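/- **Setting.** Let $V$ be a real separable Hilbert space and $A$ a strictly negative operator on $V$ with compact inverse: there are a complete orthonormal basis $(e_i)_{i\in\mathbb N}$ of $V$ and numbers $\lambda_i>0$, $\lambda_i\to\infty$, with $Ae_i=-\lambda_ie_i$. Let $S(t)x=\sum_i e^{-\lambda_i t}(e_i,x)e_i$ be the semigroup generated by $A$. For $\delta\in[0,1]$ let $V_\delta=D((-A)^\delta)$ with norm $|x|_{V_\delta}=|(-A)^\delta x|$. Let $V\otimes V$ be the Hilbert tensor product, and let $L_2(H,K)$ be the space of Hilbert–Schmidt operators with the Hilbert–Schmidt norm. Assume $$\sum_{i}\lambda_i^{-1-2\delta}<\infty .$$ Let $T>0$ and let $\omega:[0,T]\to V$ be a smooth path: continuous and, off finitely many points, continuously differentiable with bounded derivative $\omega'$. Let $F:V\to V$ be Lipschitz. Let $G:V\to L_2(V,V_\delta)$ be Lipschitz and twice continuously Fréchet differentiable, with $DG(x)(h,k)=DG(x)(h\otimes k)$ for some $DG(x)\in L_2(V\otimes V,V_\delta)$ and with $x\mapsto DG(x)\in L_2(V\otimes V,V_\delta)$ Lipschitz. Let $u_0\in V_\delta$ and let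 $u\in C([0,T];V)$ be a mild solution, i.e. for $t\in[0,T]$ $$u(t)=S(t)u_0+\int_0^tS(t-r)F(u(r))\,dr+\int_0^tS(t-r)G(u(r))\omega'(r)\,dr .$$ Let $\tfrac12<\alpha<1$. **Fractional derivatives.** For $0<\kappa<1$, a function $g$, a two-parameter function $v$, a differentiable map $f$ and a path $y$, put (in real form, without factors $(-1)^{\kappa}$) $$D_{a+}^{\kappa}g[r]=\tfrac1{\Gamma(1-\kappa)}\Big(\tfrac{g(r)}{(r-a)^\kappa}+\kappa\int_a^r\tfrac{g(r)-g(q)}{(r-q)^{1+\kappa}}dq\Big),\qquad D_{b-}^{\kappa}g[r]=\tfrac1{\Gamma(1-\kappa)}\Big(\tfrac{g(r)}{(b-r)^\kappa}+\kappa\int_r^b\tfrac{g(r)-g(q)}{(q-r)^{1+\kappa}}dq\Big),$$ $$\mathcal D_{b-}^{\kappa}v[r]=\tfrac1{\Gamma(1-\kappa)}\Big(\tfrac{v(r,b)}{(b-r)^\kappa}+\kappa\int_r^b\tfrac{v(r,\tau)}{(\tau-r)^{1+\kappa}}d\tau\Big),$$ $$\hat D_{a+}^{\kappa}f(y)[r]=\tfrac1{\Gamma(1-\kappa)}\Big(\tfrac{f(y(r))}{(r-a)^\kappa}+\kappa\int_a^r\tfrac{f(y(r))-f(y(q))-Df(y(q))(y(r)-y(q))}{(r-q)^{1+\kappa}}dq\Big),$$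 and $g_{b-}=g-g(b)$. **Tensors.** For $x\in V_\delta$, $E\in L_2(V,V_\delta)$, $\tilde E\in L_2(V\otimes V,V_\delta)$ put $$(u\otimes\omega)(s,t)=\int_s^t(u(\tau)-u(s))\otimes\omega'(\tau)\,d\tau,\qquad \omega_S(s,t)x=\int_s^t (S(\xi-s)x)\otimes\omega'(\xi)\,d\xi,$$ $$E(\omega\otimes_S\omega)(s,t)=\int_s^t\Big(\int_s^\xi S(\xi-r)E\omega'(r)\,dr\Big)\otimes\omega'(\xi)\,d\xi,$$ $$\tilde E(u\otimes(\omega\otimes_S\omega)(t))(s,r)=-\int_s^r\int_q^tS(\xi-q)\tilde E\big((u(q)-u(s))\otimes\omega'(q)\big)\otimes\omega'(\xi)\,d\xi\,dq,$$ $$E(\omega_S(t)\otimes\omega)(s,\tau)=\int_s^\tau(\omega_S(r,t)-\omega_S(s,t))E\omega'(r)\,dr .$$ They are regarded as operators acting on $x$, $E$, $\tilde E$. **Statement.** (0) For $0\le s\le r\le t\le T$, $(\omega\otimes_S\omega)(s,t)\in L_2(L_2(V,V_\delta),V\otimes V)$ and $(u\otimes(\omega\otimes_S\omega)(t))(s,r)\in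 L_2(L_2(V\otimes V,V_\delta),V\otimes V)$. (1) For $0\le s\le t\le T$, $$\begin{aligned}(u\otimes\omega)(s,t)={}&\int_s^t(S(\xi-s)-\mathrm{id})u(s)\otimes\omega'(\xi)\,d\xi+\int_s^t\int_s^\xi S(\xi-r)F(u(r))\,dr\otimes\omega'(\xi)\,d\xi\\&+\int_s^t\hat D_{s+}^{\alpha}G(u)[r]\;D_{t-}^{1-\alpha}(\omega\otimes_S\omega)(\cdot,t)_{t-}[r]\,dr\\&-\int_s^tD_{s+}^{2\alpha-1}DG(u(\cdot))[r]\;D_{t-}^{1-\alpha}\mathcal D_{t-}^{1-\alpha}(u\otimes(\omega\otimes_S\omega)(t))[r]\,dr,\end{aligned}$$ where in the last two integrals the operator-valued right-hand factor is applied to the left-hand factor. (2) For $E\in L_2(V,V_\delta)$ and $0\le s\le\tau\le t\le T$, $\int_s^\tau S(\tau-r)E\omega'(r)\,dr\in V_\delta$ and $$E(\omega_S(t)\otimes\omega)(s,\tau)=\omega_S(\tau,t)\int_s^\tau S(\tau-r)E\omega'(r)\,dr+E(\omega\otimes_S\omega)(s,\tau)-\omega_S(s,t)E(\omega(\tau)-\omega(s)).$$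 (3) For $\tilde E\in L_2(V\otimes V,V_\delta)$ and $0\le s\le q\le t\le T$, $$\begin{aligned}\tilde E(u\otimes(\omega\otimes_S\omega)(t))(s,q)={}&-\int_s^q\omega_S(r,t)\tilde E\big((u(r)-u(s))\otimes\omega'(r)\big)\,dr\\={}&\int_s^q\hat D_{s+}^{\alpha}\big[\omega_S(\cdot,t)\tilde E((u(\cdot)-u(s))\otimes\,\cdot\,)\big][r]\;D_{q-}^{1-\alpha}\omega_{q-}[r]\,dr\\&-\int_s^qD_{s+}^{2\alpha-1}\tilde E((u(\cdot)-u(s))\otimes\,\cdot\,)[r]\;D_{q-}^{1-\alpha}\mathcal D_{q-}^{1-\alpha}(\omega_S(t)\otimes\omega)[r]\,dr\\&-\int_s^qD_{s+}^{2\alpha-1}\omega_S(\cdot,t)[r]\;\tilde E\,D_{q-}^{1-\alpha}\mathcal D_{q-}^{1-\alpha}(u\otimes\omega)[r]\,dr,\end{aligned}$$ where the compensated derivative is that of the map $f_{\tilde E}:L(V_\delta,V\otimes V)\times V\to L(V,V\otimes V)$, $f_{\tilde E}(Q,x)=Q\tilde E(x\otimes\cdot)$, along the path $r\mapsto(\omega_S(r,t),u(r)-u(s))$,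 and in the integral containing $(\omega_S(t)\otimes\omega)$ that operator-valued factor is applied to the left-hand factor. All integrals involving fractional derivatives in (1) and (3) converge absolutely, and so do the integrals defining these fractional derivatives at every interior point $r$ of the interval of integration. -/

import Mathlib

open MeasureTheory Set Filter Topology
open scoped TensorProduct NNReal ENNReal

noncomputable section

/-! ### Hilbert--Schmidt operators between real Hilbert spaces -/

section HilbertSchmidt

variable (H : Type*) [NormedAddCommGroup H] [InnerProductSpace ℝ H] [CompleteSpace H]
variable (K : Type*) [NormedAddCommGroup K] [InnerProductSpace ℝ K]

/-- Index set of a fixed complete orthonormal basis of `H`. -/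
def hsIndex : Set H := (exists_hilbertBasis ℝ H).choose

/-- A fixed complete orthonormal basis of `H`. -/
def hsBasis : HilbertBasis (hsIndex H) ℝ H := (exists_hilbertBasis ℝ H).choose_spec.choose

variable {H K}

/-- `T` is Hilbert--Schmidt: `∑ ‖T bᵢ‖² < ∞` for a complete orthonormal basis `(bᵢ)` of `H`
(the sum does not depend on the basis, see `isHS_iff`). -/
def IsHS (T : H →L[ℝ] K) : Prop := Summable fun i => ‖T (hsBasis H i)‖ ^ 2

theorem isHS_iff_memℓp (T : H →L[ℝ] K) :
    IsHS T ↔ Memℓp (fun i => T (hsBasis H i)) 2 := by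
  rw [memℓp_gen_iff (by norm_num)]
  simp [IsHS]

variable (H K)

/-- Hilbert--Schmidt operators as a linear subspace of the bounded operators. -/
def hsSubmodule : Submodule ℝ (H →L[ℝ] K) where
  carrier := {T | IsHS T}
  zero_mem' := by simp [IsHS, summable_zero]
  add_mem' := by
    intro S T hS hT
    rw [mem_ofPred_eq, isHS_iff_memℓp] at *
    exact hS.add hT
  smul_mem' := by
    intro c T hT
    rw [mem_ofPred_eq, isHS_iff_memℓp] at *
    exact hT.const_smul c

/-- The space `L₂(H, K)` of Hilbert--Schmidt operators. It carries the Hilbert--Schmidt norm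
`‖T‖² = ∑ ‖T bᵢ‖²` (not the operator norm), see the instances below. -/
def HSOp : Type _ := ↥(hsSubmodule H K)

namespace HSOp

instance : AddCommGroup (HSOp H K) := inferInstanceAs (AddCommGroup ↥(hsSubmodule H K))
instance : Module ℝ (HSOp H K) := inferInstanceAs (Module ℝ ↥(hsSubmodule H K))

variable {H K}

/-- The bounded operator underlying a Hilbert--Schmidt operator. -/
def op (T : HSOp H K) : H →L[ℝ] K := (hsSubmodule H K).subtype T

/-- A bounded Hilbert--Schmidt operator as an element of `L₂(H, K)`. -/
def mk (T : H →L[ℝ] K) (hT : IsHS T) : HSOp H K := ⟨T, hT⟩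

theorem op_isHS (T : HSOp H K) : IsHS T.op := T.2

@[simp] theorem op_mk (T : H →L[ℝ] K) (hT : IsHS T) : (mk T hT).op = T := rfl

theorem op_injective : Function.Injective (op : HSOp H K → H →L[ℝ] K) :=
  Subtype.val_injective

variable (H K)

/-- `T ↦ (T bᵢ)ᵢ`, from `L₂(H, K)` to the Hilbert sum `ℓ²(K)`. -/
def toLp : HSOp H K →ₗ[ℝ] lp (fun _ : hsIndex H => K) 2 where
  toFun T := ⟨fun i => T.op (hsBasis H i), (isHS_iff_memℓp _).1 T.op_isHS⟩
  map_add' _ _ := rfl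
  map_smul' _ _ := rfl

theorem toLp_injective : Function.Injective (toLp H K) := by
  intro S T h
  apply op_injective
  apply ContinuousLinearMap.ext_on
    (by simpa using Submodule.dense_iff_topologicalClosure_eq_top.2 (hsBasis H).dense_span)
  rintro _ ⟨i, rfl⟩
  exact congrFun (congrArg Subtype.val h) i

instance : NormedAddCommGroup (HSOp H K) :=
  NormedAddCommGroup.induced _ _ (toLp H K) (toLp_injective H K)

instance : InnerProductSpace ℝ (HSOp H K) := InnerProductSpace.induced (toLp H K)

variable {H K}

theorem norm_sq_eq (T : HSOp H K) : ‖T‖ ^ 2 = ∑' i, ‖T.op (hsBasis H i)‖ ^ 2 := by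
  have h := lp.norm_rpow_eq_tsum (p := 2) (by norm_num) (toLp H K T)
  have h' : ‖toLp H K T‖ ^ 2 = ∑' i, ‖T.op (hsBasis H i)‖ ^ 2 := by
    simp only [ENNReal.toReal_ofNat, Real.rpow_ofNat] at h
    exact h
  exact h'

theorem norm_apply_le (T : HSOp H K) (x : H) : ‖T.op x‖ ≤ ‖T‖ * ‖x‖ := by
  have hx := (hsBasis H).hasSum_repr x
  have hT := hx.mapL T.op
  refine le_of_tendsto hT.norm (Eventually.of_forall fun s => ?_)
  have h1 : ‖∑ i ∈ s, T.op ((hsBasis H).repr x i • hsBasis H i)‖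
      ≤ ∑ i ∈ s, |(hsBasis H).repr x i| * ‖T.op (hsBasis H i)‖ := by
    refine (norm_sum_le _ _).trans (le_of_eq ?_)
    refine Finset.sum_congr rfl fun i _ => ?_
    rw [map_smul, norm_smul, Real.norm_eq_abs]
  refine h1.trans ?_
  have h2 := Finset.sum_mul_sq_le_sq_mul_sq s
    (fun i => |(hsBasis H).repr x i|) (fun i => ‖T.op (hsBasis H i)‖)
  have h3 : ∑ i ∈ s, |(hsBasis H).repr x i| ^ 2 ≤ ‖x‖ ^ 2 := by
    have := (hsBasis H).orthonormal.sum_inner_products_le (x := x) (s := s)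
    simpa [HilbertBasis.repr_apply_apply] using this
  have h4 : ∑ i ∈ s, ‖T.op (hsBasis H i)‖ ^ 2 ≤ ‖T‖ ^ 2 := by
    rw [norm_sq_eq]
    exact T.op_isHS.sum_le_tsum s (fun _ _ => by positivity)
  apply le_of_sq_le_sq _ (by positivity)
  calc _ ≤ _ := h2
    _ ≤ ‖x‖ ^ 2 * ‖T‖ ^ 2 := by gcongr
    _ = (‖T‖ * ‖x‖) ^ 2 := by ring

variable (H K)

/-- The inclusion `L₂(H, K) ⊂ L(H, K)`. -/
def opL : HSOp H K →L[ℝ] (H →L[ℝ] K) :=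
  LinearMap.mkContinuous ((hsSubmodule H K).subtype : HSOp H K →ₗ[ℝ] (H →L[ℝ] K)) 1
    (fun T => by
      rw [one_mul]
      exact ContinuousLinearMap.opNorm_le_bound _ (norm_nonneg _) (norm_apply_le T))

theorem opL_apply (T : HSOp H K) : opL H K T = T.op := rfl

instance [CompleteSpace K] : CompleteSpace (HSOp H K) := by
  refine Metric.complete_of_cauchySeq_tendsto fun T hT => ?_
  have hiso : Isometry (toLp H K) :=
    AddMonoidHomClass.isometry_of_norm (toLp H K) (fun _ => rfl)
  obtain ⟨f, hf⟩ := cauchySeq_tendsto_of_complete (hiso.uniformContinuous.comp_cauchySeq hT)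
  obtain ⟨S, hS⟩ := cauchySeq_tendsto_of_complete
    ((opL H K).uniformContinuous.comp_cauchySeq hT)
  have key : ∀ i, S (hsBasis H i) = f i := by
    intro i
    have h1 : Tendsto (fun n => (T n).op (hsBasis H i)) atTop (𝓝 (S (hsBasis H i))) :=
      ((ContinuousLinearMap.apply ℝ K (hsBasis H i)).continuous.tendsto S).comp hS
    have h2 : Tendsto (fun n => (T n).op (hsBasis H i)) atTop (𝓝 (f i)) :=
      ((lp.evalCLM ℝ (fun _ : hsIndex H => K) 2 i).continuous.tendsto f).comp hf
    exact tendsto_nhds_unique h1 h2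
  have hSm : IsHS S := by
    rw [isHS_iff_memℓp]
    convert lp.memℓp f using 1
    exact funext key
  refine ⟨mk S hSm, ?_⟩
  have hval : toLp H K (mk S hSm) = f := by
    ext i
    exact key i
  rw [hiso.isUniformInducing.isInducing.tendsto_nhds_iff, hval]
  exact hf


end HSOp

variable {H K}

theorem parseval_nnnorm {E ν : Type*} [NormedAddCommGroup E] [InnerProductSpace ℝ E]
    (d : HilbertBasis ν ℝ E) (x : E) :
    ((‖x‖₊ ^ 2 : ℝ≥0) : ℝ≥0∞) = ∑' k, ((‖inner ℝ x (d k)‖₊ ^ 2 : ℝ≥0) : ℝ≥0∞) := by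
  have h := d.hasSum_inner_mul_inner x x
  have h' : HasSum (fun k => (‖inner ℝ x (d k)‖₊ ^ 2 : ℝ≥0)) (‖x‖₊ ^ 2) := by
    rw [← NNReal.hasSum_coe]
    push_cast
    rw [← real_inner_self_eq_norm_sq]
    have hk : ∀ k, ‖inner ℝ x (d k)‖ ^ 2 = inner ℝ x (d k) * inner ℝ (d k) x := by
      intro k
      rw [real_inner_comm x (d k), Real.norm_eq_abs, sq_abs, sq]
    simp_rw [hk]
    exact h
  exact (ENNReal.hasSum_coe.2 h').tsum_eq.symm

/-- The Hilbert--Schmidt sums of `T` and of its adjoint agree, for arbitrary complete orthonormal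
bases. -/
theorem tsum_sq_eq_adjoint [CompleteSpace K] {ι κ : Type*} (b : HilbertBasis ι ℝ H)
    (c : HilbertBasis κ ℝ K) (T : H →L[ℝ] K) :
    ∑' i, ((‖T (b i)‖₊ ^ 2 : ℝ≥0) : ℝ≥0∞)
      = ∑' k, ((‖ContinuousLinearMap.adjoint T (c k)‖₊ ^ 2 : ℝ≥0) : ℝ≥0∞) := by
  simp_rw [fun i => parseval_nnnorm c (T (b i)),
    fun k => parseval_nnnorm b (ContinuousLinearMap.adjoint T (c k))]
  rw [ENNReal.tsum_comm]
  simp_rw [ContinuousLinearMap.adjoint_inner_left, real_inner_comm (T _)]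

theorem isHS_iff_tsum (T : H →L[ℝ] K) :
    IsHS T ↔ ∑' i, ((‖T (hsBasis H i)‖₊ ^ 2 : ℝ≥0) : ℝ≥0∞) ≠ ⊤ := by
  rw [ENNReal.tsum_coe_ne_top_iff_summable, IsHS, ← NNReal.summable_coe]
  rfl

/-- The Hilbert--Schmidt property can be tested on any complete orthonormal basis. -/
theorem isHS_iff [CompleteSpace K] {ι : Type*} (b : HilbertBasis ι ℝ H) (T : H →L[ℝ] K) :
    IsHS T ↔ Summable fun i => ‖T (b i)‖ ^ 2 := by
  rw [isHS_iff_tsum, tsum_sq_eq_adjoint _ (hsBasis K), ← tsum_sq_eq_adjoint b,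
    ENNReal.tsum_coe_ne_top_iff_summable, ← NNReal.summable_coe]
  rfl

/-- A Hilbert--Schmidt operator composed with a bounded operator is Hilbert--Schmidt. -/
theorem IsHS.comp [CompleteSpace K] {L : Type*} [NormedAddCommGroup L] [InnerProductSpace ℝ L]
    [CompleteSpace L] {T : H →L[ℝ] K} (hT : IsHS T) (B : L →L[ℝ] H) : IsHS (T ∘L B) := by
  rw [isHS_iff_tsum, tsum_sq_eq_adjoint _ (hsBasis K)] at *
  refine ne_top_of_le_ne_top
    (ENNReal.mul_ne_top (a := ((‖ContinuousLinearMap.adjoint B‖₊ ^ 2 : ℝ≥0) : ℝ≥0∞))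
      ENNReal.coe_ne_top hT) ?_
  rw [← ENNReal.tsum_mul_left]
  refine ENNReal.tsum_le_tsum fun k => ?_
  rw [ContinuousLinearMap.adjoint_comp, ← ENNReal.coe_mul, ENNReal.coe_le_coe, ← mul_pow]
  gcongr
  exact (ContinuousLinearMap.adjoint B).le_opNNNorm _

namespace HSOp

/-- Composition `T ∘ B` of `T ∈ L₂(H, K)` with a bounded operator `B`. -/
def comp [CompleteSpace K] {L : Type*} [NormedAddCommGroup L] [InnerProductSpace ℝ L]
    [CompleteSpace L] (T : HSOp H K) (B : L →L[ℝ] H) : HSOp L K :=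
  mk (T.op ∘L B) (T.op_isHS.comp B)

/-- Evaluation `T ↦ T x` at a point, as a bounded operator on `L₂(H, K)`. -/
def evalL (x : H) : HSOp H K →L[ℝ] K := (ContinuousLinearMap.apply ℝ K x) ∘L (opL H K)

theorem evalL_apply (x : H) (T : HSOp H K) : evalL x T = T.op x := rfl

end HSOp

end HilbertSchmidt

/-! ### The Hilbert tensor product `V ⊗ V` -/

/-- The Hilbert space tensor product `V ⊗ V`, the completion of the algebraic tensor product with
respect to the inner product `⟪a ⊗ b, c ⊗ d⟫ = ⟪a, c⟫ ⟪b, d⟫`. -/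
abbrev HTensor (V : Type*) [NormedAddCommGroup V] [InnerProductSpace ℝ V] : Type _ :=
  UniformSpace.Completion (V ⊗[ℝ] V)

/-- The elementary tensor `x ⊗ y` as a bounded bilinear map. -/
def tens (V : Type*) [NormedAddCommGroup V] [InnerProductSpace ℝ V] : V →L[ℝ] V →L[ℝ] HTensor V :=
  (ContinuousLinearMap.compL ℝ V (V ⊗[ℝ] V) (HTensor V) UniformSpace.Completion.toComplL) ∘L
    (TensorProduct.mkL ℝ V V)

/-! ### The operator `A`, its semigroup and the spaces `V_δ` -/

/-- A strictly negative operator `A` with compact inverse on `V`, given by its eigendata: a complete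
orthonormal basis `(eᵢ)` of `V` and numbers `λᵢ > 0`, `λᵢ → ∞`, with `A eᵢ = -λᵢ eᵢ`. So
`A x = -∑ λᵢ ⟪eᵢ, x⟫ eᵢ` on the domain of all `x` with `∑ λᵢ² ⟪eᵢ, x⟫² < ∞`. -/
structure EigenData (V : Type*) [NormedAddCommGroup V] [InnerProductSpace ℝ V] where
  e : HilbertBasis ℕ ℝ V
  lam : ℕ → ℝ
  lam_pos : ∀ i, 0 < lam i
  lam_tendsto : Tendsto lam atTop atTop

namespace EigenData

variable {V : Type*} [NormedAddCommGroup V] [InnerProductSpace ℝ V] (D : EigenData V)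

theorem abs_exp_mul_le (t : ℝ) (a : ℝ) (i : ℕ) :
    ‖Real.exp (-(D.lam i * max t 0)) * a‖ ≤ ‖a‖ := by
  rw [norm_mul, Real.norm_eq_abs, Real.abs_exp]
  refine mul_le_of_le_one_left (norm_nonneg _) (Real.exp_le_one_iff.2 ?_)
  have := mul_nonneg (D.lam_pos i).le (le_max_right t 0)
  linarith

theorem semigroup_memℓp (t : ℝ) (x : V) :
    Memℓp (fun i => Real.exp (-(D.lam i * max t 0)) * D.e.repr x i) 2 :=
  (lp.memℓp (D.e.repr x)).mono' fun i => D.abs_exp_mul_le t _ i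

/-- The analytic semigroup generated by `A`: `S(t) x = ∑ exp(-λᵢ t) ⟪eᵢ, x⟫ eᵢ` for `t ≥ 0`
(and `S(t) = id` for `t < 0`, a value that is never used). -/
def S (t : ℝ) : V →L[ℝ] V :=
  LinearMap.mkContinuous
    { toFun := fun x => D.e.repr.symm
        (⟨fun i => Real.exp (-(D.lam i * max t 0)) * D.e.repr x i, D.semigroup_memℓp t x⟩ :
          lp (fun _ : ℕ => ℝ) 2)
      map_add' := by
        intro x y
        rw [← map_add]
        congr 1
        ext i
        change _ * D.e.repr (x + y) i = _ * D.e.repr x i + _ * D.e.repr y i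
        rw [map_add, lp.coeFn_add, Pi.add_apply, mul_add]
      map_smul' := by
        intro c x
        rw [← map_smul]
        congr 1
        ext i
        simp [mul_left_comm] } 1 (by
    intro x
    rw [one_mul, ← D.e.repr.norm_map x]
    refine (D.e.repr.symm.norm_map _).trans_le ?_
    exact lp.norm_mono (by norm_num) fun i => D.abs_exp_mul_le t _ i)

variable (δ : ℝ≥0)

/-- The domain of `(-A)^δ`: all `x` with `∑ (λᵢ^δ ⟪eᵢ, x⟫)² < ∞`. -/
def fracDomain : Submodule ℝ V where
  carrier := {x | Memℓp (fun i => D.lam i ^ (δ : ℝ) * inner ℝ (D.e i) x) 2}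
  zero_mem' := by
    have h : (fun i => D.lam i ^ (δ : ℝ) * inner ℝ (D.e i) (0 : V)) = 0 := by
      funext i
      simp
    rw [mem_ofPred_eq, h]
    exact zero_memℓp
  add_mem' := by
    intro x y hx hy
    rw [mem_ofPred_eq] at *
    convert hx.add hy using 1
    funext i
    simp [inner_add_right, mul_add]
  smul_mem' := by
    intro c x hx
    rw [mem_ofPred_eq] at *
    convert hx.const_smul c using 1
    funext i
    simp [inner_smul_right, mul_left_comm]

/-- The Hilbert space `V_δ = D((-A)^δ)` with norm `|x|_{V_δ} = |(-A)^δ x|`, that is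
`|x|² = ∑ (λᵢ^δ ⟪eᵢ, x⟫)²`. -/
def Vd : Type _ := ↥(D.fracDomain δ)

namespace Vd

instance : AddCommGroup (D.Vd δ) := inferInstanceAs (AddCommGroup ↥(D.fracDomain δ))
instance : Module ℝ (D.Vd δ) := inferInstanceAs (Module ℝ ↥(D.fracDomain δ))

/-- The underlying vector of `V`. -/
def val : D.Vd δ →ₗ[ℝ] V := (D.fracDomain δ).subtype

theorem val_injective : Function.Injective (val D δ) := Subtype.val_injective

theorem memℓp (x : D.Vd δ) :
    Memℓp (fun i => D.lam i ^ (δ : ℝ) * inner ℝ (D.e i) (val D δ x)) 2 := x.2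

/-- A vector in the domain of `(-A)^δ` as an element of `V_δ`. -/
def mk (x : V) (hx : Memℓp (fun i => D.lam i ^ (δ : ℝ) * inner ℝ (D.e i) x) 2) : D.Vd δ :=
  (⟨x, hx⟩ : ↥(D.fracDomain δ))

/-- The coordinates `(λᵢ^δ ⟪eᵢ, x⟫)ᵢ` of `(-A)^δ x`. -/
def toLp : D.Vd δ →ₗ[ℝ] lp (fun _ : ℕ => ℝ) 2 where
  toFun x := ⟨fun i => D.lam i ^ (δ : ℝ) * inner ℝ (D.e i) (val D δ x), memℓp D δ x⟩
  map_add' x y := by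
    ext i
    change _ * inner ℝ _ (val D δ x + val D δ y) = _
    rw [inner_add_right, mul_add]
    rfl
  map_smul' c x := by
    ext i
    simp [inner_smul_right, mul_left_comm]

theorem toLp_apply (x : D.Vd δ) (i : ℕ) :
    toLp D δ x i = D.lam i ^ (δ : ℝ) * inner ℝ (D.e i) (val D δ x) := rfl

theorem inner_eq (x : D.Vd δ) (i : ℕ) :
    inner ℝ (D.e i) (val D δ x) = D.lam i ^ (-(δ : ℝ)) * toLp D δ x i := by
  rw [toLp_apply, ← mul_assoc, ← Real.rpow_add (D.lam_pos i), neg_add_cancel, Real.rpow_zero,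
    one_mul]

theorem toLp_injective : Function.Injective (toLp D δ) := by
  intro x y h
  apply val_injective
  apply D.e.repr.injective
  ext i
  rw [HilbertBasis.repr_apply_apply, HilbertBasis.repr_apply_apply, inner_eq, inner_eq, h]

instance : NormedAddCommGroup (D.Vd δ) :=
  NormedAddCommGroup.induced _ _ (toLp D δ) (toLp_injective D δ)

instance : InnerProductSpace ℝ (D.Vd δ) := InnerProductSpace.induced (toLp D δ)

theorem exists_bound : ∃ C : ℝ, 0 ≤ C ∧ ∀ i, D.lam i ^ (-(δ : ℝ)) ≤ C := by
  obtain ⟨n, hn⟩ := (D.lam_tendsto.eventually_ge_atTop 1).exists_forall_of_atTop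
  refine ⟨1 + ∑ i ∈ Finset.range n, D.lam i ^ (-(δ : ℝ)), ?_, fun i => ?_⟩
  · exact add_nonneg zero_le_one
      (Finset.sum_nonneg fun i _ => (Real.rpow_pos_of_pos (D.lam_pos i) _).le)
  · rcases lt_or_ge i n with h | h
    · have := Finset.single_le_sum (f := fun i => D.lam i ^ (-(δ : ℝ)))
        (fun i _ => (Real.rpow_pos_of_pos (D.lam_pos i) _).le) (Finset.mem_range.2 h)
      linarith
    · have h1 : D.lam i ^ (-(δ : ℝ)) ≤ 1 :=
        Real.rpow_le_one_of_one_le_of_nonpos (hn i h) (by simp)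
      have h2 : 0 ≤ ∑ i ∈ Finset.range n, D.lam i ^ (-(δ : ℝ)) :=
        Finset.sum_nonneg fun i _ => (Real.rpow_pos_of_pos (D.lam_pos i) _).le
      linarith

theorem exists_norm_val_le : ∃ C : ℝ, ∀ x, ‖val D δ x‖ ≤ C * ‖x‖ := by
  obtain ⟨C, hC, h⟩ := exists_bound D δ
  refine ⟨C, fun x => ?_⟩
  rw [← D.e.repr.norm_map]
  change _ ≤ C * ‖toLp D δ x‖
  rw [← Real.norm_of_nonneg hC, ← norm_smul]
  refine lp.norm_mono (by norm_num) fun i => ?_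
  rw [HilbertBasis.repr_apply_apply, inner_eq, lp.coeFn_smul, Pi.smul_apply, norm_mul, norm_smul,
    Real.norm_of_nonneg hC, Real.norm_of_nonneg (Real.rpow_pos_of_pos (D.lam_pos i) _).le]
  gcongr
  exact h i

/-- The bounded inclusion `V_δ ⊂ V`. -/
def incl : D.Vd δ →L[ℝ] V :=
  (val D δ).mkContinuousOfExistsBound (exists_norm_val_le D δ)

theorem incl_apply (x : D.Vd δ) : incl D δ x = val D δ x := rfl

instance [CompleteSpace V] : CompleteSpace (D.Vd δ) := by
  refine Metric.complete_of_cauchySeq_tendsto fun x hx => ?_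
  have hiso : Isometry (toLp D δ) :=
    AddMonoidHomClass.isometry_of_norm (toLp D δ) (fun _ => rfl)
  obtain ⟨f, hf⟩ := cauchySeq_tendsto_of_complete (hiso.uniformContinuous.comp_cauchySeq hx)
  obtain ⟨y, hy⟩ := cauchySeq_tendsto_of_complete
    ((incl D δ).uniformContinuous.comp_cauchySeq hx)
  have key : ∀ i, D.lam i ^ (δ : ℝ) * inner ℝ (D.e i) y = f i := by
    intro i
    have h1 : Tendsto (fun n => D.lam i ^ (δ : ℝ) * inner ℝ (D.e i) (val D δ (x n))) atTop
        (𝓝 (D.lam i ^ (δ : ℝ) * inner ℝ (D.e i) y)) :=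
      ((tendsto_const_nhds.inner hy).const_mul _)
    have h2 : Tendsto (fun n => D.lam i ^ (δ : ℝ) * inner ℝ (D.e i) (val D δ (x n))) atTop
        (𝓝 (f i)) :=
      ((lp.evalCLM ℝ (fun _ : ℕ => ℝ) 2 i).continuous.tendsto f).comp hf
    exact tendsto_nhds_unique h1 h2
  have hmem : Memℓp (fun i => D.lam i ^ (δ : ℝ) * inner ℝ (D.e i) y) 2 := by
    convert lp.memℓp f using 1
    exact funext key
  refine ⟨mk D δ y hmem, ?_⟩
  rw [hiso.isUniformInducing.isInducing.tendsto_nhds_iff]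
  convert hf using 2
  ext i
  exact key i

end Vd

end EigenData

/-! ### Fractional derivatives

All derivatives are taken in the real form, without the unimodular factors `(-1)^κ` that are
sometimes attached to the right-sided derivatives; in every product the total power of `-1` is an
integer, and it is written as an explicit sign. -/

section Fractional

variable {E : Type*} [NormedAddCommGroup E] [NormedSpace ℝ E]
variable {X : Type*} [NormedAddCommGroup X] [NormedSpace ℝ X]

/-- Left-sided Weyl derivative `D_{a+}^κ g[r]`. -/
def leftFrac (κ a : ℝ) (g : ℝ → E) (r : ℝ) : E :=
  (Real.Gamma (1 - κ))⁻¹ •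
    ((r - a) ^ (-κ) • g r + κ • ∫ q in a..r, (r - q) ^ (-(1 + κ)) • (g r - g q))

/-- The integral in `leftFrac` converges absolutely. -/
def LeftFracExists (κ a : ℝ) (g : ℝ → E) (r : ℝ) : Prop :=
  IntervalIntegrable (fun q => (r - q) ^ (-(1 + κ)) • (g r - g q)) volume a r

/-- Right-sided Weyl derivative `D_{b-}^κ g[r]`. -/
def rightFrac (κ b : ℝ) (g : ℝ → E) (r : ℝ) : E :=
  (Real.Gamma (1 - κ))⁻¹ •
    ((b - r) ^ (-κ) • g r + κ • ∫ q in r..b, (q - r) ^ (-(1 + κ)) • (g r - g q))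

/-- The integral in `rightFrac` converges absolutely. -/
def RightFracExists (κ b : ℝ) (g : ℝ → E) (r : ℝ) : Prop :=
  IntervalIntegrable (fun q => (q - r) ^ (-(1 + κ)) • (g r - g q)) volume r b

/-- Right-sided fractional derivative `𝓓_{b-}^κ v[r]` of a two-parameter function `v(r, τ)`. -/
def rightFracTwo (κ b : ℝ) (v : ℝ → ℝ → E) (r : ℝ) : E :=
  (Real.Gamma (1 - κ))⁻¹ •
    ((b - r) ^ (-κ) • v r b + κ • ∫ τ in r..b, (τ - r) ^ (-(1 + κ)) • v r τ)

/-- The integral in `rightFracTwo` converges absolutely. -/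
def RightFracTwoExists (κ b : ℝ) (v : ℝ → ℝ → E) (r : ℝ) : Prop :=
  IntervalIntegrable (fun τ => (τ - r) ^ (-(1 + κ)) • v r τ) volume r b

/-- Compensated left-sided fractional derivative of `f ∘ y` at `r`, for a differentiable map `f`
and a path `y`. -/
def compFrac (κ a : ℝ) (f : X → E) (y : ℝ → X) (r : ℝ) : E :=
  (Real.Gamma (1 - κ))⁻¹ •
    ((r - a) ^ (-κ) • f (y r) + κ • ∫ q in a..r,
      (r - q) ^ (-(1 + κ)) • (f (y r) - f (y q) - fderiv ℝ f (y q) (y r - y q)))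

/-- The integral in `compFrac` converges absolutely. -/
def CompFracExists (κ a : ℝ) (f : X → E) (y : ℝ → X) (r : ℝ) : Prop :=
  IntervalIntegrable (fun q =>
    (r - q) ^ (-(1 + κ)) • (f (y r) - f (y q) - fderiv ℝ f (y q) (y r - y q))) volume a r

end Fractional

/-! ### Smooth paths, mild solutions and the tensors -/

section Equation

variable {V : Type*} [NormedAddCommGroup V] [InnerProductSpace ℝ V]

/-- `ω` is continuous on `[0, T]` and, off finitely many points, continuously differentiable with
bounded derivative. -/
def SmoothPath (T : ℝ) (ω : ℝ → V) : Prop :=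
  ContinuousOn ω (Icc 0 T) ∧ ∃ N : Set ℝ, N.Finite ∧ ContDiffOn ℝ 1 ω (Ioo 0 T \ N) ∧
    ∃ M : ℝ, ∀ t ∈ Ioo 0 T \ N, ‖deriv ω t‖ ≤ M

/-- `(u ⊗ ω)(s, t) = ∫_s^t (u(τ) - u(s)) ⊗ ω'(τ) dτ`. -/
def area (u ω : ℝ → V) (s t : ℝ) : HTensor V :=
  ∫ τ in s..t, tens V (u τ - u s) (deriv ω τ)

variable [CompleteSpace V] (D : EigenData V) (δ : ℝ≥0)

/-- `u` is a mild solution on `[0, T]` of `du = (Au + F(u)) dt + G(u) dω`, `u(0) = u₀ ∈ V_δ`. -/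
def IsMildSolution (T : ℝ) (ω : ℝ → V) (F : V → V) (G : V → HSOp V (D.Vd δ)) (u₀ : D.Vd δ)
    (u : ℝ → V) : Prop :=
  ContinuousOn u (Icc 0 T) ∧ ∀ t ∈ Icc 0 T,
    u t = D.S t (EigenData.Vd.incl D δ u₀) + (∫ s in (0 : ℝ)..t, D.S (t - s) (F (u s)))
      + ∫ s in (0 : ℝ)..t, D.S (t - s) (EigenData.Vd.incl D δ ((G (u s)).op (deriv ω s)))

/-- `ω_S(s, t) x = ∫_s^t (S(ξ - s) x) ⊗ ω'(ξ) dξ` for `x ∈ V_δ`. -/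
def omS (ω : ℝ → V) (s t : ℝ) : D.Vd δ →L[ℝ] HTensor V :=
  ∫ ξ in s..t, (tens V).flip (deriv ω ξ) ∘L D.S (ξ - s) ∘L EigenData.Vd.incl D δ

/-- `E (ω ⊗_S ω)(s, t) = ∫_s^t (∫_s^ξ S(ξ - r) E ω'(r) dr) ⊗ ω'(ξ) dξ` for `E ∈ L₂(V, V_δ)`. -/
def omSom (ω : ℝ → V) (s t : ℝ) : HSOp V (D.Vd δ) →L[ℝ] HTensor V :=
  ∫ ξ in s..t, (tens V).flip (deriv ω ξ) ∘L
    ∫ r in s..ξ, D.S (ξ - r) ∘L EigenData.Vd.incl D δ ∘L HSOp.evalL (deriv ω r)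

/-- `E (u ⊗ (ω ⊗_S ω)(t))(s, r)
  = - ∫_s^r ∫_q^t S(ξ - q) E((u(q) - u(s)) ⊗ ω'(q)) ⊗ ω'(ξ) dξ dq` for `E ∈ L₂(V ⊗ V, V_δ)`. -/
def uomSom (u ω : ℝ → V) (t s r : ℝ) : HSOp (HTensor V) (D.Vd δ) →L[ℝ] HTensor V :=
  -∫ q in s..r, ∫ ξ in q..t, (tens V).flip (deriv ω ξ) ∘L D.S (ξ - q) ∘L
    EigenData.Vd.incl D δ ∘L HSOp.evalL (tens V (u q - u s) (deriv ω q))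

/-- `E (ω_S(t) ⊗ ω)(s, τ) = ∫_s^τ (ω_S(r, t) - ω_S(s, t)) E ω'(r) dr` for `E ∈ L₂(V, V_δ)`. -/
def omStensOm (ω : ℝ → V) (t s τ : ℝ) : HSOp V (D.Vd δ) →L[ℝ] HTensor V :=
  ∫ r in s..τ, (omS D δ ω r t - omS D δ ω s t) ∘L HSOp.evalL (deriv ω r)

variable {D δ} in
/-- The bilinear map `(Q, x) ↦ Q E(x ⊗ ·)`, for `E ∈ L₂(V ⊗ V, V_δ)`. -/
def fE (E : HSOp (HTensor V) (D.Vd δ)) (p : (D.Vd δ →L[ℝ] HTensor V) × V) :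
    V →L[ℝ] HTensor V :=
  p.1 ∘L (E.comp (tens V p.2)).op

end Equation

end

set_option linter.unusedSectionVars false

/-! Since `ω'` is bounded, every tensor is an honest Bochner integral, and each claimed formula is
an exact identity between absolutely convergent iterated integrals. Fractional derivatives only
redistribute power kernels.

Regularity: on the eigenbasis, ‖S(r) - S(q)‖ ≤ (r - q)^γ q^(-γ). Hence orbits are γ-Hölder away from
time zero with the weight q^(-γ), while convolutions of S with bounded functions are γ-Hölder. So a
mild solution lies in the class `WHolder γ` for every 0 < γ < 1. This class is stable under
Lipschitz and bilinear maps, and for γ > α its left derivatives of orders α and 2α - 1 converge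
absolutely.

First order: let g have a bounded density k and put J(r) = ∫_r^b (τ - r)^(α-1) k(τ) dτ. Then
D_{b-}^{1-α} g_{b-} = -Γ(α)⁻¹ J, and ∫ D^α y · D^{1-α} g_{b-} = -∫ y k. With the compensated
derivative of f(y) the right side becomes -∫ f(y) k + c ∫∫_{q<r} (r - q)^(-1-α) Df(y(q))(y(r) -
y(q)) J(r), where c = α / (Γ(α) Γ(1-α)) (`WHolder.compensated_parts`).

Second order: let v(r, τ) = ∫_r^τ m(y(ρ) - y(r), k(ρ)) dρ. Its derivative 𝓓^{1-α} v(r) is Γ(α)⁻¹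
∫_r^b (τ - r)^(α-1) m(y(τ) - y(r), k(τ)) dτ. Solving an Abel equation for (τ - r)^(α-1) (y(τ) -
y(r)) rewrites it as a fractional integral of order α of Ψ(ρ) = ∫_ρ^b (q - ρ)^(-1-α) m(y(q) - y(ρ),
J(q)) dq (`secondDensity`). A further D^{1-α} leaves a fractional integral of order 2α - 1, and
pairing with D^{2α-1} φ gives ∫ φ Ψ. Up to the same constant c this is the double integral of the
first order formula as soon as n(φ, m(h, ·)) is the linearisation Df(y) h
(`WHolder.second_order_parts`). Subtracting cancels it.

The area formula: the restarted mild equation and Fubini leave ∫ ω_S(r, t) G(u(r)) ω'(r) dr as the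
rough part. As a function of its first time, (ω ⊗_S ω)(·, t) has density -ω_S(r, t)(· ω'(r)), so
both formulas apply with y = u, f = G and φ = DG(u).

The third order tensor: f_E is bilinear in (ω_S(r, t), u(r) - u(s)), so its derivative has two
terms. Each is cancelled by its own second order tensor, ω_S(t) ⊗ ω and u ⊗ ω, and here g = ω.

The formula for ω_S(t) ⊗ ω is the semigroup law together with Fubini. The Hilbert–Schmidt property
follows from the bound C τ^(-1/2) for S(τ) composed with evaluation of operators into V_δ, which is
integrable in τ. -/

noncomputable section

/-! ### Fubini on a triangle -/

section Triangle

variable {E F : Type*} [NormedAddCommGroup E] [NormedSpace ℝ E] [NormedAddCommGroup F]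

/-- The open triangle `a < x < y < b`. -/
def tri (a b : ℝ) : Set (ℝ × ℝ) := {p | a < p.1 ∧ p.1 < p.2 ∧ p.2 < b}

theorem isOpen_tri (a b : ℝ) : IsOpen (tri a b) :=
  (isOpen_lt continuous_const continuous_fst).inter
    ((isOpen_lt continuous_fst continuous_snd).inter (isOpen_lt continuous_snd continuous_const))

theorem measurableSet_tri (a b : ℝ) : MeasurableSet (tri a b) := (isOpen_tri a b).measurableSet

theorem tri_subset (a b : ℝ) : tri a b ⊆ Ioo a b ×ˢ Ioo a b := fun _ hp =>
  ⟨⟨hp.1, hp.2.1.trans hp.2.2⟩, ⟨hp.1.trans hp.2.1, hp.2.2⟩⟩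

theorem aesm_tri_fst {a b : ℝ} {f : ℝ → F}
    (hf : AEStronglyMeasurable f (volume.restrict (Ioo a b))) :
    AEStronglyMeasurable (fun p : ℝ × ℝ => f p.1) (volume.restrict (tri a b)) := by
  have h := hf.comp_fst (ν := volume.restrict (Ioo a b))
  rw [Measure.prod_restrict] at h
  exact h.mono_measure (Measure.restrict_mono (tri_subset a b) le_rfl)

theorem aesm_tri_snd {a b : ℝ} {f : ℝ → F}
    (hf : AEStronglyMeasurable f (volume.restrict (Ioo a b))) :
    AEStronglyMeasurable (fun p : ℝ × ℝ => f p.2) (volume.restrict (tri a b)) := by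
  have h := hf.comp_snd (μ := volume.restrict (Ioo a b))
  rw [Measure.prod_restrict] at h
  exact h.mono_measure (Measure.restrict_mono (tri_subset a b) le_rfl)

theorem integral_tri_snd {a b : ℝ} (f : ℝ → ℝ → E) (x : ℝ) :
    ∫ y, (tri a b).indicator (fun p : ℝ × ℝ => f p.1 p.2) (x, y)
      = (Ioo a b).indicator (fun x => ∫ y in x..b, f x y) x := by
  by_cases hx : x ∈ Ioo a b
  · rw [indicator_of_mem hx, intervalIntegral.integral_of_le hx.2.le, integral_Ioc_eq_integral_Ioo,
      ← integral_indicator measurableSet_Ioo]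
    congr 1
    ext y
    by_cases hy : y ∈ Ioo x b
    · rw [indicator_of_mem hy, indicator_of_mem (show (x, y) ∈ tri a b from ⟨hx.1, hy.1, hy.2⟩)]
    · rw [indicator_of_notMem hy, indicator_of_notMem fun h => hy ⟨h.2.1, h.2.2⟩]
  · rw [indicator_of_notMem hx]
    convert integral_zero ℝ E using 3 with y
    exact indicator_of_notMem (fun h => hx ((tri_subset a b h).1)) _

theorem integral_tri_fst {a b : ℝ} (f : ℝ → ℝ → E) (y : ℝ) :
    ∫ x, (tri a b).indicator (fun p : ℝ × ℝ => f p.1 p.2) (x, y)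
      = (Ioo a b).indicator (fun y => ∫ x in a..y, f x y) y := by
  by_cases hy : y ∈ Ioo a b
  · rw [indicator_of_mem hy, intervalIntegral.integral_of_le hy.1.le, integral_Ioc_eq_integral_Ioo,
      ← integral_indicator measurableSet_Ioo]
    congr 1
    ext x
    by_cases hx : x ∈ Ioo a y
    · rw [indicator_of_mem hx, indicator_of_mem (show (x, y) ∈ tri a b from ⟨hx.1, hx.2, hy.2⟩)]
    · rw [indicator_of_notMem hx, indicator_of_notMem fun h => hx ⟨h.1, h.2.1⟩]
  · rw [indicator_of_notMem hy]
    convert integral_zero ℝ E using 3 with x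
    exact indicator_of_notMem (fun h => hy ((tri_subset a b h).2)) _

/-- Extension by zero to the plane reduces this to Fubini on the product. The integrability of the
two inner integrals is recorded because it is also how measurability of the fractional derivatives
and integrals is obtained later. -/
theorem tri_fubini {a b : ℝ} (hab : a ≤ b) {f : ℝ → ℝ → E}
    (hf : IntegrableOn (fun p : ℝ × ℝ => f p.1 p.2) (tri a b)) :
    IntervalIntegrable (fun x => ∫ y in x..b, f x y) volume a b ∧
    IntervalIntegrable (fun y => ∫ x in a..y, f x y) volume a b ∧
    ∫ x in a..b, ∫ y in x..b, f x y = ∫ y in a..b, ∫ x in a..y, f x y := by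
  have hg : Integrable ((tri a b).indicator fun p : ℝ × ℝ => f p.1 p.2)
      ((volume : Measure ℝ).prod (volume : Measure ℝ)) :=
    (integrable_indicator_iff (measurableSet_tri a b)).2 hf
  have h1 := hg.integral_prod_left
  have h2 := hg.integral_prod_right
  have h3 := integral_integral_swap (f := fun x y =>
    (tri a b).indicator (fun p : ℝ × ℝ => f p.1 p.2) (x, y)) hg
  simp only [integral_tri_fst, integral_tri_snd] at h1 h2 h3
  rw [integral_indicator measurableSet_Ioo, integral_indicator measurableSet_Ioo,
    ← integral_Ioc_eq_integral_Ioo, ← integral_Ioc_eq_integral_Ioo,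
    ← intervalIntegral.integral_of_le hab, ← intervalIntegral.integral_of_le hab] at h3
  refine ⟨?_, ?_, h3⟩
  · exact (intervalIntegrable_iff_integrableOn_Ioo_of_le hab).2
      ((integrable_indicator_iff measurableSet_Ioo).1 h1)
  · exact (intervalIntegrable_iff_integrableOn_Ioo_of_le hab).2
      ((integrable_indicator_iff measurableSet_Ioo).1 h2)

/-- Tonelli with the inner integral first: every fibre of the kernel has mass at most `C`, which
leaves the integrable function `C * g`. A kernel singular on the diagonal costs nothing beyond a
uniform mass bound. -/
theorem tri_integrable_left {a b C : ℝ} {f : ℝ → ℝ → F} {g : ℝ → ℝ} {K : ℝ → ℝ → ℝ}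
    (hf : AEStronglyMeasurable (fun p : ℝ × ℝ => f p.1 p.2) (volume.restrict (tri a b)))
    (hg : IntegrableOn g (Ioo a b)) (hg0 : ∀ x ∈ Ioo a b, 0 ≤ g x)
    (hK : ∀ x ∈ Ioo a b, IntegrableOn (K x) (Ioo x b))
    (hKC : ∀ x ∈ Ioo a b, ∫ y in Ioo x b, K x y ≤ C)
    (hfK : ∀ x y, a < x → x < y → y < b → ‖f x y‖ ≤ g x * K x y) :
    IntegrableOn (fun p : ℝ × ℝ => f p.1 p.2) (tri a b) := by
  have hm : AEStronglyMeasurable ((tri a b).indicator fun p : ℝ × ℝ => f p.1 p.2)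
      ((volume : Measure ℝ).prod (volume : Measure ℝ)) :=
    (aestronglyMeasurable_indicator_iff (measurableSet_tri a b)).2 hf
  rw [← integrable_indicator_iff (measurableSet_tri a b)]
  have hb : ∀ x ∈ Ioo a b, ∀ y, ‖(tri a b).indicator (fun p : ℝ × ℝ => f p.1 p.2) (x, y)‖
      ≤ (Ioo x b).indicator (fun y => g x * K x y) y := by
    intro x hx y
    by_cases hy : y ∈ Ioo x b
    · rw [indicator_of_mem hy, indicator_of_mem (show (x, y) ∈ tri a b from ⟨hx.1, hy.1, hy.2⟩)]
      exact hfK x y hx.1 hy.1 hy.2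
    · rw [indicator_of_notMem hy, indicator_of_notMem fun h => hy ⟨h.2.1, h.2.2⟩, norm_zero]
  have hi : ∀ x ∈ Ioo a b, Integrable ((Ioo x b).indicator fun y => g x * K x y) := fun x hx =>
    (integrable_indicator_iff measurableSet_Ioo).2 ((hK x hx).const_mul _)
  have h0 : ∀ x ∉ Ioo a b, ∀ y, (tri a b).indicator (fun p : ℝ × ℝ => f p.1 p.2) (x, y) = 0 :=
    fun x hx y => indicator_of_notMem (fun h => hx ((tri_subset a b h).1)) _
  refine (integrable_prod_iff hm).2 ⟨?_, ?_⟩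
  · filter_upwards [hm.prodMk_left] with x hx
    by_cases hxm : x ∈ Ioo a b
    · exact (hi x hxm).mono' hx (Eventually.of_forall (hb x hxm))
    · simp_rw [h0 x hxm]
      exact integrable_zero _ _ _
  · refine ((integrable_indicator_iff measurableSet_Ioo).2 (hg.mul_const C)).mono'
      hm.norm.integral_prod_right' (Eventually.of_forall fun x => ?_)
    rw [Real.norm_of_nonneg (integral_nonneg fun _ => norm_nonneg _)]
    by_cases hxm : x ∈ Ioo a b
    · rw [indicator_of_mem hxm]
      refine (integral_mono_of_nonneg (Eventually.of_forall fun _ => norm_nonneg _) (hi x hxm)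
        (Eventually.of_forall (hb x hxm))).trans ?_
      rw [integral_indicator measurableSet_Ioo, integral_const_mul]
      exact mul_le_mul_of_nonneg_left (hKC x hxm) (hg0 x hxm)
    · rw [indicator_of_notMem hxm]
      simp_rw [h0 x hxm]
      simp

theorem tri_integrable_right {a b C : ℝ} {f : ℝ → ℝ → F} {g : ℝ → ℝ} {K : ℝ → ℝ → ℝ}
    (hf : AEStronglyMeasurable (fun p : ℝ × ℝ => f p.1 p.2) (volume.restrict (tri a b)))
    (hg : IntegrableOn g (Ioo a b)) (hg0 : ∀ x ∈ Ioo a b, 0 ≤ g x)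
    (hK : ∀ y ∈ Ioo a b, IntegrableOn (fun x => K x y) (Ioo a y))
    (hKC : ∀ y ∈ Ioo a b, ∫ x in Ioo a y, K x y ≤ C)
    (hfK : ∀ x y, a < x → x < y → y < b → ‖f x y‖ ≤ K x y * g y) :
    IntegrableOn (fun p : ℝ × ℝ => f p.1 p.2) (tri a b) := by
  have hm : AEStronglyMeasurable ((tri a b).indicator fun p : ℝ × ℝ => f p.1 p.2)
      ((volume : Measure ℝ).prod (volume : Measure ℝ)) :=
    (aestronglyMeasurable_indicator_iff (measurableSet_tri a b)).2 hf
  rw [← integrable_indicator_iff (measurableSet_tri a b)]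
  have hb : ∀ y ∈ Ioo a b, ∀ x, ‖(tri a b).indicator (fun p : ℝ × ℝ => f p.1 p.2) (x, y)‖
      ≤ (Ioo a y).indicator (fun x => K x y * g y) x := by
    intro y hy x
    by_cases hx : x ∈ Ioo a y
    · rw [indicator_of_mem hx, indicator_of_mem (show (x, y) ∈ tri a b from ⟨hx.1, hx.2, hy.2⟩)]
      exact hfK x y hx.1 hx.2 hy.2
    · rw [indicator_of_notMem hx, indicator_of_notMem fun h => hx ⟨h.1, h.2.1⟩, norm_zero]
  have hi : ∀ y ∈ Ioo a b, Integrable ((Ioo a y).indicator fun x => K x y * g y) := fun y hy =>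
    (integrable_indicator_iff measurableSet_Ioo).2 ((hK y hy).mul_const _)
  have h0 : ∀ y ∉ Ioo a b, ∀ x, (tri a b).indicator (fun p : ℝ × ℝ => f p.1 p.2) (x, y) = 0 :=
    fun y hy x => indicator_of_notMem (fun h => hy ((tri_subset a b h).2)) _
  refine (integrable_prod_iff' hm).2 ⟨?_, ?_⟩
  · filter_upwards [hm.prodMk_right] with y hy
    by_cases hym : y ∈ Ioo a b
    · exact (hi y hym).mono' hy (Eventually.of_forall (hb y hym))
    · simp_rw [h0 y hym]
      exact integrable_zero _ _ _
  · refine ((integrable_indicator_iff measurableSet_Ioo).2 (hg.const_mul C)).mono'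
      hm.prod_swap.norm.integral_prod_right' (Eventually.of_forall fun y => ?_)
    rw [Real.norm_of_nonneg (integral_nonneg fun _ => norm_nonneg _)]
    by_cases hym : y ∈ Ioo a b
    · rw [indicator_of_mem hym]
      refine (integral_mono_of_nonneg (Eventually.of_forall fun _ => norm_nonneg _) (hi y hym)
        (Eventually.of_forall (hb y hym))).trans ?_
      rw [integral_indicator measurableSet_Ioo, integral_mul_const]
      exact mul_le_mul_of_nonneg_right (hKC y hym) (hg0 y hym)
    · rw [indicator_of_notMem hym]
      simp_rw [h0 y hym]
      simp

end Triangle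

/-! ### Power kernels -/

section Power

theorem intervalIntegrable_sub_rpow {s : ℝ} (hs : -1 < s) (a b c : ℝ) :
    IntervalIntegrable (fun y => (y - c) ^ s) volume a b := by
  have h := (intervalIntegral.intervalIntegrable_rpow' (a := a - c) (b := b - c) hs).comp_sub_right c
  simpa using h

theorem intervalIntegrable_rsub_rpow {s : ℝ} (hs : -1 < s) (a b c : ℝ) :
    IntervalIntegrable (fun y => (c - y) ^ s) volume a b := by
  have h := (intervalIntegral.intervalIntegrable_rpow' (a := c - a) (b := c - b) hs).comp_sub_left c
  simpa using h

theorem integral_sub_rpow {s : ℝ} (hs : -1 < s) (a b : ℝ) :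
    ∫ y in a..b, (y - a) ^ s = (b - a) ^ (s + 1) / (s + 1) := by
  rw [intervalIntegral.integral_comp_sub_right (fun y => y ^ s), integral_rpow (Or.inl hs), sub_self,
    Real.zero_rpow (by linarith), sub_zero]

theorem integral_rsub_rpow {s : ℝ} (hs : -1 < s) (a b : ℝ) :
    ∫ y in a..b, (b - y) ^ s = (b - a) ^ (s + 1) / (s + 1) := by
  rw [intervalIntegral.integral_comp_sub_left (fun y => y ^ s), integral_rpow (Or.inl hs), sub_self,
    Real.zero_rpow (by linarith), sub_zero]

theorem integrableOn_sub_rpow {s : ℝ} (hs : -1 < s) (a b c : ℝ) :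
    IntegrableOn (fun y => (y - c) ^ s) (Ioo a b) := by
  rcases le_or_gt a b with h | h
  · exact (intervalIntegrable_iff_integrableOn_Ioo_of_le h).1 (intervalIntegrable_sub_rpow hs a b c)
  · simp [Ioo_eq_empty h.le.not_gt]

theorem integrableOn_rsub_rpow {s : ℝ} (hs : -1 < s) (a b c : ℝ) :
    IntegrableOn (fun y => (c - y) ^ s) (Ioo a b) := by
  rcases le_or_gt a b with h | h
  · exact (intervalIntegrable_iff_integrableOn_Ioo_of_le h).1 (intervalIntegrable_rsub_rpow hs a b c)
  · simp [Ioo_eq_empty h.le.not_gt]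

theorem measurable_sub_rpow (s c : ℝ) : Measurable fun y : ℝ => (y - c) ^ s := by fun_prop

theorem measurable_rsub_rpow (s c : ℝ) : Measurable fun y : ℝ => (c - y) ^ s := by fun_prop

theorem measurable_tri_rpow (s : ℝ) : Measurable fun p : ℝ × ℝ => (p.2 - p.1) ^ s := by fun_prop

theorem setIntegral_Ioo_eq {E : Type*} [NormedAddCommGroup E] [NormedSpace ℝ E] {a b : ℝ}
    (h : a ≤ b) (f : ℝ → E) : ∫ y in Ioo a b, f y = ∫ y in a..b, f y := by
  rw [intervalIntegral.integral_of_le h, integral_Ioc_eq_integral_Ioo]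

/-- A singularity at the left endpoint and one on the diagonal can be integrated one after the
other: the mass of `(y - x) ^ s` over `(x, b)` is bounded uniformly in `x` when `s > -1`. Most
double integrals below are controlled this way. -/
theorem tri_integrable_pow {E : Type*} [NormedAddCommGroup E] [NormedSpace ℝ E]
    {a b C p s : ℝ} (hp : -1 < p) (hs : -1 < s) {f : ℝ → ℝ → E}
    (hf : AEStronglyMeasurable (fun p : ℝ × ℝ => f p.1 p.2) (volume.restrict (tri a b)))
    (hfC : ∀ x y, a < x → x < y → y < b → ‖f x y‖ ≤ C * (x - a) ^ p * (y - x) ^ s) :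
    IntegrableOn (fun p : ℝ × ℝ => f p.1 p.2) (tri a b) := by
  refine tri_integrable_left (g := fun x => |C| * (x - a) ^ p) (K := fun x y => (y - x) ^ s)
    (C := (b - a) ^ (s + 1) / (s + 1)) hf ((integrableOn_sub_rpow hp a b a).const_mul _)
    (fun x hx => mul_nonneg (abs_nonneg _) (Real.rpow_nonneg (by linarith [hx.1]) _))
    (fun x _ => integrableOn_sub_rpow hs x b x) (fun x hx => ?_) fun x y hx hxy hy =>
      (hfC x y hx hxy hy).trans ?_
  · rw [setIntegral_Ioo_eq hx.2.le, integral_sub_rpow hs]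
    have := hx.1
    have := hx.2
    gcongr
    · linarith
    · linarith
  · have := Real.rpow_nonneg (sub_nonneg.2 hx.le) p
    have := Real.rpow_nonneg (sub_nonneg.2 hxy.le) s
    gcongr
    exact le_abs_self C

/-- Two-point splitting of a product of negative powers. -/
theorem rpow_mul_rpow_le {u v p q : ℝ} (hu : 0 < u) (hv : 0 < v) (hp : p ≤ 0) (hq : q ≤ 0) :
    u ^ p * v ^ q ≤ ((u + v) / 2) ^ p * v ^ q + ((u + v) / 2) ^ q * u ^ p := by
  have hu' := Real.rpow_nonneg hu.le p
  have hv' := Real.rpow_nonneg hv.le q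
  have h1 : 0 ≤ ((u + v) / 2) ^ p := Real.rpow_nonneg (by linarith) _
  have h2 : 0 ≤ ((u + v) / 2) ^ q := Real.rpow_nonneg (by linarith) _
  -- The larger of the two numbers is at least the mean, so its power is at most the power of the
  -- mean; the other factor keeps its singularity.
  rcases le_total v u with h | h
  · have : u ^ p ≤ ((u + v) / 2) ^ p :=
      Real.rpow_le_rpow_of_nonpos (by linarith) (by linarith) hp
    nlinarith
  · have : v ^ q ≤ ((u + v) / 2) ^ q :=
      Real.rpow_le_rpow_of_nonpos (by linarith) (by linarith) hq
    nlinarith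

/-- After `rpow_mul_rpow_le` each summand is singular at one endpoint only, since the mean of `z -
y` and `y - x` is the constant `(z - x) / 2`. -/
theorem integrableOn_beta {p q : ℝ} (hp : -1 < p) (hq : -1 < q) (hp0 : p ≤ 0) (hq0 : q ≤ 0)
    (x z : ℝ) : IntegrableOn (fun y => (z - y) ^ p * (y - x) ^ q) (Ioo x z) := by
  refine (((integrableOn_sub_rpow hq x z x).const_mul (((z - x) / 2) ^ p)).add
    ((integrableOn_rsub_rpow hp x z z).const_mul (((z - x) / 2) ^ q))).mono' ?_ ?_
  · exact (by fun_prop : Measurable fun y : ℝ => (z - y) ^ p * (y - x) ^ q).aestronglyMeasurable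
  · filter_upwards [ae_restrict_mem measurableSet_Ioo] with y hy
    have h1 : 0 < z - y := by linarith [hy.2]
    have h2 : 0 < y - x := by linarith [hy.1]
    have := rpow_mul_rpow_le h1 h2 hp0 hq0
    rw [Real.norm_of_nonneg (by positivity)]
    rw [show z - y + (y - x) = z - x by ring] at this
    exact this

/-- Euler's beta integral over `(x, z)`. -/
theorem integral_beta {p q : ℝ} (hp : 0 < p) (hq : 0 < q) {x z : ℝ} (hxz : x < z) :
    ∫ y in x..z, (z - y) ^ (p - 1) * (y - x) ^ (q - 1)
      = Real.Gamma p * Real.Gamma q / Real.Gamma (p + q) * (z - x) ^ (p + q - 1) := by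
  have h := Complex.betaIntegral_scaled (q : ℂ) (p : ℂ) (sub_pos.2 hxz)
  rw [Complex.betaIntegral_eq_Gamma_mul_div _ _ (by simpa) (by simpa)] at h
  have h2 : ∫ y in x..z, (z - y) ^ (p - 1) * (y - x) ^ (q - 1)
      = ∫ y in (0 : ℝ)..(z - x), ((z - x) - y) ^ (p - 1) * y ^ (q - 1) := by
    have := intervalIntegral.integral_comp_sub_right
      (fun y => ((z - x) - y) ^ (p - 1) * y ^ (q - 1)) (a := x) (b := z) x
    rw [sub_self] at this
    rw [← this]
    refine intervalIntegral.integral_congr fun y _ => ?_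
    ring_nf
  rw [h2]
  apply Complex.ofReal_injective
  rw [← intervalIntegral.integral_ofReal]
  -- Both bases are nonnegative on the interval of integration, so real and complex powers agree
  -- there.
  have h3 : ∫ y in (0 : ℝ)..(z - x), (((((z - x) - y) ^ (p - 1) * y ^ (q - 1) : ℝ)) : ℂ)
      = ∫ y in (0 : ℝ)..(z - x), (y : ℂ) ^ ((q : ℂ) - 1) * (((z - x : ℝ) : ℂ) - y) ^ ((p : ℂ) - 1) := by
    refine intervalIntegral.integral_congr fun y hy => ?_
    rw [uIcc_of_le (by linarith)] at hy
    have e1 : 0 ≤ y := hy.1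
    have e2 : 0 ≤ z - x - y := by linarith [hy.2]
    change (((((z - x) - y) ^ (p - 1) * y ^ (q - 1) : ℝ)) : ℂ) = _
    rw [Complex.ofReal_mul, Complex.ofReal_cpow e2, Complex.ofReal_cpow e1]
    push_cast
    ring
  rw [h3, h]
  push_cast
  rw [Complex.Gamma_ofReal, Complex.Gamma_ofReal, ← Complex.ofReal_add, Complex.Gamma_ofReal,
    Complex.ofReal_cpow (by linarith)]
  push_cast
  ring_nf

end Power

/-! ### Interval integrals as integrals over open intervals -/

section Interval

variable {E : Type*} [NormedAddCommGroup E]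

theorem intervalIntegrable_iff_Ioo {a b : ℝ} (hab : a ≤ b) {f : ℝ → E} :
    IntervalIntegrable f volume a b ↔ IntegrableOn f (Ioo a b) :=
  intervalIntegrable_iff_integrableOn_Ioo_of_le hab

theorem intervalIntegrable_of_bound {a b : ℝ} (hab : a ≤ b) {f : ℝ → E} {g : ℝ → ℝ}
    (hg : IntervalIntegrable g volume a b)
    (hf : AEStronglyMeasurable f (volume.restrict (Ioo a b)))
    (h : ∀ x ∈ Ioo a b, ‖f x‖ ≤ g x) : IntervalIntegrable f volume a b := by
  rw [intervalIntegrable_iff_Ioo hab] at *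
  refine hg.mono' hf ?_
  filter_upwards [ae_restrict_mem measurableSet_Ioo] with x hx using h x hx

theorem IntervalIntegrable.aesm_Ioo {a b : ℝ} (hab : a ≤ b) {f : ℝ → E}
    (hf : IntervalIntegrable f volume a b) :
    AEStronglyMeasurable f (volume.restrict (Ioo a b)) :=
  ((intervalIntegrable_iff_Ioo hab).1 hf).aestronglyMeasurable

theorem IntervalIntegrable.congr_Ioo {a b : ℝ} (hab : a ≤ b) {f g : ℝ → E}
    (hf : IntervalIntegrable f volume a b) (h : ∀ x ∈ Ioo a b, f x = g x) :
    IntervalIntegrable g volume a b := by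
  rw [intervalIntegrable_iff_Ioo hab] at *
  exact hf.congr_fun h measurableSet_Ioo

theorem IntervalIntegrable.congr_ae_Ioo {a b : ℝ} (hab : a ≤ b) {f g : ℝ → E}
    (hf : IntervalIntegrable f volume a b) (h : f =ᵐ[volume.restrict (Ioo a b)] g) :
    IntervalIntegrable g volume a b := by
  rw [intervalIntegrable_iff_Ioo hab] at *
  exact Integrable.congr hf h

theorem aesm_Ioo_mono {a b c d : ℝ} {f : ℝ → E}
    (hf : AEStronglyMeasurable f (volume.restrict (Ioo a b))) (hc : a ≤ c) (hd : d ≤ b) :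
    AEStronglyMeasurable f (volume.restrict (Ioo c d)) :=
  hf.mono_measure (Measure.restrict_mono (Ioo_subset_Ioo hc hd) le_rfl)

variable [NormedSpace ℝ E]

theorem integral_congr_Ioo {a b : ℝ} (hab : a ≤ b) {f g : ℝ → E} (h : ∀ x ∈ Ioo a b, f x = g x) :
    ∫ x in a..b, f x = ∫ x in a..b, g x := by
  rw [← setIntegral_Ioo_eq hab, ← setIntegral_Ioo_eq hab]
  exact setIntegral_congr_fun measurableSet_Ioo h

theorem integral_congr_ae_Ioo {a b : ℝ} (hab : a ≤ b) {f g : ℝ → E}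
    (h : f =ᵐ[volume.restrict (Ioo a b)] g) : ∫ x in a..b, f x = ∫ x in a..b, g x := by
  rw [← setIntegral_Ioo_eq hab, ← setIntegral_Ioo_eq hab]
  exact integral_congr_ae h

theorem setIntegral_tri {a b : ℝ} (hab : a ≤ b) {f : ℝ → ℝ → E}
    (hf : IntegrableOn (fun p : ℝ × ℝ => f p.1 p.2) (tri a b)) :
    ∫ p in tri a b, f p.1 p.2 = ∫ x in a..b, ∫ y in x..b, f x y := by
  have hg : Integrable ((tri a b).indicator fun p : ℝ × ℝ => f p.1 p.2)
      ((volume : Measure ℝ).prod (volume : Measure ℝ)) :=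
    (integrable_indicator_iff (measurableSet_tri a b)).2 hf
  have h := integral_prod _ hg
  simp only [integral_tri_snd] at h
  rw [integral_indicator measurableSet_Ioo, setIntegral_Ioo_eq hab] at h
  rw [← h, ← integral_indicator (measurableSet_tri a b)]
  rfl

theorem setIntegral_tri' {a b : ℝ} (hab : a ≤ b) {f : ℝ → ℝ → E}
    (hf : IntegrableOn (fun p : ℝ × ℝ => f p.1 p.2) (tri a b)) :
    ∫ p in tri a b, f p.1 p.2 = ∫ y in a..b, ∫ x in a..y, f x y := by
  rw [setIntegral_tri hab hf, (tri_fubini hab hf).2.2]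

/-- An integrable function all of whose primitives from `a` vanish is zero almost everywhere. -/
theorem ae_eq_zero_of_primitive {a b : ℝ} (hab : a ≤ b) [CompleteSpace E] {f : ℝ → E}
    (hf : IntervalIntegrable f volume a b) (h : ∀ z ∈ Ioo a b, ∫ x in a..z, f x = 0) :
    f =ᵐ[volume.restrict (Ioo a b)] 0 := by
  filter_upwards [ae_restrict_of_ae (s := Ioo a b) hf.ae_hasDerivAt_integral,
    ae_restrict_mem measurableSet_Ioo] with x hx hxm
  rw [uIcc_of_le hab] at hx
  have h1 := hx (Ioo_subset_Icc_self hxm) a (left_mem_Icc.2 hab)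
  have h2 : HasDerivAt (fun x => ∫ t in a..x, f t) 0 x := by
    refine (hasDerivAt_const x (0 : E)).congr_of_eventuallyEq ?_
    filter_upwards [Ioo_mem_nhds hxm.1 hxm.2] with z hz using h z hz
  exact h1.unique h2

theorem ae_eq_zero_of_primitive_right {a b : ℝ} (hab : a ≤ b) [CompleteSpace E] {f : ℝ → E}
    (hf : IntervalIntegrable f volume a b) (h : ∀ z ∈ Ioo a b, ∫ x in z..b, f x = 0) :
    f =ᵐ[volume.restrict (Ioo a b)] 0 := by
  filter_upwards [ae_restrict_of_ae (s := Ioo a b) hf.ae_hasDerivAt_integral,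
    ae_restrict_mem measurableSet_Ioo] with x hx hxm
  rw [uIcc_of_le hab] at hx
  have h1 := hx (Ioo_subset_Icc_self hxm) b (right_mem_Icc.2 hab)
  have h2 : HasDerivAt (fun x => ∫ t in b..x, f t) 0 x := by
    refine (hasDerivAt_const x (0 : E)).congr_of_eventuallyEq ?_
    filter_upwards [Ioo_mem_nhds hxm.1 hxm.2] with z hz
    rw [intervalIntegral.integral_symm, h z hz, neg_zero]
  exact h1.unique h2

end Interval

/-! ### Removing the singularity of the kernel `(r - q)^(-1-κ)` -/

section Regularized

variable {X : Type*} [NormedAddCommGroup X] [NormedSpace ℝ X] [CompleteSpace X]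

theorem tendsto_add_rpow {c : ℝ} (hc : 0 < c) (s : ℝ) :
    Tendsto (fun ε : ℝ => (c + ε) ^ s) (𝓝[>] 0) (𝓝 (c ^ s)) := by
  have h : ContinuousAt (fun ε : ℝ => (c + ε) ^ s) 0 :=
    (continuousAt_const.add continuousAt_id).rpow_const (Or.inl (by simpa using hc.ne'))
  have h' := h.tendsto
  simp only [add_zero] at h'
  exact h'.mono_left nhdsWithin_le_nhds

theorem integral_shifted_rpow {κ : ℝ} (hκ : 0 < κ) {ε : ℝ} (hε : 0 < ε) {q b : ℝ} (hqb : q ≤ b) :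
    ∫ r in q..b, κ * (r - q + ε) ^ (-(1 + κ)) = ε ^ (-κ) - (b - q + ε) ^ (-κ) := by
  rw [intervalIntegral.integral_const_mul]
  have h : ∫ r in q..b, (r - q + ε) ^ (-(1 + κ)) = ∫ r in ε..(b - q + ε), r ^ (-(1 + κ)) := by
    have := intervalIntegral.integral_comp_add_right (a := q) (b := b)
      (fun x : ℝ => x ^ (-(1 + κ))) (ε - q)
    rw [show q + (ε - q) = ε by ring, show b + (ε - q) = b - q + ε by ring] at this
    rw [← this]
    refine intervalIntegral.integral_congr fun y _ => ?_
    congr 1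
    ring
  rw [h, integral_rpow (Or.inr ⟨by linarith, ?_⟩)]
  · rw [show -(1 + κ) + 1 = -κ by ring]
    field_simp
    ring
  · rw [uIcc_of_le (by linarith)]
    exact fun h0 => absurd h0.1 (not_le.2 hε)

/-- Regularisation of the singular kernel `(r - q)^{-1-κ}`. -/
theorem tendsto_regularized {a b κ : ℝ} (hab : a < b) (hκ0 : 0 < κ)
    {θ : ℝ → ℝ} (hθ : IntegrableOn θ (Ioo a b)) (hθ0 : ∀ q ∈ Ioo a b, 0 ≤ θ q) {y : ℝ → X}
    (hy : AEStronglyMeasurable y (volume.restrict (Ioo a b))) {M : ℝ}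
    (hM : ∀ q ∈ Ioo a b, ‖y q‖ ≤ M)
    (h_int : IntegrableOn (fun p : ℝ × ℝ => (θ p.1 * (p.2 - p.1) ^ (-(1 + κ))) • (y p.2 - y p.1))
      (tri a b)) :
    Tendsto (fun ε : ℝ => ∫ z in a..b, ((∫ q in a..z, κ * (θ q * (z - q + ε) ^ (-(1 + κ))))
        - θ z * (ε ^ (-κ) - (b - z + ε) ^ (-κ))) • y z) (𝓝[>] 0)
      (𝓝 (κ • ∫ r in a..b, ∫ q in a..r, (θ q * (r - q) ^ (-(1 + κ))) • (y r - y q))) := by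
  have hθm := aesm_tri_fst hθ.aestronglyMeasurable
  have hkm : ∀ ε : ℝ, Measurable fun p : ℝ × ℝ => (p.2 - p.1 + ε) ^ (-(1 + κ)) := fun ε => by
    fun_prop
  have hcm : ∀ ε : ℝ, AEStronglyMeasurable
      (fun p : ℝ × ℝ => κ * (θ p.1 * (p.2 - p.1 + ε) ^ (-(1 + κ)))) (volume.restrict (tri a b)) :=
    fun ε => (hθm.mul (hkm ε).aestronglyMeasurable).const_mul κ
  have hM0 : 0 ≤ M := (norm_nonneg _).trans (hM ((a + b) / 2) ⟨by linarith, by linarith⟩)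
  -- Dominated convergence on the triangle: the shifted kernel is at most the unshifted one, which
  -- `h_int` integrates against the increment of `y`.
  have hlim : Tendsto (fun ε : ℝ => ∫ p in tri a b,
      (κ * (θ p.1 * (p.2 - p.1 + ε) ^ (-(1 + κ)))) • (y p.2 - y p.1)) (𝓝[>] 0)
      (𝓝 (∫ p in tri a b, κ • (θ p.1 * (p.2 - p.1) ^ (-(1 + κ))) • (y p.2 - y p.1))) := by
    refine tendsto_integral_filter_of_dominated_convergence
      (fun p => ‖κ • (θ p.1 * (p.2 - p.1) ^ (-(1 + κ))) • (y p.2 - y p.1)‖)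
      (Eventually.of_forall fun ε => (hcm ε).smul ((aesm_tri_snd hy).sub (aesm_tri_fst hy)))
      ?_ (Integrable.norm (Integrable.smul κ h_int)) ?_
    · filter_upwards [self_mem_nhdsWithin] with ε (hε : 0 < ε)
      filter_upwards [ae_restrict_mem (measurableSet_tri a b)] with p hp
      have h1 := hθ0 p.1 (tri_subset a b hp).1
      have h2 : 0 < p.2 - p.1 := sub_pos.2 hp.2.1
      have h3 := Real.rpow_le_rpow_of_nonpos h2 (by linarith : p.2 - p.1 ≤ p.2 - p.1 + ε)
        (by linarith : -(1 + κ) ≤ 0)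
      have h4 := Real.rpow_nonneg h2.le (-(1 + κ))
      have h5 := Real.rpow_nonneg (by linarith : 0 ≤ p.2 - p.1 + ε) (-(1 + κ))
      rw [norm_smul, norm_smul, norm_smul, Real.norm_of_nonneg (by positivity),
        Real.norm_of_nonneg hκ0.le, Real.norm_of_nonneg (by positivity), mul_assoc κ]
      gcongr
    · filter_upwards [ae_restrict_mem (measurableSet_tri a b)] with p hp
      have h2 : 0 < p.2 - p.1 := sub_pos.2 hp.2.1
      rw [smul_smul]
      exact (((tendsto_add_rpow h2 _).const_mul _).const_mul _).smul_const _
  have hR : (∫ p in tri a b, κ • (θ p.1 * (p.2 - p.1) ^ (-(1 + κ))) • (y p.2 - y p.1))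
      = κ • ∫ r in a..b, ∫ q in a..r, (θ q * (r - q) ^ (-(1 + κ))) • (y r - y q) := by
    rw [integral_smul, ← setIntegral_tri' hab.le h_int]
  rw [hR] at hlim
  refine hlim.congr' ?_
  filter_upwards [self_mem_nhdsWithin] with ε (hε : 0 < ε)
  -- For fixed ε the kernel is bounded by ε^(-1-κ). The two halves of `y z - y x` are then
  -- integrable separately, and exchanging the order in one of them collects the coefficient of `y
  -- z`.
  have hbd : ∀ x z : ℝ, a < x → x < z → z < b → ∀ v : X, ‖v‖ ≤ M →
      ‖(κ * (θ x * (z - x + ε) ^ (-(1 + κ)))) • v‖ ≤ θ x * (κ * ε ^ (-(1 + κ)) * M) := by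
    intro x z hx hxz hz v hv
    have h1 := hθ0 x ⟨hx, hxz.trans hz⟩
    have h3 := Real.rpow_le_rpow_of_nonpos hε (by linarith : ε ≤ z - x + ε)
      (by linarith : -(1 + κ) ≤ 0)
    have h5 := Real.rpow_nonneg (by linarith : 0 ≤ z - x + ε) (-(1 + κ))
    rw [norm_smul, Real.norm_of_nonneg (by positivity)]
    calc _ ≤ κ * (θ x * ε ^ (-(1 + κ))) * M := by gcongr
      _ = _ := by ring
  have hcon : ∀ x ∈ Ioo a b, ∫ _ in Ioo x b, (κ * ε ^ (-(1 + κ)) * M)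
      ≤ (b - a) * (κ * ε ^ (-(1 + κ)) * M) := by
    intro x hx
    rw [setIntegral_Ioo_eq hx.2.le, intervalIntegral.integral_const, smul_eq_mul]
    have := hx.1
    gcongr
  have i1 : IntegrableOn (fun p : ℝ × ℝ => (κ * (θ p.1 * (p.2 - p.1 + ε) ^ (-(1 + κ)))) • y p.2)
      (tri a b) := by
    refine tri_integrable_left (f := fun q z => (κ * (θ q * (z - q + ε) ^ (-(1 + κ)))) • y z)
      (K := fun _ _ => κ * ε ^ (-(1 + κ)) * M)
      ((hcm ε).smul (aesm_tri_snd hy)) hθ hθ0 (fun x _ => integrableOn_const (by simp)) hcon ?_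
    exact fun x z hx hxz hz => hbd x z hx hxz hz _ (hM z ⟨hx.trans hxz, hz⟩)
  have i2 : IntegrableOn (fun p : ℝ × ℝ => (κ * (θ p.1 * (p.2 - p.1 + ε) ^ (-(1 + κ)))) • y p.1)
      (tri a b) := by
    refine tri_integrable_left (f := fun q z => (κ * (θ q * (z - q + ε) ^ (-(1 + κ)))) • y q)
      (K := fun _ _ => κ * ε ^ (-(1 + κ)) * M)
      ((hcm ε).smul (aesm_tri_fst hy)) hθ hθ0 (fun x _ => integrableOn_const (by simp)) hcon ?_
    exact fun x z hx hxz hz => hbd x z hx hxz hz _ (hM x ⟨hx, hxz.trans hz⟩)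
  simp_rw [smul_sub]
  rw [integral_sub i1 i2,
    setIntegral_tri' hab.le (f := fun q z => (κ * (θ q * (z - q + ε) ^ (-(1 + κ)))) • y z) i1,
    setIntegral_tri hab.le (f := fun q z => (κ * (θ q * (z - q + ε) ^ (-(1 + κ)))) • y q) i2,
    ← intervalIntegral.integral_sub
      (tri_fubini hab.le (f := fun q z => (κ * (θ q * (z - q + ε) ^ (-(1 + κ)))) • y z) i1).2.1
      (tri_fubini hab.le (f := fun q z => (κ * (θ q * (z - q + ε) ^ (-(1 + κ)))) • y q) i2).1]
  refine integral_congr_Ioo hab.le fun z hz => ?_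
  rw [intervalIntegral.integral_smul_const, intervalIntegral.integral_smul_const, ← sub_smul,
    ← integral_shifted_rpow hκ0 hε hz.2.le, ← intervalIntegral.integral_const_mul]
  congr 3
  funext r
  ring

/-- The antisymmetric double integral behind the Weyl--Marchaud derivative. -/
theorem integral_marchaud {a b κ : ℝ} (hab : a < b) (hκ0 : 0 < κ) (hκ1 : κ < 1) {y : ℝ → X}
    (hy : AEStronglyMeasurable y (volume.restrict (Ioo a b))) {M : ℝ}
    (hM : ∀ q ∈ Ioo a b, ‖y q‖ ≤ M)
    (h_int : IntegrableOn (fun p : ℝ × ℝ => (p.2 - p.1) ^ (-(1 + κ)) • (y p.2 - y p.1))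
      (tri a b)) :
    κ • ∫ r in a..b, ∫ q in a..r, (r - q) ^ (-(1 + κ)) • (y r - y q)
      = ∫ z in a..b, ((b - z) ^ (-κ) - (z - a) ^ (-κ)) • y z := by
  have h := tendsto_regularized hab hκ0 (θ := fun _ => 1) (by simp) (by simp) hy hM
    (by simpa using h_int)
  simp only [one_mul] at h
  refine tendsto_nhds_unique h ?_
  -- Integrating the kernel on either side of z produces ε^(-κ) twice with opposite signs. Only this
  -- bounded combination of shifted powers remains, and it is dominated by the unshifted powers.
  have key : Tendsto (fun ε : ℝ => ∫ z in a..b, ((b - z + ε) ^ (-κ) - (z - a + ε) ^ (-κ)) • y z)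
      (𝓝[>] 0) (𝓝 (∫ z in a..b, ((b - z) ^ (-κ) - (z - a) ^ (-κ)) • y z)) := by
    simp_rw [← setIntegral_Ioo_eq hab.le]
    refine tendsto_integral_filter_of_dominated_convergence
      (fun z => ((b - z) ^ (-κ) + (z - a) ^ (-κ)) * M)
      (Eventually.of_forall fun ε => AEStronglyMeasurable.smul
        (Measurable.aestronglyMeasurable (by fun_prop)) hy) ?_
      (((integrableOn_rsub_rpow (by linarith) a b b).add
        (integrableOn_sub_rpow (by linarith) a b a)).mul_const M) ?_
    · filter_upwards [self_mem_nhdsWithin] with ε (hε : 0 < ε)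
      filter_upwards [ae_restrict_mem measurableSet_Ioo] with z hz
      have h1 : 0 < b - z := sub_pos.2 hz.2
      have h2 : 0 < z - a := sub_pos.2 hz.1
      have h3 := Real.rpow_le_rpow_of_nonpos h1 (by linarith : b - z ≤ b - z + ε)
        (by linarith : -κ ≤ 0)
      have h4 := Real.rpow_le_rpow_of_nonpos h2 (by linarith : z - a ≤ z - a + ε)
        (by linarith : -κ ≤ 0)
      have h5 := Real.rpow_nonneg (by linarith : 0 ≤ b - z + ε) (-κ)
      have h6 := Real.rpow_nonneg (by linarith : 0 ≤ z - a + ε) (-κ)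
      rw [norm_smul]
      refine mul_le_mul ?_ (hM z hz) (norm_nonneg _) (by linarith)
      rw [Real.norm_eq_abs, abs_le]
      constructor <;> linarith
    · filter_upwards [ae_restrict_mem measurableSet_Ioo] with z hz
      have h1 : 0 < b - z := sub_pos.2 hz.2
      have h2 : 0 < z - a := sub_pos.2 hz.1
      exact ((tendsto_add_rpow h1 _).sub (tendsto_add_rpow h2 _)).smul_const _
  refine key.congr' ?_
  filter_upwards [self_mem_nhdsWithin] with ε (hε : 0 < ε)
  refine integral_congr_Ioo hab.le fun z hz => ?_
  have e : ∫ q in a..z, κ * (z - q + ε) ^ (-(1 + κ)) = ε ^ (-κ) - (z - a + ε) ^ (-κ) := by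
    rw [← integral_shifted_rpow hκ0 hε hz.1.le]
    have := intervalIntegral.integral_comp_sub_left (a := a) (b := z)
      (fun x : ℝ => κ * (x - a + ε) ^ (-(1 + κ))) (z + a)
    rw [show z + a - z = a by ring, show z + a - a = z by ring] at this
    rw [← this]
    refine intervalIntegral.integral_congr fun q _ => ?_
    congr 2
    ring
  simp only [e]
  congr 1
  ring

end Regularized

/-! ### The antisymmetric double integral with a weight -/

section Weighted

variable {X : Type*} [NormedAddCommGroup X] [NormedSpace ℝ X] [CompleteSpace X]

/-- An antiderivative is (q - a)^α (z - q + ε)^(-α) / (z - a + ε): the two terms of its derivative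
have a common factor whose cofactor is (z - q + ε) + (q - a), the denominator. -/
theorem integral_weighted_shifted {α : ℝ} (hα0 : 0 < α) {ε : ℝ} (hε : 0 < ε) {a z : ℝ}
    (haz : a < z) :
    ∫ q in a..z, α * ((q - a) ^ (α - 1) * (z - q + ε) ^ (-(1 + α)))
      = (z - a) ^ α * ε ^ (-α) / (z - a + ε) := by
  have hpos : ∀ q ∈ Icc a z, 0 < z - q + ε := fun q hq => by linarith [hq.2]
  have h := intervalIntegral.integral_eq_sub_of_hasDerivAt_of_le haz.le
    (f := fun q => (q - a) ^ α * (z - q + ε) ^ (-α) / (z - a + ε))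
    (f' := fun q => α * ((q - a) ^ (α - 1) * (z - q + ε) ^ (-(1 + α)))) ?_ ?_ ?_
  · rw [h]
    simp [Real.zero_rpow hα0.ne']
  · refine ContinuousOn.div_const (ContinuousOn.mul ?_ ?_) _
    · exact (continuousOn_id.sub continuousOn_const).rpow_const fun q _ => Or.inr hα0.le
    · exact ContinuousOn.rpow_const (by fun_prop) fun q hq => Or.inl (hpos q hq).ne'
  · intro q hq
    have h1 : 0 < q - a := sub_pos.2 hq.1
    have h2 := hpos q (Ioo_subset_Icc_self hq)
    have d1 : HasDerivAt (fun q => (q - a) ^ α) (1 * α * (q - a) ^ (α - 1)) q :=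
      ((hasDerivAt_id q).sub_const a).rpow_const (Or.inl h1.ne')
    have d2 : HasDerivAt (fun q => (z - q + ε) ^ (-α)) (-1 * (-α) * (z - q + ε) ^ (-α - 1)) q :=
      (((hasDerivAt_id q).const_sub z).add_const ε).rpow_const (Or.inl h2.ne')
    refine ((d1.mul d2).div_const (z - a + ε)).congr_deriv ?_
    have e1 : (q - a) ^ α = (q - a) ^ (α - 1) * (q - a) := by
      rw [← Real.rpow_add_one h1.ne']; ring_nf
    have e2 : (z - q + ε) ^ (-α) = (z - q + ε) ^ (-(1 + α)) * (z - q + ε) := by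
      rw [← Real.rpow_add_one h2.ne']; ring_nf
    have h3 : z - a + ε ≠ 0 := by linarith
    rw [show -α - 1 = -(1 + α) by ring, e1, e2]
    field_simp
    ring
  · refine (IntervalIntegrable.mul_continuousOn (intervalIntegrable_sub_rpow (by linarith) a z a)
      ?_).const_mul α
    rw [uIcc_of_le haz.le]
    exact ContinuousOn.rpow_const (by fun_prop) fun q hq => Or.inl (hpos q hq).ne'

/-- Weighted version of `integral_marchaud`, with weight `(q - a)^{α - 1}`. -/
theorem integral_marchaud_weighted {a b α γ C : ℝ} (hab : a < b) (hα0 : 0 < α) (hα1 : α < 1)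
    (hγ : 1 < α + γ) {y : ℝ → X}
    (hy : AEStronglyMeasurable y (volume.restrict (Ioo a b)))
    (hC : ∀ z ∈ Ioo a b, ‖y z‖ ≤ C * (z - a) ^ γ)
    (h_int : IntegrableOn (fun p : ℝ × ℝ =>
      ((p.1 - a) ^ (α - 1) * (p.2 - p.1) ^ (-(1 + α))) • (y p.2 - y p.1)) (tri a b)) :
    α • ∫ r in a..b, ∫ q in a..r, ((q - a) ^ (α - 1) * (r - q) ^ (-(1 + α))) • (y r - y q)
      = ∫ z in a..b, ((z - a) ^ (α - 1) * (b - z) ^ (-α)) • y z := by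
  have hC0 : 0 ≤ C := by
    have h1 := (norm_nonneg _).trans (hC ((a + b) / 2) ⟨by linarith, by linarith⟩)
    exact nonneg_of_mul_nonneg_left h1 (Real.rpow_pos_of_pos (by linarith) _)
  have h := tendsto_regularized hab hα0 (θ := fun q => (q - a) ^ (α - 1))
    (integrableOn_sub_rpow (by linarith) a b a)
    (fun q hq => Real.rpow_nonneg (sub_nonneg.2 hq.1.le) _) hy (M := C * (b - a) ^ γ)
    (fun q hq => (hC q hq).trans (by
      have := hq.1
      have := hq.2
      gcongr <;> linarith)) h_int
  refine tendsto_nhds_unique h ?_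
  -- With the weight, the terms in ε^(-α) no longer cancel exactly. They leave the first summand,
  -- which tends to zero pointwise and for ε < 1 is dominated by (z - a)^(α-2). Against |y(z)| ≤ C
  -- (z - a)^γ this is integrable because α + γ > 1.
  have key : Tendsto (fun ε : ℝ => ∫ z in a..b, (-((z - a) ^ (α - 1) * ε ^ (1 - α) / (z - a + ε))
      + (z - a) ^ (α - 1) * (b - z + ε) ^ (-α)) • y z)
      (𝓝[>] 0) (𝓝 (∫ z in a..b, ((z - a) ^ (α - 1) * (b - z) ^ (-α)) • y z)) := by
    simp_rw [← setIntegral_Ioo_eq hab.le]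
    refine tendsto_integral_filter_of_dominated_convergence
      (fun z => C * (z - a) ^ (α + γ - 2) + C * (b - a) ^ (α + γ - 1) * (b - z) ^ (-α))
      (Eventually.of_forall fun ε => AEStronglyMeasurable.smul
        (Measurable.aestronglyMeasurable (by fun_prop)) hy) ?_
      (((integrableOn_sub_rpow (by linarith) a b a).const_mul C).add
        ((integrableOn_rsub_rpow (by linarith) a b b).const_mul _)) ?_
    · filter_upwards [Ioo_mem_nhdsGT (show (0 : ℝ) < 1 by norm_num)] with ε hε
      filter_upwards [ae_restrict_mem measurableSet_Ioo] with z hz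
      have h1 : 0 < b - z := sub_pos.2 hz.2
      have h2 : 0 < z - a := sub_pos.2 hz.1
      have hε0 := hε.1
      have e1 : ‖(z - a) ^ (α - 1) * ε ^ (1 - α) / (z - a + ε)‖ ≤ (z - a) ^ (α - 2) := by
        have h3 : ε ^ (1 - α) ≤ 1 := Real.rpow_le_one hε0.le hε.2.le (by linarith)
        have h4 : (z - a) ^ (α - 2) = (z - a) ^ (α - 1) / (z - a) := by
          rw [← Real.rpow_sub_one h2.ne']
          ring_nf
        rw [Real.norm_of_nonneg (by positivity), h4]
        exact div_le_div₀ (by positivity) (mul_le_of_le_one_right (by positivity) h3) h2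
          (by linarith)
      have e2 : ‖(z - a) ^ (α - 1) * (b - z + ε) ^ (-α)‖ ≤ (z - a) ^ (α - 1) * (b - z) ^ (-α) := by
        have := Real.rpow_le_rpow_of_nonpos h1 (by linarith : b - z ≤ b - z + ε)
          (by linarith : -α ≤ 0)
        rw [Real.norm_of_nonneg (by positivity)]
        gcongr
      rw [norm_smul]
      calc _ ≤ ((z - a) ^ (α - 2) + (z - a) ^ (α - 1) * (b - z) ^ (-α)) * (C * (z - a) ^ γ) := by
            refine mul_le_mul ((norm_add_le _ _).trans ?_) (hC z hz) (norm_nonneg _) (by positivity)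
            rw [norm_neg]
            exact add_le_add e1 e2
        _ = C * (z - a) ^ (α + γ - 2) + C * (z - a) ^ (α + γ - 1) * (b - z) ^ (-α) := by
            rw [show α + γ - 2 = (α - 2) + γ by ring, show α + γ - 1 = (α - 1) + γ by ring,
              Real.rpow_add h2, Real.rpow_add h2]
            ring
        _ ≤ _ := by
            have : (z - a) ^ (α + γ - 1) ≤ (b - a) ^ (α + γ - 1) :=
              Real.rpow_le_rpow h2.le (by linarith [hz.2]) (by linarith)
            gcongr
    · filter_upwards [ae_restrict_mem measurableSet_Ioo] with z hz
      have h1 : 0 < b - z := sub_pos.2 hz.2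
      have h2 : 0 < z - a := sub_pos.2 hz.1
      refine Tendsto.smul_const ?_ _
      have t1 : Tendsto (fun ε : ℝ => (z - a) ^ (α - 1) * ε ^ (1 - α) / (z - a + ε)) (𝓝[>] 0)
          (𝓝 0) := by
        have c : ContinuousAt (fun ε : ℝ => (z - a) ^ (α - 1) * ε ^ (1 - α) / (z - a + ε)) 0 := by
          refine ContinuousAt.div (ContinuousAt.mul continuousAt_const
            (continuousAt_id.rpow_const (Or.inr (by linarith)))) (by fun_prop) ?_
          simpa using h2.ne'
        have c' := c.tendsto
        simp only [Real.zero_rpow (by linarith : (1 - α) ≠ 0), mul_zero, zero_div] at c'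
        exact c'.mono_left nhdsWithin_le_nhds
      simpa using t1.neg.add ((tendsto_add_rpow h1 (-α)).const_mul ((z - a) ^ (α - 1)))
  refine key.congr' ?_
  filter_upwards [self_mem_nhdsWithin] with ε (hε : 0 < ε)
  refine integral_congr_Ioo hab.le fun z hz => ?_
  have h2 : 0 < z - a := sub_pos.2 hz.1
  simp only [integral_weighted_shifted hα0 hε hz.1]
  congr 1
  have e1 : (z - a) ^ α = (z - a) ^ (α - 1) * (z - a) := by
    rw [← Real.rpow_add_one h2.ne']; ring_nf
  have e2 : ε ^ (1 - α) = ε ^ (-α) * ε := by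
    rw [← Real.rpow_add_one hε.ne']; ring_nf
  rw [e1, e2]
  have : z - a + ε ≠ 0 := by linarith
  field_simp
  ring

end Weighted

/-! ### Abel's integral equation -/

section Abel

variable {X Z W : Type*} [NormedAddCommGroup X] [NormedSpace ℝ X]
  [NormedAddCommGroup Z] [NormedSpace ℝ Z] [CompleteSpace Z]
  [NormedAddCommGroup W] [NormedSpace ℝ W] [CompleteSpace W]

theorem tri_integrable_conv_left {a b s : ℝ} (hs : -1 < s) {R : ℝ → X}
    (hR : IntegrableOn R (Ioo a b)) :
    IntegrableOn (fun p : ℝ × ℝ => (p.2 - p.1) ^ s • R p.1) (tri a b) := by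
  refine tri_integrable_left (f := fun q z => (z - q) ^ s • R q) (g := fun q => ‖R q‖)
    (K := fun q z => (z - q) ^ s) (C := (b - a) ^ (s + 1) / (s + 1))
    ((measurable_tri_rpow s).aestronglyMeasurable.smul (aesm_tri_fst hR.aestronglyMeasurable))
    hR.norm (fun _ _ => norm_nonneg _) (fun x _ => integrableOn_sub_rpow hs x b x) ?_ ?_
  · intro x hx
    have := hx.1
    have := hx.2
    rw [setIntegral_Ioo_eq hx.2.le, integral_sub_rpow hs]
    gcongr <;> linarith
  · intro x z _ hxz _
    rw [norm_smul, Real.norm_of_nonneg (Real.rpow_nonneg (by linarith) _), mul_comm]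

variable [CompleteSpace X]

/-- Abel inversion: a fractional integral equation solved for `P`. -/
theorem abel_inversion {a b κ : ℝ} (hab : a < b) (hκ0 : 0 < κ) (hκ1 : κ < 1) {P R : ℝ → X}
    (hP : IntegrableOn P (Ioo a b)) (hR : IntegrableOn R (Ioo a b))
    (h : ∀ x ∈ Ioo a b, ∫ τ in a..x, (x - τ) ^ (-κ) • P τ = ∫ τ in a..x, R τ) :
    ∀ᵐ σ ∂(volume.restrict (Ioo a b)),
      ∫ q in a..σ, (σ - q) ^ (κ - 1) • R q = (Real.Gamma κ * Real.Gamma (1 - κ)) • P σ := by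
  have hI := tri_fubini hab.le (f := fun q σ => (σ - q) ^ (κ - 1) • R q)
    (tri_integrable_conv_left (by linarith) hR)
  have hP' : IntervalIntegrable (fun σ => (Real.Gamma κ * Real.Gamma (1 - κ)) • P σ) volume a b :=
    ((intervalIntegrable_iff_Ioo hab.le).2 hP).smul _
  -- Both sides have the same primitive from a. Convolving the hypothesis with (z - x)^(κ-1) puts
  -- the weight (z - q)^κ / κ on `R`, which is the primitive of the left side, and by the beta
  -- integral the constant Γ(κ) Γ(1-κ) on `P`.
  have hz : ∀ z ∈ Ioo a b, ∫ σ in a..z, ((∫ q in a..σ, (σ - q) ^ (κ - 1) • R q)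
      - (Real.Gamma κ * Real.Gamma (1 - κ)) • P σ) = 0 := by
    intro z hz
    have haz := hz.1
    have sub : Ioo a z ⊆ Ioo a b := Ioo_subset_Ioo le_rfl hz.2.le
    have hRz := hR.mono_set sub
    have hPz := hP.mono_set sub
    have hPz' : IntervalIntegrable (fun σ => (Real.Gamma κ * Real.Gamma (1 - κ)) • P σ) volume a z :=
      ((intervalIntegrable_iff_Ioo haz.le).2 hPz).smul _
    have hI1 := tri_fubini haz.le (f := fun q σ => (σ - q) ^ (κ - 1) • R q)
      (tri_integrable_conv_left (by linarith) hRz)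
    rw [intervalIntegral.integral_sub hI1.2.1
      hPz', ← hI1.2.2,
      intervalIntegral.integral_smul]
    have e1 : ∫ q in a..z, ∫ σ in q..z, (σ - q) ^ (κ - 1) • R q
        = ∫ q in a..z, ((z - q) ^ κ / κ) • R q := by
      refine integral_congr_Ioo haz.le fun q hq => ?_
      simp only [intervalIntegral.integral_smul_const]
      rw [integral_sub_rpow (by linarith)]
      simp
    -- the other order of integration, through the equation for `P`
    have i2 : IntegrableOn (fun p : ℝ × ℝ => (z - p.2) ^ (κ - 1) • R p.1) (tri a z) := by
      refine tri_integrable_left (f := fun q x => (z - x) ^ (κ - 1) • R q) (g := fun q => ‖R q‖)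
        (K := fun q x => (z - x) ^ (κ - 1)) (C := (z - a) ^ κ / κ)
        (AEStronglyMeasurable.smul (Measurable.aestronglyMeasurable (by fun_prop))
          (aesm_tri_fst hRz.aestronglyMeasurable)) hRz.norm
        (fun _ _ => norm_nonneg _) (fun x _ => integrableOn_rsub_rpow (by linarith) x z z) ?_ ?_
      · intro x hx
        have := hx.1
        have := hx.2
        rw [setIntegral_Ioo_eq hx.2.le, integral_rsub_rpow (by linarith), sub_add_cancel]
        gcongr
      · intro x y _ _ hyz
        rw [norm_smul, Real.norm_of_nonneg (Real.rpow_nonneg (by linarith) _), mul_comm]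
    have i3 : IntegrableOn (fun p : ℝ × ℝ => ((z - p.2) ^ (κ - 1) * (p.2 - p.1) ^ (-κ)) • P p.1)
        (tri a z) := by
      refine tri_integrable_left (f := fun q x => ((z - x) ^ (κ - 1) * (x - q) ^ (-κ)) • P q)
        (g := fun q => ‖P q‖) (K := fun q x => (z - x) ^ (κ - 1) * (x - q) ^ (-κ))
        (C := Real.Gamma κ * Real.Gamma (1 - κ))
        (AEStronglyMeasurable.smul (Measurable.aestronglyMeasurable (by fun_prop))
          (aesm_tri_fst hPz.aestronglyMeasurable)) hPz.norm
        (fun _ _ => norm_nonneg _)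
        (fun x _ => integrableOn_beta (by linarith) (by linarith) (by linarith) (by linarith) x z)
        ?_ ?_
      · intro x hx
        have := integral_beta hκ0 (by linarith : 0 < 1 - κ) hx.2
        rw [show 1 - κ - 1 = -κ by ring, show κ + (1 - κ) = 1 by ring, Real.Gamma_one, sub_self,
          Real.rpow_zero, div_one, mul_one] at this
        rw [setIntegral_Ioo_eq hx.2.le, this]
      · intro x y _ hxy hyz
        have := Real.rpow_nonneg (by linarith : 0 ≤ z - y) (κ - 1)
        have := Real.rpow_nonneg (by linarith : 0 ≤ y - x) (-κ)
        rw [norm_smul, Real.norm_of_nonneg (by positivity), mul_comm]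
    have f2 := (tri_fubini haz.le (f := fun q x => (z - x) ^ (κ - 1) • R q) i2).2.2
    have f3 := (tri_fubini haz.le
      (f := fun q x => ((z - x) ^ (κ - 1) * (x - q) ^ (-κ)) • P q) i3).2.2
    have e2 : ∫ q in a..z, ∫ x in q..z, (z - x) ^ (κ - 1) • R q
        = ∫ q in a..z, ((z - q) ^ κ / κ) • R q := by
      refine integral_congr_Ioo haz.le fun q hq => ?_
      simp only [intervalIntegral.integral_smul_const]
      rw [integral_rsub_rpow (by linarith)]
      simp
    have e3 : ∫ q in a..z, ∫ x in q..z, ((z - x) ^ (κ - 1) * (x - q) ^ (-κ)) • P q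
        = ∫ q in a..z, (Real.Gamma κ * Real.Gamma (1 - κ)) • P q := by
      refine integral_congr_Ioo haz.le fun q hq => ?_
      have := integral_beta hκ0 (by linarith : 0 < 1 - κ) hq.2
      rw [show 1 - κ - 1 = -κ by ring, show κ + (1 - κ) = 1 by ring, Real.Gamma_one, sub_self,
        Real.rpow_zero, div_one, mul_one] at this
      simp only [intervalIntegral.integral_smul_const, this]
    have e4 : ∫ x in a..z, ∫ q in a..x, (z - x) ^ (κ - 1) • R q
        = ∫ x in a..z, ∫ q in a..x, ((z - x) ^ (κ - 1) * (x - q) ^ (-κ)) • P q := by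
      refine integral_congr_Ioo haz.le fun x hx => ?_
      simp only [mul_smul, intervalIntegral.integral_smul]
      rw [h x (sub hx)]
    rw [e1, ← e2, f2, e4, ← f3, e3, intervalIntegral.integral_smul, sub_self]
  filter_upwards [ae_eq_zero_of_primitive hab.le (hI.2.1.sub hP') hz] with σ hσ
  exact sub_eq_zero.1 hσ

/-- Integration by parts of a fractional integral against the solution of Abel's equation. -/
theorem abel_pairing {a b κ : ℝ} (hab : a < b) (hκ0 : 0 < κ) (hκ1 : κ < 1) {P R : ℝ → X}
    (hP : IntegrableOn P (Ioo a b)) (hR : IntegrableOn R (Ioo a b))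
    (h : ∀ x ∈ Ioo a b, ∫ τ in a..x, (x - τ) ^ (-κ) • P τ = ∫ τ in a..x, R τ)
    (B : X →L[ℝ] Z →L[ℝ] W) {k : ℝ → Z}
    (hk : ∀ q ∈ Ioo a b, IntervalIntegrable (fun τ => (τ - q) ^ (κ - 1) • k τ) volume q b)
    (hBk : IntegrableOn (fun p : ℝ × ℝ => (p.2 - p.1) ^ (κ - 1) • B (R p.1) (k p.2)) (tri a b)) :
    IntervalIntegrable (fun q => B (R q) (∫ τ in q..b, (τ - q) ^ (κ - 1) • k τ)) volume a b ∧
    ∫ q in a..b, B (R q) (∫ τ in q..b, (τ - q) ^ (κ - 1) • k τ)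
      = (Real.Gamma κ * Real.Gamma (1 - κ)) • ∫ τ in a..b, B (P τ) (k τ) := by
  have hf := tri_fubini hab.le (f := fun q τ => (τ - q) ^ (κ - 1) • B (R q) (k τ)) hBk
  have e1 : ∀ q ∈ Ioo a b, ∫ τ in q..b, (τ - q) ^ (κ - 1) • B (R q) (k τ)
      = B (R q) (∫ τ in q..b, (τ - q) ^ (κ - 1) • k τ) := by
    intro q hq
    rw [← ContinuousLinearMap.intervalIntegral_comp_comm _ (hk q hq)]
    simp
  refine ⟨hf.1.congr_Ioo hab.le e1, ?_⟩
  rw [← integral_congr_Ioo hab.le e1, hf.2.2, ← intervalIntegral.integral_smul]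
  -- With the order exchanged, the inner integral over q is the fractional integral of `R`, which
  -- Abel inversion identifies with a multiple of `P τ` for almost every τ.
  refine integral_congr_ae_Ioo hab.le ?_
  have hRi : Integrable ((tri a b).indicator fun p : ℝ × ℝ => (p.2 - p.1) ^ (κ - 1) • R p.1)
      ((volume : Measure ℝ).prod (volume : Measure ℝ)) :=
    (integrable_indicator_iff (measurableSet_tri a b)).2
      (tri_integrable_conv_left (by linarith) hR)
  filter_upwards [abel_inversion hab hκ0 hκ1 hP hR h, ae_restrict_mem measurableSet_Ioo,
    ae_restrict_of_ae (s := Ioo a b) hRi.prod_left_ae] with τ hτ hm hi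
  have hi' : IntervalIntegrable (fun q => (τ - q) ^ (κ - 1) • R q) volume a τ := by
    rw [intervalIntegrable_iff_Ioo hm.1.le]
    refine IntegrableOn.congr_fun (hi.integrableOn (s := Ioo a τ)) (fun q hq => ?_) measurableSet_Ioo
    exact indicator_of_mem (show (q, τ) ∈ tri a b from ⟨hq.1, hq.2, hm.2⟩) _
  have e2 : ∫ q in a..τ, (τ - q) ^ (κ - 1) • B (R q) (k τ)
      = B.flip (k τ) (∫ q in a..τ, (τ - q) ^ (κ - 1) • R q) := by
    rw [← ContinuousLinearMap.intervalIntegral_comp_comm _ hi']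
    simp
  simp only [e2, hτ]
  simp

end Abel

/-! ### Paths that are Hölder away from the left endpoint, and their left derivatives -/

section WeightedHolder

variable {X : Type*} [NormedAddCommGroup X]

/-- Bounded functions on `(a, b)` that are `γ`-Hölder away from `a`, with constant
`K (q - a)^{-γ}` on `(q, b)`. -/
structure WHolder (γ a b : ℝ) (y : ℝ → X) : Prop where
  aesm : AEStronglyMeasurable y (volume.restrict (Ioo a b))
  bdd : ∃ M, 0 ≤ M ∧ ∀ r ∈ Ioo a b, ‖y r‖ ≤ M
  hol : ∃ K, 0 ≤ K ∧ ∀ q r, a < q → q < r → r < b → ‖y r - y q‖ ≤ K * (q - a) ^ (-γ) * (r - q) ^ γ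

theorem WHolder.mono {γ a b b' : ℝ} {y : ℝ → X} (h : WHolder γ a b y) (hb : b' ≤ b) :
    WHolder γ a b' y := by
  obtain ⟨M, hM0, hM⟩ := h.bdd
  obtain ⟨K, hK0, hK⟩ := h.hol
  exact ⟨aesm_Ioo_mono h.aesm le_rfl hb, ⟨M, hM0, fun r hr => hM r ⟨hr.1, hr.2.trans_le hb⟩⟩,
    ⟨K, hK0, fun q r hq hqr hr => hK q r hq hqr (hr.trans_le hb)⟩⟩

variable [NormedSpace ℝ X] {γ κ a b : ℝ} {y : ℝ → X}

theorem norm_smul_diff_le {q r K : ℝ} (hqr : q < r) {v : X}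
    (h : ‖v‖ ≤ K * (q - a) ^ (-γ) * (r - q) ^ γ) :
    ‖(r - q) ^ (-(1 + κ)) • v‖ ≤ K * (q - a) ^ (-γ) * (r - q) ^ (γ - 1 - κ) := by
  have h1 : 0 < r - q := sub_pos.2 hqr
  rw [norm_smul, Real.norm_of_nonneg (Real.rpow_nonneg h1.le _),
    show γ - 1 - κ = -(1 + κ) + γ by ring, Real.rpow_add h1]
  have := Real.rpow_nonneg h1.le (-(1 + κ))
  calc _ ≤ (r - q) ^ (-(1 + κ)) * (K * (q - a) ^ (-γ) * (r - q) ^ γ) := by gcongr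
    _ = _ := by ring

theorem WHolder.tri_integrable (h : WHolder γ a b y) (hγ1 : γ < 1) (hκγ : κ < γ) :
    IntegrableOn (fun p : ℝ × ℝ => (p.2 - p.1) ^ (-(1 + κ)) • (y p.2 - y p.1)) (tri a b) := by
  obtain ⟨K, hK0, hK⟩ := h.hol
  exact tri_integrable_pow (f := fun q r => (r - q) ^ (-(1 + κ)) • (y r - y q))
    (p := -γ) (s := γ - 1 - κ) (C := K) (by linarith) (by linarith)
    ((measurable_tri_rpow _).aestronglyMeasurable.smul
      ((aesm_tri_snd h.aesm).sub (aesm_tri_fst h.aesm)))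
    fun q r hq hqr hr => norm_smul_diff_le hqr (hK q r hq hqr hr)

/-- The dominating function is a beta kernel with exponents γ - 1 - κ and -γ, both above -1 because
κ < γ < 1. A general `d` is allowed so that linearised increments are covered as well as `y r - y
q`. -/
theorem intervalIntegrable_singular (hγ1 : γ < 1) (hκ0 : 0 ≤ κ) (hκγ : κ < γ) {r K : ℝ}
    (har : a < r) {d : ℝ → X} (hd : AEStronglyMeasurable d (volume.restrict (Ioo a r)))
    (hK : ∀ q ∈ Ioo a r, ‖d q‖ ≤ K * (q - a) ^ (-γ) * (r - q) ^ γ) :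
    IntervalIntegrable (fun q => (r - q) ^ (-(1 + κ)) • d q) volume a r := by
  refine intervalIntegrable_of_bound har.le
    (g := fun q => K * ((r - q) ^ (γ - 1 - κ) * (q - a) ^ (-γ)))
    (((intervalIntegrable_iff_Ioo har.le).2 (integrableOn_beta (by linarith) (by linarith)
      (by linarith) (by linarith) a r)).const_mul K)
    ((measurable_rsub_rpow _ _).aestronglyMeasurable.smul hd) fun q hq => ?_
  refine (norm_smul_diff_le hq.2 (hK q hq)).trans_eq ?_
  ring

/-- The exponents γ - 1 - κ and -γ of the beta integral add up, with the length, to -κ. The weight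
of the Hölder constant thus leaves no trace, and the bound blows up only like the boundary term of
the derivative. -/
theorem norm_integral_singular_le (hγ1 : γ < 1) (hκ0 : 0 ≤ κ) (hκγ : κ < γ) {r K : ℝ}
    (har : a < r) {d : ℝ → X}
    (hK : ∀ q ∈ Ioo a r, ‖d q‖ ≤ K * (q - a) ^ (-γ) * (r - q) ^ γ) :
    ‖∫ q in a..r, (r - q) ^ (-(1 + κ)) • d q‖
      ≤ K * (Real.Gamma (γ - κ) * Real.Gamma (1 - γ) / Real.Gamma (1 - κ)) * (r - a) ^ (-κ) := by
  have hi : IntervalIntegrable (fun q => (r - q) ^ (γ - κ - 1) * (q - a) ^ (1 - γ - 1)) volume a r :=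
    (intervalIntegrable_iff_Ioo har.le).2 (integrableOn_beta (by linarith) (by linarith)
      (by linarith) (by linarith) a r)
  have hb := integral_beta (by linarith : 0 < γ - κ) (by linarith : 0 < 1 - γ) har
  rw [show γ - κ + (1 - γ) = 1 - κ by ring, show 1 - κ - 1 = -κ by ring] at hb
  rw [mul_assoc, ← hb, ← intervalIntegral.integral_const_mul, ← setIntegral_Ioo_eq har.le,
    ← setIntegral_Ioo_eq har.le]
  refine norm_integral_le_of_norm_le ((intervalIntegrable_iff_Ioo har.le).1 (hi.const_mul K)) ?_
  filter_upwards [ae_restrict_mem measurableSet_Ioo] with q hq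
  refine (norm_smul_diff_le hq.2 (hK q hq)).trans_eq ?_
  rw [show 1 - γ - 1 = -γ by ring, show γ - κ - 1 = γ - 1 - κ by ring]
  ring

theorem WHolder.leftFracExists (h : WHolder γ a b y) (hγ1 : γ < 1) (hκ0 : 0 ≤ κ)
    (hκγ : κ < γ) {r : ℝ} (hr : r ∈ Ioo a b) : LeftFracExists κ a y r := by
  obtain ⟨K, hK0, hK⟩ := h.hol
  exact intervalIntegrable_singular hγ1 hκ0 hκγ hr.1
    (aestronglyMeasurable_const.sub (aesm_Ioo_mono h.aesm le_rfl hr.2.le))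
    fun q hq => hK q r hq.1 hq.2 hr.2

theorem WHolder.leftFrac_bound (h : WHolder γ a b y) (hγ1 : γ < 1) (hκ0 : 0 ≤ κ)
    (hκγ : κ < γ) : ∃ C, 0 ≤ C ∧ ∀ r ∈ Ioo a b, ‖leftFrac κ a y r‖ ≤ C * (r - a) ^ (-κ) := by
  obtain ⟨K, hK0, hK⟩ := h.hol
  obtain ⟨M, hM0, hM⟩ := h.bdd
  have hG : 0 < Real.Gamma (1 - κ) := Real.Gamma_pos_of_pos (by linarith)
  have hG1 : 0 < Real.Gamma (γ - κ) := Real.Gamma_pos_of_pos (by linarith)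
  have hG2 : 0 < Real.Gamma (1 - γ) := Real.Gamma_pos_of_pos (by linarith)
  refine ⟨(Real.Gamma (1 - κ))⁻¹ * (M + κ * (K * (Real.Gamma (γ - κ) * Real.Gamma (1 - γ)
    / Real.Gamma (1 - κ)))), by positivity, fun r hr => ?_⟩
  have h1 := norm_integral_singular_le hγ1 hκ0 hκγ hr.1 (d := fun q => y r - y q)
    fun q hq => hK q r hq.1 hq.2 hr.2
  have h2 := Real.rpow_nonneg (sub_nonneg.2 hr.1.le) (-κ)
  rw [leftFrac, norm_smul, Real.norm_of_nonneg (by positivity), mul_assoc]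
  gcongr
  refine (norm_add_le _ _).trans ?_
  rw [norm_smul, norm_smul, Real.norm_of_nonneg h2, Real.norm_of_nonneg hκ0, add_mul, mul_comm]
  rw [mul_assoc κ]
  gcongr
  exact hM r hr

theorem WHolder.leftFrac_aesm (h : WHolder γ a b y) (hab : a ≤ b) (hγ1 : γ < 1) (hκγ : κ < γ) :
    AEStronglyMeasurable (leftFrac κ a y) (volume.restrict (Ioo a b)) := by
  have h1 := (tri_fubini hab (f := fun q r => (r - q) ^ (-(1 + κ)) • (y r - y q))
    (h.tri_integrable hγ1 hκγ)).2.1.aesm_Ioo hab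
  exact (((measurable_sub_rpow _ _).aestronglyMeasurable.smul h.aesm).add
    (h1.const_smul κ)).const_smul _

theorem WHolder.leftFrac_integrable (h : WHolder γ a b y) (hab : a ≤ b) (hγ1 : γ < 1)
    (hκ0 : 0 ≤ κ) (hκγ : κ < γ) : IntegrableOn (leftFrac κ a y) (Ioo a b) := by
  obtain ⟨C, hC0, hC⟩ := h.leftFrac_bound hγ1 hκ0 hκγ
  rw [← intervalIntegrable_iff_Ioo hab]
  exact intervalIntegrable_of_bound hab ((intervalIntegrable_sub_rpow (by linarith) a b a).const_mul C)
    (h.leftFrac_aesm hab hγ1 hκγ) hC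

omit [NormedSpace ℝ X] in
theorem WHolder.integrableOn (h : WHolder γ a b y) : IntegrableOn y (Ioo a b) := by
  obtain ⟨M, hM0, hM⟩ := h.bdd
  refine (integrableOn_const (C := M) (by simp)).mono' h.aesm ?_
  filter_upwards [ae_restrict_mem measurableSet_Ioo] with r hr using hM r hr

/-- `integral_marchaud` on `(a, x)` turns the double integral contained in ∫ D^κ y into an integral
against (x - z)^(-κ) - (z - a)^(-κ), and the second kernel cancels the boundary term of D^κ y. This
is Abel's equation with `P = y` and `R` a multiple of D^κ y. -/
theorem WHolder.integral_leftFrac [CompleteSpace X] (h : WHolder γ a b y) (hγ1 : γ < 1)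
    (hκ0 : 0 < κ) (hκγ : κ < γ) {x : ℝ} (hx : x ∈ Ioo a b) :
    ∫ τ in a..x, (x - τ) ^ (-κ) • y τ = ∫ τ in a..x, Real.Gamma (1 - κ) • leftFrac κ a y τ := by
  have h' := h.mono hx.2.le
  obtain ⟨M, hM0, hM⟩ := h'.bdd
  have hG : Real.Gamma (1 - κ) ≠ 0 := (Real.Gamma_pos_of_pos (by linarith)).ne'
  have e := integral_marchaud hx.1 hκ0 (by linarith) h'.aesm hM (h'.tri_integrable hγ1 hκγ)
  have i1 : IntervalIntegrable (fun z => (z - a) ^ (-κ) • y z) volume a x :=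
    intervalIntegrable_of_bound hx.1.le (g := fun z => (z - a) ^ (-κ) * M)
      ((intervalIntegrable_sub_rpow (by linarith) a x a).mul_const M)
      ((measurable_sub_rpow _ _).aestronglyMeasurable.smul h'.aesm) fun z hz => by
        have := Real.rpow_nonneg (sub_nonneg.2 hz.1.le) (-κ)
        rw [norm_smul, Real.norm_of_nonneg this]
        gcongr
        exact hM z hz
  have i2 : IntervalIntegrable (fun z => (x - z) ^ (-κ) • y z) volume a x :=
    intervalIntegrable_of_bound hx.1.le (g := fun z => (x - z) ^ (-κ) * M)
      ((intervalIntegrable_rsub_rpow (by linarith) a x x).mul_const M)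
      ((measurable_rsub_rpow _ _).aestronglyMeasurable.smul h'.aesm) fun z hz => by
        have := Real.rpow_nonneg (sub_nonneg.2 hz.2.le) (-κ)
        rw [norm_smul, Real.norm_of_nonneg this]
        gcongr
        exact hM z hz
  have i3 := (tri_fubini hx.1.le (f := fun q r => (r - q) ^ (-(1 + κ)) • (y r - y q))
    (h'.tri_integrable hγ1 hκγ)).2.1
  have i4 : IntervalIntegrable
      (fun r => κ • ∫ q in a..r, (r - q) ^ (-(1 + κ)) • (y r - y q)) volume a x := i3.smul κ
  have e2 : ∫ τ in a..x, Real.Gamma (1 - κ) • leftFrac κ a y τ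
      = (∫ z in a..x, (z - a) ^ (-κ) • y z)
        + κ • ∫ r in a..x, ∫ q in a..r, (r - q) ^ (-(1 + κ)) • (y r - y q) := by
    rw [← intervalIntegral.integral_smul, ← intervalIntegral.integral_add i1 i4]
    refine intervalIntegral.integral_congr fun r _ => ?_
    simp only [leftFrac, smul_smul, mul_inv_cancel₀ hG, one_smul]
  rw [e2, e]
  simp_rw [sub_smul]
  rw [intervalIntegral.integral_sub i2 i1]
  abel

end WeightedHolder

/-! ### Fractional integration by parts against a fractional integral -/

section Pairing

variable {X Z W : Type*} [NormedAddCommGroup X] [NormedSpace ℝ X] [CompleteSpace X]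
  [NormedAddCommGroup Z] [NormedSpace ℝ Z] [CompleteSpace Z]
  [NormedAddCommGroup W] [NormedSpace ℝ W] [CompleteSpace W]
  {γ γ' κ a b : ℝ} {y : ℝ → X}

omit [CompleteSpace Z] in
theorem intervalIntegrable_kernel (hκ0 : 0 < κ) (hγ0' : 0 ≤ γ') {k : ℝ → Z}
    (hk : AEStronglyMeasurable k (volume.restrict (Ioo a b))) {M : ℝ} (hM0 : 0 ≤ M)
    (hkM : ∀ τ ∈ Ioo a b, ‖k τ‖ ≤ M * (τ - a) ^ (-γ')) {q : ℝ} (hq : q ∈ Ioo a b) :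
    IntervalIntegrable (fun τ => (τ - q) ^ (κ - 1) • k τ) volume q b := by
  refine intervalIntegrable_of_bound hq.2.le
    (g := fun τ => (τ - q) ^ (κ - 1) * (M * (q - a) ^ (-γ')))
    ((intervalIntegrable_sub_rpow (by linarith) q b q).mul_const _)
    ((measurable_sub_rpow _ _).aestronglyMeasurable.smul (aesm_Ioo_mono hk hq.1.le le_rfl))
    fun τ hτ => ?_
  have h1 := Real.rpow_nonneg (sub_nonneg.2 hτ.1.le) (κ - 1)
  rw [norm_smul, Real.norm_of_nonneg h1]
  refine mul_le_mul_of_nonneg_left ((hkM τ ⟨hq.1.trans hτ.1, hτ.2⟩).trans ?_) h1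
  refine mul_le_mul_of_nonneg_left ?_ hM0
  exact Real.rpow_le_rpow_of_nonpos (sub_pos.2 hq.1) (by linarith [hτ.1]) (by linarith)

/-- Integration by parts `∫ D^κ y · I^κ k = ∫ y k`, with a singularity of `k` allowed at `a`. -/
theorem WHolder.pairing (hab : a < b) (h : WHolder γ a b y) (hγ1 : γ < 1)
    (hκ0 : 0 < κ) (hκγ : κ < γ) (B : X →L[ℝ] Z →L[ℝ] W) (hγ0' : 0 ≤ γ') (hγ1' : γ' < 1) {k : ℝ → Z}
    (hk : AEStronglyMeasurable k (volume.restrict (Ioo a b))) {M : ℝ} (hM0 : 0 ≤ M)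
    (hkM : ∀ τ ∈ Ioo a b, ‖k τ‖ ≤ M * (τ - a) ^ (-γ')) :
    IntervalIntegrable (fun q => B (leftFrac κ a y q) (∫ τ in q..b, (τ - q) ^ (κ - 1) • k τ))
      volume a b ∧
    ∫ q in a..b, B (leftFrac κ a y q) (∫ τ in q..b, (τ - q) ^ (κ - 1) • k τ)
      = Real.Gamma κ • ∫ τ in a..b, B (y τ) (k τ) := by
  have hG : Real.Gamma (1 - κ) ≠ 0 := (Real.Gamma_pos_of_pos (by linarith)).ne'
  obtain ⟨C, hC0, hC⟩ := h.leftFrac_bound hγ1 hκ0.le hκγ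
  have hL := h.leftFrac_integrable hab.le hγ1 hκ0.le hκγ
  have hm := h.leftFrac_aesm hab.le hγ1 hκγ
  have hBk : IntegrableOn (fun p : ℝ × ℝ => (p.2 - p.1) ^ (κ - 1) •
      B (Real.Gamma (1 - κ) • leftFrac κ a y p.1) (k p.2)) (tri a b) := by
    have e0 : 0 < (1 - κ) * (1 - γ') := mul_pos (by linarith) (by linarith)
    refine tri_integrable_pow (f := fun q τ => (τ - q) ^ (κ - 1) •
      B (Real.Gamma (1 - κ) • leftFrac κ a y q) (k τ))
      (p := -κ - (γ' - κ * γ')) (s := κ - 1 - κ * γ')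
      (C := ‖B‖ * (|Real.Gamma (1 - κ)| * C) * M)
      (by nlinarith) (by nlinarith)
      ((measurable_tri_rpow _).aestronglyMeasurable.smul
        (B.aestronglyMeasurable_comp₂ (aesm_tri_fst (hm.const_smul _)) (aesm_tri_snd hk))) ?_
    intro q τ hq hqτ hτ
    have h1 : 0 < τ - q := sub_pos.2 hqτ
    have h2 : 0 < q - a := sub_pos.2 hq
    -- The singularity of `k` at a is shared between the diagonal and the endpoint in the proportion
    -- κ : 1 - κ. The total exponents κ - 1 - κγ' and -κ - (1-κ)γ' then exceed -1 by κ(1-γ') and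
    -- (1-κ)(1-γ').
    have h3 : (τ - a) ^ (-γ') ≤ (τ - q) ^ (-(κ * γ')) * (q - a) ^ (-(γ' - κ * γ')) := by
      rw [show -γ' = -(κ * γ') + -(γ' - κ * γ') by ring, Real.rpow_add (by linarith)]
      have t1 : (τ - a) ^ (-(κ * γ')) ≤ (τ - q) ^ (-(κ * γ')) :=
        Real.rpow_le_rpow_of_nonpos h1 (by linarith) (by nlinarith)
      have t2 : (τ - a) ^ (-(γ' - κ * γ')) ≤ (q - a) ^ (-(γ' - κ * γ')) :=
        Real.rpow_le_rpow_of_nonpos h2 (by linarith) (by nlinarith)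
      exact mul_le_mul t1 t2 (Real.rpow_nonneg (by linarith) _) (Real.rpow_nonneg h1.le _)
    rw [norm_smul, Real.norm_of_nonneg (Real.rpow_nonneg h1.le _)]
    calc (τ - q) ^ (κ - 1) * ‖B (Real.Gamma (1 - κ) • leftFrac κ a y q) (k τ)‖
        ≤ (τ - q) ^ (κ - 1) * (‖B‖ * (|Real.Gamma (1 - κ)| * (C * (q - a) ^ (-κ)))
          * (M * ((τ - q) ^ (-(κ * γ')) * (q - a) ^ (-(γ' - κ * γ'))))) := by
          have := Real.rpow_nonneg h1.le (κ - 1)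
          have := Real.rpow_nonneg h2.le (-κ)
          gcongr
          refine (B.le_opNorm₂ _ _).trans ?_
          gcongr
          · rw [norm_smul, Real.norm_eq_abs]
            gcongr
            exact hC q ⟨hq, hqτ.trans hτ⟩
          · exact (hkM τ ⟨hq.trans hqτ, hτ⟩).trans (by gcongr)
      _ = _ := by
          rw [show -κ - (γ' - κ * γ') = -κ + -(γ' - κ * γ') by ring,
            show κ - 1 - κ * γ' = (κ - 1) + -(κ * γ') by ring, Real.rpow_add h1, Real.rpow_add h2]
          ring
  have key := abel_pairing hab hκ0 (by linarith) (P := y)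
    (R := fun q => Real.Gamma (1 - κ) • leftFrac κ a y q) h.integrableOn (Integrable.smul _ hL)
    (fun x hx => h.integral_leftFrac hγ1 hκ0 hκγ hx) B
    (fun q hq => intervalIntegrable_kernel hκ0 hγ0' hk hM0 hkM hq) hBk
  constructor
  · refine (key.1.smul (Real.Gamma (1 - κ))⁻¹).congr_Ioo hab.le fun q _ => ?_
    simp [smul_smul, hG]
  · have := congrArg (fun w => (Real.Gamma (1 - κ))⁻¹ • w) key.2
    simp only [map_smul, smul_apply, intervalIntegral.integral_smul, smul_smul,
      inv_mul_cancel₀ hG, one_smul] at this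
    rw [this]
    congr 1
    field_simp

end Pairing

/-! ### Right derivatives of functions with a bounded density -/

section RightDerivative

variable {E : Type*} [NormedAddCommGroup E] [NormedSpace ℝ E]

theorem integral_smul_sub_comm (c : ℝ → ℝ) (U : ℝ → E) (r b x : ℝ) :
    ∫ q in r..b, c q • (U x - U q) = -∫ q in r..b, c q • (U q - U x) := by
  rw [← intervalIntegral.integral_neg]
  refine intervalIntegral.integral_congr fun q _ => ?_
  simp only [← smul_neg, neg_sub]

theorem integral_rpow_above {κ : ℝ} (hκ : 0 < κ) {r σ b : ℝ} (hr : r < σ) (hσ : σ ≤ b) :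
    ∫ τ in σ..b, κ * (τ - r) ^ (-(1 + κ)) = (σ - r) ^ (-κ) - (b - r) ^ (-κ) := by
  have h := integral_shifted_rpow hκ (sub_pos.2 hr) hσ
  rw [show b - σ + (σ - r) = b - r by ring] at h
  rw [← h]
  refine intervalIntegral.integral_congr fun τ _ => ?_
  simp only [sub_add_sub_cancel]

/-- Integration by parts for the singular kernel against a primitive. -/
theorem primitive_rpow [CompleteSpace E] {κ r b M : ℝ} (hκ0 : 0 < κ) (hκ1 : κ < 1) (hrb : r < b)
    {l L : ℝ → E} (hl : AEStronglyMeasurable l (volume.restrict (Ioo r b)))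
    (hM : ∀ τ ∈ Ioo r b, ‖l τ‖ ≤ M) (hL : ∀ τ ∈ Ioc r b, L τ = ∫ σ in r..τ, l σ) :
    IntervalIntegrable (fun τ => (τ - r) ^ (-(1 + κ)) • L τ) volume r b ∧
    (b - r) ^ (-κ) • L b + κ • ∫ τ in r..b, (τ - r) ^ (-(1 + κ)) • L τ
      = ∫ τ in r..b, (τ - r) ^ (-κ) • l τ := by
  have hM0 : 0 ≤ M := (norm_nonneg _).trans (hM ((r + b) / 2) ⟨by linarith, by linarith⟩)
  have hf : IntegrableOn (fun p : ℝ × ℝ => (κ * (p.2 - r) ^ (-(1 + κ))) • l p.1) (tri r b) := by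
    -- The power -(1+κ) is split as -1 and -κ: the factor (τ - r)⁻¹ has mass exactly one over r < σ
    -- < τ, and (τ - r)^(-κ) is integrable.
    refine tri_integrable_right (f := fun σ τ => (κ * (τ - r) ^ (-(1 + κ))) • l σ)
      (K := fun _ τ => (τ - r)⁻¹) (g := fun τ => κ * M * (τ - r) ^ (-κ)) (C := 1)
      (AEStronglyMeasurable.smul (Measurable.aestronglyMeasurable (by fun_prop)) (aesm_tri_fst hl))
      ((integrableOn_sub_rpow (by linarith) r b r).const_mul _)
      (fun τ hτ => mul_nonneg (by positivity) (Real.rpow_nonneg (sub_nonneg.2 hτ.1.le) _))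
      (fun τ _ => integrableOn_const (by simp)) ?_ ?_
    · intro τ hτ
      rw [setIntegral_Ioo_eq hτ.1.le, intervalIntegral.integral_const, smul_eq_mul,
        mul_inv_cancel₀ (sub_pos.2 hτ.1).ne']
    · intro σ τ hσ hστ hτ
      have h1 : 0 < τ - r := by linarith
      have h2 : (τ - r) ^ (-(1 + κ)) = (τ - r)⁻¹ * (τ - r) ^ (-κ) := by
        rw [neg_add, Real.rpow_add h1, Real.rpow_neg_one]
      rw [norm_smul, Real.norm_of_nonneg (by positivity), h2]
      calc _ ≤ κ * ((τ - r)⁻¹ * (τ - r) ^ (-κ)) * M := by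
            gcongr
            exact hM σ ⟨hσ, hστ.trans hτ⟩
        _ = _ := by ring
  have h3 := tri_fubini hrb.le (f := fun σ τ => (κ * (τ - r) ^ (-(1 + κ))) • l σ) hf
  have e1 : ∀ τ ∈ Ioo r b, ∫ σ in r..τ, (κ * (τ - r) ^ (-(1 + κ))) • l σ
      = κ • (τ - r) ^ (-(1 + κ)) • L τ := by
    intro τ hτ
    rw [intervalIntegral.integral_smul, hL τ ⟨hτ.1, hτ.2.le⟩, smul_smul]
  have i1 := h3.2.1.congr_Ioo hrb.le e1
  have hi : IntervalIntegrable (fun τ => (τ - r) ^ (-(1 + κ)) • L τ) volume r b := by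
    refine (i1.smul κ⁻¹).congr_Ioo hrb.le fun τ _ => ?_
    simp [smul_smul, hκ0.ne']
  refine ⟨hi, ?_⟩
  have e2 : ∫ σ in r..b, ∫ τ in σ..b, (κ * (τ - r) ^ (-(1 + κ))) • l σ
      = ∫ σ in r..b, ((σ - r) ^ (-κ) • l σ - (b - r) ^ (-κ) • l σ) := by
    refine integral_congr_Ioo hrb.le fun σ hσ => ?_
    rw [intervalIntegral.integral_smul_const, integral_rpow_above hκ0 hσ.1 hσ.2.le, sub_smul]
  have hli : IntervalIntegrable l volume r b :=
    intervalIntegrable_of_bound hrb.le (g := fun _ => M) (by simp) hl hM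
  have hli2 : IntervalIntegrable (fun σ => (σ - r) ^ (-κ) • l σ) volume r b := by
    refine intervalIntegrable_of_bound hrb.le (g := fun σ => (σ - r) ^ (-κ) * M)
      ((intervalIntegrable_sub_rpow (by linarith) r b r).mul_const M)
      ((measurable_sub_rpow _ _).aestronglyMeasurable.smul hl) fun σ hσ => ?_
    have := Real.rpow_nonneg (sub_nonneg.2 hσ.1.le) (-κ)
    rw [norm_smul, Real.norm_of_nonneg this]
    gcongr
    exact hM σ hσ
  have hli3 : IntervalIntegrable (fun σ => (b - r) ^ (-κ) • l σ) volume r b := hli.smul _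
  rw [← intervalIntegral.integral_smul, ← integral_congr_Ioo hrb.le e1, ← h3.2.2, e2,
    intervalIntegral.integral_sub hli2 hli3, intervalIntegral.integral_smul, ← hL b ⟨hrb, le_rfl⟩]
  abel

variable [CompleteSpace E] {a b : ℝ}

/-- Boundary term and integral of the derivative of `g - g b` at r are the negatives of those for
the primitive `τ ↦ g τ - g r`, to which `primitive_rpow` applies. -/
theorem rightFrac_of_primitive {κ M : ℝ} (hκ0 : 0 < κ) (hκ1 : κ < 1) {k g : ℝ → E}
    (hk : AEStronglyMeasurable k (volume.restrict (Ioo a b))) (hM : ∀ τ ∈ Ioo a b, ‖k τ‖ ≤ M)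
    (hg : ∀ q r, a < q → q ≤ r → r ≤ b → g r - g q = ∫ τ in q..r, k τ) {r : ℝ} (hr : r ∈ Ioo a b) :
    RightFracExists κ b (fun ρ => g ρ - g b) r ∧
    rightFrac κ b (fun ρ => g ρ - g b) r
      = -((Real.Gamma (1 - κ))⁻¹ • ∫ τ in r..b, (τ - r) ^ (-κ) • k τ) := by
  have h := primitive_rpow hκ0 hκ1 hr.2 (L := fun τ => g τ - g r) (aesm_Ioo_mono hk hr.1.le le_rfl)
    (fun τ hτ => hM τ ⟨hr.1.trans hτ.1, hτ.2⟩) fun τ hτ => hg r τ hr.1 hτ.1.le hτ.2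
  have e : ∀ q, (q - r) ^ (-(1 + κ)) • (g r - g b - (g q - g b))
      = -((q - r) ^ (-(1 + κ)) • (g q - g r)) := by
    intro q
    rw [← smul_neg]
    congr 1
    abel
  constructor
  · simp only [RightFracExists, e]
    exact h.1.neg
  · simp only [rightFrac, e]
    rw [← h.2, intervalIntegral.integral_neg, ← neg_sub (g b) (g r), smul_neg, smul_neg, ← neg_add,
      smul_neg]

/-- Only the section `v r` enters, so the density `l` may depend on r, as m(y(ρ) - y(r), k(ρ)) does
for the second order tensors. -/
theorem rightFracTwo_of_primitive {κ M : ℝ} (hκ0 : 0 < κ) (hκ1 : κ < 1) {r : ℝ} (hr : r < b)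
    {l : ℝ → E} {v : ℝ → ℝ → E}
    (hl : AEStronglyMeasurable l (volume.restrict (Ioo r b))) (hM : ∀ τ ∈ Ioo r b, ‖l τ‖ ≤ M)
    (hv : ∀ τ ∈ Ioc r b, v r τ = ∫ σ in r..τ, l σ) :
    RightFracTwoExists κ b v r ∧
    rightFracTwo κ b v r = (Real.Gamma (1 - κ))⁻¹ • ∫ τ in r..b, (τ - r) ^ (-κ) • l τ := by
  have h := primitive_rpow hκ0 hκ1 hr (L := v r) hl hM hv
  exact ⟨h.1, by rw [rightFracTwo, h.2]⟩

end RightDerivative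

/-! ### Right-sided fractional integrals of bounded functions -/

section FractionalIntegral

variable {E : Type*} [NormedAddCommGroup E] [NormedSpace ℝ E] [CompleteSpace E]

omit [CompleteSpace E] in
theorem intervalIntegrable_rpow_smul {a b s M : ℝ} (hs : -1 < s) {Ψ : ℝ → E}
    (hΨ : AEStronglyMeasurable Ψ (volume.restrict (Ioo a b))) (hM : ∀ ρ ∈ Ioo a b, ‖Ψ ρ‖ ≤ M)
    {c d e : ℝ} (he : e ≤ c) (hc : a ≤ c) (hcd : c ≤ d) (hd : d ≤ b) :
    IntervalIntegrable (fun ρ => (ρ - e) ^ s • Ψ ρ) volume c d := by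
  refine intervalIntegrable_of_bound hcd (g := fun ρ => (ρ - e) ^ s * M)
    ((intervalIntegrable_sub_rpow hs c d e).mul_const M)
    ((measurable_sub_rpow _ _).aestronglyMeasurable.smul (aesm_Ioo_mono hΨ hc hd)) fun ρ hρ => ?_
  have := Real.rpow_nonneg (by linarith [hρ.1] : 0 ≤ ρ - e) s
  rw [norm_smul, Real.norm_of_nonneg this]
  gcongr
  exact hM ρ ⟨hc.trans_lt hρ.1, hρ.2.trans_le hd⟩

omit [CompleteSpace E] in
/-- Fractional integrals of bounded functions are Hölder continuous. -/
theorem fracIntegral_holder {a b α M : ℝ} (hα0 : 0 < α) (hα1 : α < 1) {Ψ : ℝ → E}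
    (hΨ : AEStronglyMeasurable Ψ (volume.restrict (Ioo a b))) (hM : ∀ ρ ∈ Ioo a b, ‖Ψ ρ‖ ≤ M)
    {r q : ℝ} (hr : a ≤ r) (hrq : r < q) (hq : q < b) :
    ‖(∫ ρ in r..b, (ρ - r) ^ (α - 1) • Ψ ρ) - ∫ ρ in q..b, (ρ - q) ^ (α - 1) • Ψ ρ‖
      ≤ 2 * M / α * (q - r) ^ α := by
  have hM0 : 0 ≤ M := (norm_nonneg _).trans (hM q ⟨hr.trans_lt hrq, hq⟩)
  have i1 := intervalIntegrable_rpow_smul (s := α - 1) (by linarith) hΨ hM le_rfl hr hrq.le hq.le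
  have i2 := intervalIntegrable_rpow_smul (s := α - 1) (by linarith) hΨ hM hrq.le (hr.trans hrq.le)
    hq.le le_rfl
  have i3 := intervalIntegrable_rpow_smul (s := α - 1) (by linarith) hΨ hM le_rfl
    (hr.trans hrq.le) hq.le le_rfl
  rw [← intervalIntegral.integral_add_adjacent_intervals i1 i2, add_sub_assoc,
    ← intervalIntegral.integral_sub i2 i3]
  have n1 : ‖∫ ρ in r..q, (ρ - r) ^ (α - 1) • Ψ ρ‖ ≤ M / α * (q - r) ^ α := by
    have e : M / α * (q - r) ^ α = ∫ ρ in Ioo r q, (ρ - r) ^ (α - 1) * M := by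
      rw [setIntegral_Ioo_eq hrq.le, intervalIntegral.integral_mul_const,
        integral_sub_rpow (by linarith), sub_add_cancel]
      ring
    rw [e, ← setIntegral_Ioo_eq hrq.le]
    refine norm_integral_le_of_norm_le ((integrableOn_sub_rpow (by linarith) r q r).mul_const M) ?_
    filter_upwards [ae_restrict_mem measurableSet_Ioo] with ρ hρ
    have := Real.rpow_nonneg (sub_nonneg.2 hρ.1.le) (α - 1)
    rw [norm_smul, Real.norm_of_nonneg this]
    gcongr
    exact hM ρ ⟨hr.trans_lt hρ.1, hρ.2.trans hq⟩
  -- The kernel decreases in the distance, so the difference of kernels has constant sign. Its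
  -- integral is ((b - q)^α - (b - r)^α + (q - r)^α) / α up to sign, and the first two terms
  -- together are nonpositive.
  have n2 : ‖∫ ρ in q..b, ((ρ - r) ^ (α - 1) • Ψ ρ - (ρ - q) ^ (α - 1) • Ψ ρ)‖
      ≤ M / α * (q - r) ^ α := by
    have e0 : ∫ ρ in q..b, (ρ - r) ^ (α - 1) = (b - r) ^ α / α - (q - r) ^ α / α := by
      rw [intervalIntegral.integral_comp_sub_right (fun y => y ^ (α - 1)),
        integral_rpow (Or.inl (by linarith)), sub_add_cancel]
      ring
    have j1 := intervalIntegrable_sub_rpow (by linarith : -1 < α - 1) q b q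
    have j2 := intervalIntegrable_sub_rpow (by linarith : -1 < α - 1) q b r
    have e : ∫ ρ in Ioo q b, ((ρ - q) ^ (α - 1) - (ρ - r) ^ (α - 1)) * M
        ≤ M / α * (q - r) ^ α := by
      rw [setIntegral_Ioo_eq hq.le, intervalIntegral.integral_mul_const,
        intervalIntegral.integral_sub j1 j2, integral_sub_rpow (by linarith), e0, sub_add_cancel]
      have : (b - q) ^ α ≤ (b - r) ^ α :=
        Real.rpow_le_rpow (by linarith) (by linarith) hα0.le
      have h2 : ((b - q) ^ α / α - ((b - r) ^ α / α - (q - r) ^ α / α)) ≤ (q - r) ^ α / α := by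
        have : (b - q) ^ α / α ≤ (b - r) ^ α / α := by gcongr
        linarith
      calc _ ≤ (q - r) ^ α / α * M := by gcongr
        _ = _ := by ring
    refine le_trans ?_ e
    rw [← setIntegral_Ioo_eq hq.le]
    refine norm_integral_le_of_norm_le (((intervalIntegrable_iff_Ioo hq.le).1
      (j1.sub j2)).mul_const M) ?_
    filter_upwards [ae_restrict_mem measurableSet_Ioo] with ρ hρ
    have h1 : (ρ - r) ^ (α - 1) ≤ (ρ - q) ^ (α - 1) :=
      Real.rpow_le_rpow_of_nonpos (sub_pos.2 hρ.1) (by linarith) (by linarith)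
    rw [← sub_smul, norm_smul, Real.norm_eq_abs, abs_sub_comm, abs_of_nonneg (sub_nonneg.2 h1)]
    refine mul_le_mul_of_nonneg_left (hM ρ ⟨(hr.trans_lt hrq).trans hρ.1, hρ.2⟩) (sub_nonneg.2 h1)
  calc _ ≤ M / α * (q - r) ^ α + M / α * (q - r) ^ α := (norm_add_le _ _).trans (add_le_add n1 n2)
    _ = _ := by ring

omit [CompleteSpace E] in
theorem tri_integrable_fracIntegral {a b s M : ℝ} (hs : -1 < s) {Ψ : ℝ → E}
    (hΨ : AEStronglyMeasurable Ψ (volume.restrict (Ioo a b))) (hM : ∀ ρ ∈ Ioo a b, ‖Ψ ρ‖ ≤ M) :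
    IntegrableOn (fun p : ℝ × ℝ => (p.2 - p.1) ^ s • Ψ p.2) (tri a b) := by
  refine tri_integrable_pow (f := fun r ρ => (ρ - r) ^ s • Ψ ρ) (p := 0) (s := s) (C := M)
    (by norm_num) hs ((measurable_tri_rpow _).aestronglyMeasurable.smul (aesm_tri_snd hΨ)) ?_
  intro r ρ hr hrρ hρ
  have := Real.rpow_nonneg (sub_nonneg.2 hrρ.le) s
  rw [norm_smul, Real.norm_of_nonneg this, Real.rpow_zero, mul_one, mul_comm]
  gcongr
  exact hM ρ ⟨hr.trans hrρ, hρ⟩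

omit [CompleteSpace E] in
theorem fracIntegral_aesm {a b s M : ℝ} (hab : a ≤ b) (hs : -1 < s) {Ψ : ℝ → E}
    (hΨ : AEStronglyMeasurable Ψ (volume.restrict (Ioo a b))) (hM : ∀ ρ ∈ Ioo a b, ‖Ψ ρ‖ ≤ M) :
    AEStronglyMeasurable (fun r => ∫ ρ in r..b, (ρ - r) ^ s • Ψ ρ) (volume.restrict (Ioo a b)) :=
  (tri_fubini hab (f := fun r ρ => (ρ - r) ^ s • Ψ ρ)
    (tri_integrable_fracIntegral hs hΨ hM)).1.aesm_Ioo hab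

omit [CompleteSpace E] in
theorem fracIntegral_bound {a b s M : ℝ} (hs : -1 < s) {Ψ : ℝ → E}
    (hM : ∀ ρ ∈ Ioo a b, ‖Ψ ρ‖ ≤ M) {r : ℝ} (hr : r ∈ Ioo a b) :
    ‖∫ ρ in r..b, (ρ - r) ^ s • Ψ ρ‖ ≤ M * (b - a) ^ (s + 1) / (s + 1) := by
  have hM0 : 0 ≤ M := (norm_nonneg _).trans (hM r hr)
  have e : ∫ ρ in Ioo r b, (ρ - r) ^ s * M ≤ M * (b - a) ^ (s + 1) / (s + 1) := by
    rw [setIntegral_Ioo_eq hr.2.le, intervalIntegral.integral_mul_const, integral_sub_rpow hs,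
      mul_comm, ← mul_div_assoc]
    have := hr.1
    have := hr.2
    gcongr <;> linarith
  refine le_trans ?_ e
  rw [← setIntegral_Ioo_eq hr.2.le]
  refine norm_integral_le_of_norm_le ((integrableOn_sub_rpow hs r b r).mul_const M) ?_
  filter_upwards [ae_restrict_mem measurableSet_Ioo] with ρ hρ
  have := Real.rpow_nonneg (sub_nonneg.2 hρ.1.le) s
  rw [norm_smul, Real.norm_of_nonneg this]
  gcongr
  exact hM ρ ⟨hr.1.trans hρ.1, hρ.2⟩

omit [CompleteSpace E] in
-- The fractional integral is α-Hölder, and α exceeds the order 1 - α precisely because α > 1/2: the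
-- integrand is of order (q - r)^(2α-2).
theorem rightFracExists_fracIntegral {a b α M : ℝ} (hα : 1 / 2 < α) (hα1 : α < 1) {Ψ : ℝ → E}
    (hΨ : AEStronglyMeasurable Ψ (volume.restrict (Ioo a b))) (hM : ∀ ρ ∈ Ioo a b, ‖Ψ ρ‖ ≤ M)
    {r : ℝ} (hr : r ∈ Ioo a b) :
    RightFracExists (1 - α) b (fun r => ∫ ρ in r..b, (ρ - r) ^ (α - 1) • Ψ ρ) r := by
  refine intervalIntegrable_of_bound hr.2.le (g := fun q => 2 * M / α * (q - r) ^ (2 * α - 2))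
    ((intervalIntegrable_sub_rpow (by linarith) r b r).const_mul _)
    ((measurable_sub_rpow _ _).aestronglyMeasurable.smul
      (aestronglyMeasurable_const.sub (aesm_Ioo_mono
        (fracIntegral_aesm (hr.1.trans hr.2).le (by linarith) hΨ hM) hr.1.le le_rfl)))
    fun q hq => ?_
  have h1 : 0 < q - r := sub_pos.2 hq.1
  have := Real.rpow_nonneg h1.le (-(1 + (1 - α)))
  rw [norm_smul, Real.norm_of_nonneg this, show 2 * α - 2 = -(1 + (1 - α)) + α by ring,
    Real.rpow_add h1]
  calc _ ≤ (q - r) ^ (-(1 + (1 - α))) * (2 * M / α * (q - r) ^ α) := by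
        gcongr
        exact fracIntegral_holder (by linarith) hα1 hΨ hM hr.1.le hq.1 hq.2
    _ = _ := by ring

/-- `D_{b-}^{1-α} I_{b-}^α = I_{b-}^{2α-1}` on bounded functions. -/
theorem rightFrac_fracIntegral {a b α M : ℝ} (hab : a < b) (hα : 1 / 2 < α) (hα1 : α < 1) {Ψ : ℝ → E}
    (hΨ : AEStronglyMeasurable Ψ (volume.restrict (Ioo a b))) (hM : ∀ ρ ∈ Ioo a b, ‖Ψ ρ‖ ≤ M) :
    ∀ᵐ r ∂(volume.restrict (Ioo a b)),
      rightFrac (1 - α) b (fun r => ∫ ρ in r..b, (ρ - r) ^ (α - 1) • Ψ ρ) r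
        = (Real.Gamma α / Real.Gamma (2 * α - 1)) •
          ∫ ρ in r..b, (ρ - r) ^ (2 * α - 1 - 1) • Ψ ρ := by
  set U : ℝ → E := fun r => ∫ ρ in r..b, (ρ - r) ^ (α - 1) • Ψ ρ with hU
  have hG : 0 < Real.Gamma α := Real.Gamma_pos_of_pos (by linarith)
  have hG2 : 0 < Real.Gamma (2 * α - 1) := Real.Gamma_pos_of_pos (by linarith)
  have hM0 : 0 ≤ M := (norm_nonneg _).trans (hM ((a + b) / 2) ⟨by linarith, by linarith⟩)
  have hUm : AEStronglyMeasurable U (volume.restrict (Ioo a b)) :=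
    fracIntegral_aesm hab.le (by linarith) hΨ hM
  obtain ⟨CU, hCU⟩ : ∃ CU, ∀ r ∈ Ioo a b, ‖U r‖ ≤ CU :=
    ⟨_, fun r hr => fracIntegral_bound (by linarith) hM hr⟩
  have triU : ∀ z, a ≤ z → IntegrableOn
      (fun p : ℝ × ℝ => (p.2 - p.1) ^ (-(1 + (1 - α))) • (U p.2 - U p.1)) (tri z b) := by
    intro z hz
    have hUz := aesm_Ioo_mono hUm hz le_rfl
    refine tri_integrable_pow (f := fun r q => (q - r) ^ (-(1 + (1 - α))) • (U q - U r))
      (p := 0) (s := 2 * α - 2) (C := 2 * M / α) (by norm_num) (by linarith)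
      ((measurable_tri_rpow _).aestronglyMeasurable.smul
        ((aesm_tri_snd hUz).sub (aesm_tri_fst hUz))) ?_
    intro r q hr hrq hq
    have h1 : 0 < q - r := sub_pos.2 hrq
    have := Real.rpow_nonneg h1.le (-(1 + (1 - α)))
    rw [norm_smul, Real.norm_of_nonneg this, show 2 * α - 2 = -(1 + (1 - α)) + α by ring,
      Real.rpow_add h1, Real.rpow_zero, norm_sub_rev]
    calc _ ≤ (q - r) ^ (-(1 + (1 - α))) * (2 * M / α * (q - r) ^ α) := by
          gcongr
          exact fracIntegral_holder (by linarith) hα1 hΨ hM (hz.trans hr.le) hrq hq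
      _ = _ := by ring
  have triV := fun z (hz : a ≤ z) => tri_integrable_fracIntegral (s := 2 * α - 1 - 1) (by linarith)
    (aesm_Ioo_mono hΨ hz le_rfl) fun ρ hρ => hM ρ ⟨hz.trans_lt hρ.1, hρ.2⟩
  have iU : ∀ z, a ≤ z → z ≤ b → IntervalIntegrable (fun r => (b - r) ^ (-(1 - α)) • U r) volume z b := by
    intro z hz hzb
    refine intervalIntegrable_of_bound hzb (g := fun r => (b - r) ^ (-(1 - α)) * CU)
      ((intervalIntegrable_rsub_rpow (by linarith) z b b).mul_const CU)
      ((measurable_rsub_rpow _ _).aestronglyMeasurable.smul (aesm_Ioo_mono hUm hz le_rfl))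
      fun r hr => ?_
    have := Real.rpow_nonneg (sub_nonneg.2 hr.2.le) (-(1 - α))
    rw [norm_smul, Real.norm_of_nonneg this]
    gcongr
    exact hCU r ⟨hz.trans_lt hr.1, hr.2⟩
  have iD : ∀ z, a ≤ z → z ≤ b → IntervalIntegrable
      (fun r => (1 - α) • ∫ q in r..b, (q - r) ^ (-(1 + (1 - α))) • (U r - U q)) volume z b := by
    intro z hz hzb
    have h1 := (tri_fubini hzb (f := fun r q => (q - r) ^ (-(1 + (1 - α))) • (U q - U r))
      (triU z hz)).1.smul (1 - α)
    refine h1.neg.congr_Ioo hzb fun r _ => ?_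
    rw [integral_smul_sub_comm (fun q => (q - r) ^ (-(1 + (1 - α))))]
    simp only [Pi.smul_apply, Pi.neg_apply, smul_neg]
  have iV : ∀ z, a ≤ z → z ≤ b → IntervalIntegrable (fun r => (Real.Gamma α * Real.Gamma α
      / Real.Gamma (2 * α - 1)) • ∫ ρ in r..b, (ρ - r) ^ (2 * α - 1 - 1) • Ψ ρ) volume z b :=
    fun z hz hzb => (tri_fubini hzb (f := fun r ρ => (ρ - r) ^ (2 * α - 1 - 1) • Ψ ρ)
      (triV z hz)).1.smul _
  -- It suffices to compare the integrals over all `(z, b)`. On the left `integral_marchaud` leaves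
  -- ∫ (r - z)^(α-1) U(r) dr. After an exchange of order both sides are multiples of ∫ (ρ -
  -- z)^(2α-1) Ψ(ρ) dρ.
  have key : ∀ z ∈ Ioo a b, ∫ r in z..b, (((b - r) ^ (-(1 - α)) • U r
      + (1 - α) • ∫ q in r..b, (q - r) ^ (-(1 + (1 - α))) • (U r - U q))
      - (Real.Gamma α * Real.Gamma α / Real.Gamma (2 * α - 1)) •
          ∫ ρ in r..b, (ρ - r) ^ (2 * α - 1 - 1) • Ψ ρ) = 0 := by
    intro z hz
    have hza := hz.1.le
    have hzb := hz.2
    rw [intervalIntegral.integral_sub ((iU z hza hzb.le).add (iD z hza hzb.le)) (iV z hza hzb.le),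
      intervalIntegral.integral_add (iU z hza hzb.le) (iD z hza hzb.le)]
    have hUz := aesm_Ioo_mono hUm hza le_rfl
    have hΨz := aesm_Ioo_mono hΨ hza le_rfl
    have hMz : ∀ ρ ∈ Ioo z b, ‖Ψ ρ‖ ≤ M := fun ρ hρ => hM ρ ⟨hz.1.trans hρ.1, hρ.2⟩
    have hCUz : ∀ ρ ∈ Ioo z b, ‖U ρ‖ ≤ CU := fun ρ hρ => hCU ρ ⟨hz.1.trans hρ.1, hρ.2⟩
    have f1 := tri_fubini hzb.le (f := fun r q => (q - r) ^ (-(1 + (1 - α))) • (U q - U r))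
      (triU z hza)
    have m := integral_marchaud hzb (by linarith : 0 < 1 - α) (by linarith) hUz hCUz (triU z hza)
    have e1 : ∫ r in z..b, (1 - α) • ∫ q in r..b, (q - r) ^ (-(1 + (1 - α))) • (U r - U q)
        = -∫ r in z..b, ((b - r) ^ (-(1 - α)) - (r - z) ^ (-(1 - α))) • U r := by
      rw [← m, ← f1.2.2, intervalIntegral.integral_smul, ← smul_neg, ← intervalIntegral.integral_neg]
      congr 1
      refine intervalIntegral.integral_congr fun r _ => ?_
      exact integral_smul_sub_comm (fun q => (q - r) ^ (-(1 + (1 - α)))) U r b r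
    have i2 : IntervalIntegrable (fun r => (r - z) ^ (-(1 - α)) • U r) volume z b :=
      intervalIntegrable_rpow_smul (by linarith) hUz hCUz le_rfl le_rfl hzb.le le_rfl
    have e2 : (∫ r in z..b, (b - r) ^ (-(1 - α)) • U r)
        + -∫ r in z..b, ((b - r) ^ (-(1 - α)) - (r - z) ^ (-(1 - α))) • U r
        = ∫ r in z..b, (r - z) ^ (-(1 - α)) • U r := by
      simp_rw [sub_smul]
      rw [intervalIntegral.integral_sub (iU z hza hzb.le) i2]
      abel
    rw [e1, e2]
    have triB : IntegrableOn (fun p : ℝ × ℝ =>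
        ((p.1 - z) ^ (α - 1) * (p.2 - p.1) ^ (α - 1)) • Ψ p.2) (tri z b) := by
      refine tri_integrable_pow (f := fun r ρ => ((r - z) ^ (α - 1) * (ρ - r) ^ (α - 1)) • Ψ ρ)
        (p := α - 1) (s := α - 1) (C := M) (by linarith) (by linarith)
        (AEStronglyMeasurable.smul (Measurable.aestronglyMeasurable (by fun_prop))
          (aesm_tri_snd hΨz)) ?_
      intro r ρ hr hrρ hρ
      have h1 := Real.rpow_nonneg (sub_nonneg.2 hr.le) (α - 1)
      have h2 := Real.rpow_nonneg (sub_nonneg.2 hrρ.le) (α - 1)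
      rw [norm_smul, Real.norm_of_nonneg (by positivity)]
      calc _ ≤ (r - z) ^ (α - 1) * (ρ - r) ^ (α - 1) * M := by
            gcongr
            exact hMz ρ ⟨hr.trans hrρ, hρ⟩
        _ = _ := by ring
    have f2 := (tri_fubini hzb.le (f := fun r ρ => ((r - z) ^ (α - 1) * (ρ - r) ^ (α - 1)) • Ψ ρ)
      triB).2.2
    have f3 := (tri_fubini hzb.le (f := fun r ρ => (ρ - r) ^ (2 * α - 1 - 1) • Ψ ρ)
      (triV z hza)).2.2
    have e3 : ∫ r in z..b, (r - z) ^ (-(1 - α)) • U r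
        = ∫ r in z..b, ∫ ρ in r..b, ((r - z) ^ (α - 1) * (ρ - r) ^ (α - 1)) • Ψ ρ := by
      refine intervalIntegral.integral_congr fun r _ => ?_
      simp only [hU]
      rw [← intervalIntegral.integral_smul, neg_sub]
      simp only [smul_smul]
    -- The beta integral contributes Γ(α)² / Γ(2α), integrating (ρ - r)^(2α-2) contributes 1 /
    -- (2α-1), and the functional equation reconciles them.
    have hGm : Real.Gamma (2 * α) = (2 * α - 1) * Real.Gamma (2 * α - 1) := by
      rw [← Real.Gamma_add_one (by linarith), sub_add_cancel]
    rw [e3, f2, intervalIntegral.integral_smul, f3, ← intervalIntegral.integral_smul, sub_eq_zero]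
    refine integral_congr_Ioo hzb.le fun ρ hρ => ?_
    simp only [intervalIntegral.integral_smul_const]
    rw [integral_rsub_rpow (by linarith), smul_smul]
    congr 1
    have hb := integral_beta (by linarith : 0 < α) (by linarith : 0 < α) hρ.1
    rw [← two_mul, hGm] at hb
    have h3 : 2 * α - 1 ≠ 0 := by linarith
    rw [sub_add_cancel]
    calc _ = ∫ y in z..ρ, (ρ - y) ^ (α - 1) * (y - z) ^ (α - 1) := by
          refine intervalIntegral.integral_congr fun y _ => ?_
          ring
      _ = _ := by
          rw [hb]
          field_simp
  filter_upwards [ae_eq_zero_of_primitive_right hab.le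
    (((iU a le_rfl hab.le).add (iD a le_rfl hab.le)).sub (iV a le_rfl hab.le)) key] with r hr
  have hr' := sub_eq_zero.1 hr
  rw [rightFrac, sub_sub_cancel, hr', smul_smul]
  congr 1
  field_simp

end FractionalIntegral

/-! ### The derivative of a second order tensor as a fractional integral -/

section SecondOrder

variable {X Y Z W P : Type*} [NormedAddCommGroup X] [NormedSpace ℝ X] [CompleteSpace X]
  [NormedAddCommGroup Y] [NormedSpace ℝ Y] [CompleteSpace Y]
  [NormedAddCommGroup Z] [NormedSpace ℝ Z] [CompleteSpace Z]
  [NormedAddCommGroup W] [NormedSpace ℝ W] [CompleteSpace W]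
  [NormedAddCommGroup P] [NormedSpace ℝ P] [CompleteSpace P]
  {α γ a b : ℝ}

/-- Fractional integration by parts `∫ D^α y · D^{1-α} g = -∫ y dg`. -/
theorem WHolder.integral_leftFrac_rightFrac (hab : a < b) {y : ℝ → X} (hy : WHolder γ a b y)
    (hγ1 : γ < 1) (hα0 : 0 < α) (hαγ : α < γ) (B : X →L[ℝ] Z →L[ℝ] W) {k g : ℝ → Z} {M : ℝ}
    (hM0 : 0 ≤ M)
    (hk : AEStronglyMeasurable k (volume.restrict (Ioo a b))) (hM : ∀ τ ∈ Ioo a b, ‖k τ‖ ≤ M)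
    (hg : ∀ q r, a < q → q ≤ r → r ≤ b → g r - g q = ∫ τ in q..r, k τ) :
    IntervalIntegrable (fun r => B (leftFrac α a y r)
      (rightFrac (1 - α) b (fun ρ => g ρ - g b) r)) volume a b ∧
    ∫ r in a..b, B (leftFrac α a y r) (rightFrac (1 - α) b (fun ρ => g ρ - g b) r)
      = -∫ r in a..b, B (y r) (k r) := by
  have hG : Real.Gamma α ≠ 0 := (Real.Gamma_pos_of_pos hα0).ne'
  have h := hy.pairing hab hγ1 hα0 hαγ B (γ' := 0) le_rfl one_pos hk hM0
    (by simpa using hM)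
  have e : ∀ r ∈ Ioo a b, (-(Real.Gamma α)⁻¹) •
      B (leftFrac α a y r) (∫ τ in r..b, (τ - r) ^ (α - 1) • k τ)
      = B (leftFrac α a y r) (rightFrac (1 - α) b (fun ρ => g ρ - g b) r) := by
    intro r hr
    rw [(rightFrac_of_primitive (by linarith) (by linarith) hk hM hg hr).2, sub_sub_cancel, neg_sub,
      ← neg_smul, map_smul]
  refine ⟨(h.1.smul (-(Real.Gamma α)⁻¹)).congr_Ioo hab.le e, ?_⟩
  rw [← integral_congr_Ioo hab.le e, intervalIntegral.integral_smul, h.2, smul_smul, neg_mul,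
    inv_mul_cancel₀ hG, neg_one_smul]

omit [CompleteSpace Y] in
-- The derivative at r sees only values on `[r, b)`. This matters because the formula for 𝓓^{1-α} v
-- is proved at interior points and not at b.
theorem rightFrac_congr_smul {κ c r : ℝ} {w U : ℝ → Y} (hr : r < b)
    (h : ∀ q, r ≤ q → q < b → w q = c • U q) : rightFrac κ b w r = c • rightFrac κ b U r := by
  have e : ∫ q in r..b, (q - r) ^ (-(1 + κ)) • (w r - w q)
      = c • ∫ q in r..b, (q - r) ^ (-(1 + κ)) • (U r - U q) := by
    rw [← intervalIntegral.integral_smul]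
    refine integral_congr_Ioo hr.le fun q hq => ?_
    rw [h r le_rfl hr, h q hq.1.le hq.2, ← smul_sub, smul_comm]
  rw [rightFrac, rightFrac, e, h r le_rfl hr]
  module

omit [CompleteSpace Y] in
theorem rightFracExists_congr_smul {κ c r : ℝ} {w U : ℝ → Y} (hr : r < b)
    (h : ∀ q, r ≤ q → q < b → w q = c • U q) (hU : RightFracExists κ b U r) :
    RightFracExists κ b w r := by
  refine (IntervalIntegrable.smul hU c).congr_Ioo hr.le fun q hq => ?_
  simp only [Pi.smul_apply]
  rw [h r le_rfl hr, h q hq.1.le hq.2, ← smul_sub, smul_comm]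

/-- The density `r ↦ ∫_r^b (q - r)^{-1-α} m(y(q) - y(r), J(q)) dq`. -/
def secondDensity (α b : ℝ) (m : X →L[ℝ] Z →L[ℝ] Y) (y : ℝ → X) (J : ℝ → Z) (r : ℝ) : Y :=
  ∫ q in r..b, (q - r) ^ (-(1 + α)) • m (y q - y r) (J q)

section Density

variable (m : X →L[ℝ] Z →L[ℝ] Y) {y : ℝ → X} {J : ℝ → Z} {CJ : ℝ}

omit [CompleteSpace X] [CompleteSpace Y] [CompleteSpace Z] in
theorem norm_density_le {K q r : ℝ} (hJ : ‖J q‖ ≤ CJ) (hrq : r < q)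
    (hK : ‖y q - y r‖ ≤ K * (r - a) ^ (-γ) * (q - r) ^ γ) :
    ‖(q - r) ^ (-(1 + α)) • m (y q - y r) (J q)‖
      ≤ ‖m‖ * CJ * K * (r - a) ^ (-γ) * (q - r) ^ (γ - 1 - α) := by
  refine norm_smul_diff_le (κ := α) (γ := γ) hrq ((m.le_opNorm₂ _ _).trans ?_)
  calc ‖m‖ * ‖y q - y r‖ * ‖J q‖ ≤ ‖m‖ * (K * (r - a) ^ (-γ) * (q - r) ^ γ) * CJ := by
        have := (norm_nonneg _).trans hK
        gcongr
    _ = _ := by ring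

theorem tri_integrable_density (hy : WHolder γ a b y) (hγ1 : γ < 1) (hαγ : α < γ)
    (hJm : AEStronglyMeasurable J (volume.restrict (Ioo a b)))
    (hJ : ∀ q ∈ Ioo a b, ‖J q‖ ≤ CJ) :
    IntegrableOn (fun p : ℝ × ℝ => (p.2 - p.1) ^ (-(1 + α)) • m (y p.2 - y p.1) (J p.2))
      (tri a b) := by
  obtain ⟨K, hK0, hK⟩ := hy.hol
  exact tri_integrable_pow (f := fun r q => (q - r) ^ (-(1 + α)) • m (y q - y r) (J q))
    (p := -γ) (s := γ - 1 - α) (C := ‖m‖ * CJ * K) (by linarith) (by linarith)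
    ((measurable_tri_rpow _).aestronglyMeasurable.smul (m.aestronglyMeasurable_comp₂
      ((aesm_tri_snd hy.aesm).sub (aesm_tri_fst hy.aesm)) (aesm_tri_snd hJm)))
    fun r q hr hrq hq => norm_density_le m (hJ q ⟨hr.trans hrq, hq⟩) hrq (hK r q hr hrq hq)

theorem intervalIntegrable_density (hy : WHolder γ a b y) (hαγ : α < γ)
    (hJm : AEStronglyMeasurable J (volume.restrict (Ioo a b)))
    (hJ : ∀ q ∈ Ioo a b, ‖J q‖ ≤ CJ) {r : ℝ} (hr : r ∈ Ioo a b) :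
    IntervalIntegrable (fun q => (q - r) ^ (-(1 + α)) • m (y q - y r) (J q)) volume r b := by
  obtain ⟨K, hK0, hK⟩ := hy.hol
  exact intervalIntegrable_of_bound hr.2.le
    (g := fun q => ‖m‖ * CJ * K * (r - a) ^ (-γ) * (q - r) ^ (γ - 1 - α))
    ((intervalIntegrable_sub_rpow (by linarith) r b r).const_mul _)
    ((measurable_sub_rpow _ _).aestronglyMeasurable.smul (m.aestronglyMeasurable_comp₂
      ((aesm_Ioo_mono hy.aesm hr.1.le le_rfl).sub aestronglyMeasurable_const)
      (aesm_Ioo_mono hJm hr.1.le le_rfl)))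
    fun q hq => norm_density_le m (hJ q ⟨hr.1.trans hq.1, hq.2⟩) hq.1 (hK r q hr.1 hq.1 hq.2)

theorem secondDensity_aesm (hab : a ≤ b) (hy : WHolder γ a b y) (hγ1 : γ < 1) (hαγ : α < γ)
    (hJm : AEStronglyMeasurable J (volume.restrict (Ioo a b)))
    (hJ : ∀ q ∈ Ioo a b, ‖J q‖ ≤ CJ) :
    AEStronglyMeasurable (secondDensity α b m y J) (volume.restrict (Ioo a b)) :=
  (tri_fubini hab (f := fun r q => (q - r) ^ (-(1 + α)) • m (y q - y r) (J q))
    (tri_integrable_density m hy hγ1 hαγ hJm hJ)).1.aesm_Ioo hab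

/-- Integrating (q - r)^(γ-1-α) is harmless since α < γ, but the weight of the Hölder constant
stays. The resulting bound is integrable up to a when γ < 1, yet gives boundedness only on
subintervals away from a. -/
theorem secondDensity_bound (hy : WHolder γ a b y) (hαγ : α < γ) (hCJ : 0 ≤ CJ)
    (hJ : ∀ q ∈ Ioo a b, ‖J q‖ ≤ CJ) :
    ∃ C, 0 ≤ C ∧ ∀ r ∈ Ioo a b, ‖secondDensity α b m y J r‖ ≤ C * (r - a) ^ (-γ) := by
  obtain ⟨K, hK0, hK⟩ := hy.hol
  refine ⟨‖m‖ * CJ * K * (|b - a| ^ (γ - α) / (γ - α)), ?_, fun r hr => ?_⟩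
  · have : 0 < γ - α := by linarith
    positivity
  · have h2 := Real.rpow_nonneg (sub_nonneg.2 hr.1.le) (-γ)
    have e : ∫ q in Ioo r b, ‖m‖ * CJ * K * (r - a) ^ (-γ) * (q - r) ^ (γ - 1 - α)
        ≤ ‖m‖ * CJ * K * (|b - a| ^ (γ - α) / (γ - α)) * (r - a) ^ (-γ) := by
      rw [setIntegral_Ioo_eq hr.2.le, intervalIntegral.integral_const_mul,
        integral_sub_rpow (by linarith), show γ - 1 - α + 1 = γ - α by ring]
      have : (b - r) ^ (γ - α) ≤ |b - a| ^ (γ - α) :=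
        Real.rpow_le_rpow (by linarith [hr.2]) ((by linarith [hr.1] : b - r ≤ b - a).trans
          (le_abs_self _)) (by linarith)
      have h3 : 0 < γ - α := by linarith
      calc _ ≤ ‖m‖ * CJ * K * (r - a) ^ (-γ) * (|b - a| ^ (γ - α) / (γ - α)) := by gcongr
        _ = _ := by ring
    refine le_trans ?_ e
    rw [secondDensity, ← setIntegral_Ioo_eq hr.2.le]
    refine norm_integral_le_of_norm_le
      ((integrableOn_sub_rpow (by linarith) r b r).const_mul _) ?_
    filter_upwards [ae_restrict_mem measurableSet_Ioo] with q hq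
    exact norm_density_le m (hJ q ⟨hr.1.trans hq.1, hq.2⟩) hq.1 (hK r q hr.1 hq.1 hq.2)

end Density

omit [CompleteSpace X] in
theorem norm_weighted_smul_le {r ρ q C : ℝ} (hρ : r < ρ) (hρq : ρ < q) {v : X}
    (hv : ‖v‖ ≤ C * (q - ρ) ^ γ) :
    ‖((ρ - r) ^ (α - 1) * (q - ρ) ^ (-(1 + α))) • v‖
      ≤ C * (ρ - r) ^ (α - 1) * (q - ρ) ^ (γ - 1 - α) := by
  have h1 : 0 < q - ρ := sub_pos.2 hρq
  have h2 := Real.rpow_nonneg (sub_nonneg.2 hρ.le) (α - 1)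
  have h3 := Real.rpow_nonneg h1.le (-(1 + α))
  rw [norm_smul, Real.norm_of_nonneg (by positivity), show γ - 1 - α = -(1 + α) + γ by ring,
    Real.rpow_add h1]
  calc _ ≤ (ρ - r) ^ (α - 1) * (q - ρ) ^ (-(1 + α)) * (C * (q - ρ) ^ γ) := by gcongr
    _ = _ := by ring

/-- The Weyl derivative of the first order tensor is a fractional integral of `secondDensity`. -/
theorem integral_kernel_eq_fracIntegral (m : X →L[ℝ] Z →L[ℝ] Y) {y : ℝ → X} (hy : WHolder γ a b y)
    (hγ1 : γ < 1) (hα : 1 / 2 < α) (hαγ : α < γ) {k : ℝ → Z} {M : ℝ}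
    (hk : AEStronglyMeasurable k (volume.restrict (Ioo a b))) (hM : ∀ τ ∈ Ioo a b, ‖k τ‖ ≤ M)
    {r : ℝ} (hr : r ∈ Ioo a b) :
    ∫ τ in r..b, (τ - r) ^ (α - 1) • m (y τ - y r) (k τ)
      = (α / (Real.Gamma α * Real.Gamma (1 - α))) • ∫ ρ in r..b, (ρ - r) ^ (α - 1) •
        secondDensity α b m y (fun q => ∫ τ in q..b, (τ - q) ^ (α - 1) • k τ) ρ := by
  set J : ℝ → Z := fun q => ∫ τ in q..b, (τ - q) ^ (α - 1) • k τ with hJdef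
  obtain ⟨K, hK0, hK⟩ := hy.hol
  obtain ⟨My, hMy0, hMy⟩ := hy.bdd
  have hrb := hr.2
  have hα1 : α < 1 := hαγ.trans hγ1
  have hra : 0 < r - a := sub_pos.2 hr.1
  have hym := aesm_Ioo_mono hy.aesm hr.1.le le_rfl
  have hkm := aesm_Ioo_mono hk hr.1.le le_rfl
  have hkM : ∀ τ ∈ Ioo r b, ‖k τ‖ ≤ M := fun τ hτ => hM τ ⟨hr.1.trans hτ.1, hτ.2⟩
  -- Right of the fixed point r > a the weight is at most (r - a)^(-γ), so `y` is Hölder on `[r, b)`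
  -- without weight.
  obtain ⟨K', hK0', hK'⟩ : ∃ K', 0 ≤ K' ∧ ∀ q z, r ≤ q → q < z → z < b →
      ‖y z - y q‖ ≤ K' * (z - q) ^ γ := by
    refine ⟨K * (r - a) ^ (-γ), by positivity, fun q z hq hqz hz => ?_⟩
    refine (hK q z (hr.1.trans_le hq) hqz hz).trans ?_
    have := Real.rpow_nonneg (sub_nonneg.2 hqz.le) γ
    have : (q - a) ^ (-γ) ≤ (r - a) ^ (-γ) :=
      Real.rpow_le_rpow_of_nonpos hra (by linarith) (by linarith)
    gcongr
  have hJm : AEStronglyMeasurable J (volume.restrict (Ioo r b)) :=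
    fracIntegral_aesm hrb.le (by linarith) hkm hkM
  obtain ⟨CJ, hCJ0, hCJ⟩ : ∃ CJ, 0 ≤ CJ ∧ ∀ q ∈ Ioo r b, ‖J q‖ ≤ CJ :=
    ⟨_, (norm_nonneg _).trans (fracIntegral_bound (by linarith) hkM (r := (r + b) / 2)
      ⟨by linarith, by linarith⟩), fun q hq => fracIntegral_bound (by linarith) hkM hq⟩
  -- the solution of Abel's equation
  set R : ℝ → X := fun q =>
    α • ∫ ρ in r..q, ((ρ - r) ^ (α - 1) * (q - ρ) ^ (-(1 + α))) • (y q - y ρ) with hR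
  have triR : IntegrableOn (fun p : ℝ × ℝ =>
      ((p.1 - r) ^ (α - 1) * (p.2 - p.1) ^ (-(1 + α))) • (y p.2 - y p.1)) (tri r b) :=
    tri_integrable_pow
      (f := fun ρ q => ((ρ - r) ^ (α - 1) * (q - ρ) ^ (-(1 + α))) • (y q - y ρ))
      (p := α - 1) (s := γ - 1 - α) (C := K') (by linarith) (by linarith)
      (AEStronglyMeasurable.smul (Measurable.aestronglyMeasurable (by fun_prop))
        ((aesm_tri_snd hym).sub (aesm_tri_fst hym)))
      fun ρ q hρ hρq hq => norm_weighted_smul_le hρ hρq (hK' ρ q hρ.le hρq hq)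
  have hRi : IntegrableOn R (Ioo r b) :=
    (intervalIntegrable_iff_Ioo hrb.le).1 ((tri_fubini hrb.le
      (f := fun ρ q => ((ρ - r) ^ (α - 1) * (q - ρ) ^ (-(1 + α))) • (y q - y ρ)) triR).2.1.smul α)
  have iR : ∀ q ∈ Ioo r b, IntervalIntegrable
      (fun ρ => ((ρ - r) ^ (α - 1) * (q - ρ) ^ (-(1 + α))) • (y q - y ρ)) volume r q := by
    intro q hq
    refine intervalIntegrable_of_bound hq.1.le
      (g := fun ρ => K' * ((q - ρ) ^ (γ - 1 - α) * (ρ - r) ^ (α - 1)))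
      (((intervalIntegrable_iff_Ioo hq.1.le).2 (integrableOn_beta (by linarith) (by linarith)
        (by linarith) (by linarith) r q)).const_mul K')
      (AEStronglyMeasurable.smul (Measurable.aestronglyMeasurable (by fun_prop))
        (aestronglyMeasurable_const.sub (aesm_Ioo_mono hym le_rfl hq.2.le))) fun ρ hρ => ?_
    refine (norm_weighted_smul_le hρ.1 hρ.2 (hK' ρ q hρ.1.le hρ.2 hq.2)).trans_eq (by ring)
  -- A beta integral again: the exponents γ - 1 - α and α - 1 leave γ - 1, an integrable singularity
  -- at r.
  have hRb : ∃ C, ∀ q ∈ Ioo r b, ‖R q‖ ≤ C * (q - r) ^ (γ - 1) := by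
    refine ⟨α * (K' * (Real.Gamma (γ - α) * Real.Gamma α / Real.Gamma γ)), fun q hq => ?_⟩
    have hb := integral_beta (by linarith : 0 < γ - α) (by linarith : 0 < α) hq.1
    rw [sub_add_cancel] at hb
    rw [hR]
    simp only
    rw [norm_smul, Real.norm_of_nonneg (by linarith), mul_assoc, mul_assoc K', ← hb,
      ← intervalIntegral.integral_const_mul, ← setIntegral_Ioo_eq hq.1.le,
      ← setIntegral_Ioo_eq hq.1.le]
    refine mul_le_mul_of_nonneg_left ?_ (by linarith)
    refine norm_integral_le_of_norm_le ((integrableOn_beta (by linarith) (by linarith)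
        (by linarith) (by linarith) r q).const_mul K') ?_
    filter_upwards [ae_restrict_mem measurableSet_Ioo] with ρ hρ
    refine (norm_weighted_smul_le hρ.1 hρ.2 (hK' ρ q hρ.1.le hρ.2 hq.2)).trans_eq ?_
    rw [sub_right_comm]
    ring
  obtain ⟨CR, hCR⟩ := hRb
  have hPi : IntegrableOn (fun τ => (τ - r) ^ (α - 1) • (y τ - y r)) (Ioo r b) :=
    (intervalIntegrable_iff_Ioo hrb.le).1 (intervalIntegrable_rpow_smul (by linarith)
      (M := My + My) (hym.sub aestronglyMeasurable_const) (fun ρ hρ => (norm_sub_le _ _).trans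
        (add_le_add (hMy ρ ⟨hr.1.trans hρ.1, hρ.2⟩) (hMy r hr))) le_rfl le_rfl hrb.le le_rfl)
  -- Subtracting `y r` does not change increments but makes the path vanish like (τ - r)^γ at r, as
  -- `integral_marchaud_weighted` requires; α + γ > 1 because both exceed 1/2.
  have hP : ∀ x ∈ Ioo r b, ∫ τ in r..x, (x - τ) ^ (-α) • (τ - r) ^ (α - 1) • (y τ - y r)
      = ∫ τ in r..x, R τ := by
    intro x hx
    have h := integral_marchaud_weighted hx.1 (by linarith : 0 < α) hα1 (by linarith : 1 < α + γ)
      (y := fun τ => y τ - y r) (C := K')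
      ((aesm_Ioo_mono hym le_rfl hx.2.le).sub aestronglyMeasurable_const)
      (fun z hz => hK' r z le_rfl hz.1 (hz.2.trans hx.2)) (by
        simp only [sub_sub_sub_cancel_right]
        exact triR.mono_set fun p hp => ⟨hp.1, hp.2.1, hp.2.2.trans hx.2⟩)
    simp only [sub_sub_sub_cancel_right] at h
    rw [hR, intervalIntegral.integral_smul, h]
    refine intervalIntegral.integral_congr fun τ _ => ?_
    simp only [smul_smul, mul_comm]
  have hBk : IntegrableOn (fun p : ℝ × ℝ => (p.2 - p.1) ^ (α - 1) • m (R p.1) (k p.2)) (tri r b) := by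
    refine tri_integrable_pow (f := fun q τ => (τ - q) ^ (α - 1) • m (R q) (k τ))
      (p := γ - 1) (s := α - 1) (C := ‖m‖ * CR * M) (by linarith) (by linarith)
      ((measurable_tri_rpow _).aestronglyMeasurable.smul (m.aestronglyMeasurable_comp₂
        (aesm_tri_fst hRi.aestronglyMeasurable) (aesm_tri_snd hkm))) ?_
    intro q τ hq hqτ hτ
    have h1 := Real.rpow_nonneg (sub_nonneg.2 hqτ.le) (α - 1)
    have h2 := hCR q ⟨hq, hqτ.trans hτ⟩
    have h3 := hkM τ ⟨hq.trans hqτ, hτ⟩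
    rw [norm_smul, Real.norm_of_nonneg h1]
    calc _ ≤ (τ - q) ^ (α - 1) * (‖m‖ * (CR * (q - r) ^ (γ - 1)) * M) := by
          refine mul_le_mul_of_nonneg_left ((m.le_opNorm₂ _ _).trans ?_) h1
          have := (norm_nonneg _).trans h2
          gcongr
      _ = _ := by ring
  have key := (abel_pairing hrb (by linarith : 0 < α) hα1 hPi hRi hP m
    (fun q hq => intervalIntegrable_rpow_smul (by linarith) hkm hkM le_rfl hq.1.le hq.2.le le_rfl)
    hBk).2
  have triF : IntegrableOn (fun p : ℝ × ℝ =>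
      ((p.1 - r) ^ (α - 1) * (p.2 - p.1) ^ (-(1 + α))) • m (y p.2 - y p.1) (J p.2)) (tri r b) := by
    refine tri_integrable_pow
      (f := fun ρ q => ((ρ - r) ^ (α - 1) * (q - ρ) ^ (-(1 + α))) • m (y q - y ρ) (J q))
      (p := α - 1) (s := γ - 1 - α) (C := ‖m‖ * K' * CJ) (by linarith) (by linarith)
      (AEStronglyMeasurable.smul (Measurable.aestronglyMeasurable (by fun_prop))
        (m.aestronglyMeasurable_comp₂ ((aesm_tri_snd hym).sub (aesm_tri_fst hym))
          (aesm_tri_snd hJm))) ?_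
    intro ρ q hρ hρq hq
    refine norm_weighted_smul_le (C := ‖m‖ * K' * CJ) hρ hρq ((m.le_opNorm₂ _ _).trans ?_)
    have h1 := hK' ρ q hρ.le hρq hq
    have h2 := hCJ q ⟨hρ.trans hρq, hq⟩
    calc _ ≤ ‖m‖ * (K' * (q - ρ) ^ γ) * CJ := by
          have := (norm_nonneg _).trans h1
          gcongr
      _ = _ := by ring
  -- Inserting the integral that defines `R` and integrating first in q for fixed ρ produces the
  -- density at ρ.
  have e1 : ∫ q in r..b, m (R q) (J q) = α • ∫ ρ in r..b, (ρ - r) ^ (α - 1) •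
      secondDensity α b m y J ρ := by
    have e2 : ∀ q ∈ Ioo r b, m (R q) (J q) = α • ∫ ρ in r..q,
        ((ρ - r) ^ (α - 1) * (q - ρ) ^ (-(1 + α))) • m (y q - y ρ) (J q) := by
      intro q hq
      have := ContinuousLinearMap.intervalIntegral_comp_comm (m.flip (J q)) (iR q hq)
      simp only [map_smul, ContinuousLinearMap.flip_apply] at this
      rw [this, hR]
      simp
    rw [integral_congr_Ioo hrb.le e2, intervalIntegral.integral_smul, ← (tri_fubini hrb.le
      (f := fun ρ q => ((ρ - r) ^ (α - 1) * (q - ρ) ^ (-(1 + α))) • m (y q - y ρ) (J q))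
      triF).2.2]
    congr 1
    refine intervalIntegral.integral_congr fun ρ _ => ?_
    simp only [mul_smul, intervalIntegral.integral_smul, secondDensity]
  rw [e1] at key
  have hG : Real.Gamma α * Real.Gamma (1 - α) ≠ 0 :=
    (mul_pos (Real.Gamma_pos_of_pos (by linarith)) (Real.Gamma_pos_of_pos (by linarith))).ne'
  rw [div_eq_inv_mul, mul_smul, key, smul_smul, inv_mul_cancel₀ hG, one_smul]
  refine intervalIntegral.integral_congr fun τ _ => ?_
  simp

end SecondOrder

/-! ### Integration by parts with second order tensors and compensated derivatives -/

section SecondOrderParts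

variable {X Y Z W P : Type*} [NormedAddCommGroup X] [NormedSpace ℝ X] [CompleteSpace X]
  [NormedAddCommGroup Y] [NormedSpace ℝ Y] [CompleteSpace Y]
  [NormedAddCommGroup Z] [NormedSpace ℝ Z] [CompleteSpace Z]
  [NormedAddCommGroup W] [NormedSpace ℝ W] [CompleteSpace W]
  [NormedAddCommGroup P] [NormedSpace ℝ P] [CompleteSpace P]
  {α γ a b : ℝ}

/-- An exhaustion by intervals that stay away from a, where the second density is bounded, so that
almost everywhere statements can be glued. The denominator `n + 2` keeps every left endpoint
strictly below b. -/
theorem Ioo_eq_iUnion (hab : a < b) : Ioo a b = ⋃ n : ℕ, Ioo (a + (b - a) / (n + 2)) b := by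
  ext r
  simp only [mem_iUnion]
  constructor
  · intro hr
    obtain ⟨n, hn⟩ := exists_nat_gt ((b - a) / (r - a))
    refine ⟨n, ?_, hr.2⟩
    have h1 : 0 < r - a := sub_pos.2 hr.1
    rw [div_lt_iff₀ h1] at hn
    have : (b - a) / (n + 2) < r - a := by
      rw [div_lt_iff₀ (by positivity)]
      nlinarith
    linarith
  · rintro ⟨n, hn⟩
    refine ⟨lt_of_le_of_lt ?_ hn.1, hn.2⟩
    have : 0 ≤ (b - a) / ((n : ℝ) + 2) := div_nonneg (by linarith) (by positivity)
    linarith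

/-- Fractional integration by parts against the second order tensor
`v(r, τ) = ∫_r^τ m(y(ρ) - y(r), k(ρ)) dρ`. -/
theorem WHolder.second_order_parts (hab : a < b) {y : ℝ → X} {φ : ℝ → P} (hy : WHolder γ a b y)
    (hφ : WHolder γ a b φ) (hγ1 : γ < 1) (hα : 1 / 2 < α) (hαγ : α < γ)
    (m : X →L[ℝ] Z →L[ℝ] Y) (n : P →L[ℝ] Y →L[ℝ] W) {k : ℝ → Z} {M : ℝ}
    (hk : AEStronglyMeasurable k (volume.restrict (Ioo a b))) (hM : ∀ τ ∈ Ioo a b, ‖k τ‖ ≤ M)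
    {v : ℝ → ℝ → Y}
    (hv : ∀ r τ, a < r → r < τ → τ ≤ b → v r τ = ∫ ρ in r..τ, m (y ρ - y r) (k ρ)) :
    (∀ r ∈ Ioo a b, RightFracTwoExists (1 - α) b v r ∧
      RightFracExists (1 - α) b (rightFracTwo (1 - α) b v) r) ∧
    IntervalIntegrable (fun r => n (leftFrac (2 * α - 1) a φ r)
      (rightFrac (1 - α) b (rightFracTwo (1 - α) b v) r)) volume a b ∧
    IntervalIntegrable (fun q => ∫ r in a..q, (q - r) ^ (-(1 + α)) •
      n (φ r) (m (y q - y r) (∫ τ in q..b, (τ - q) ^ (α - 1) • k τ))) volume a b ∧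
    ∫ r in a..b, n (leftFrac (2 * α - 1) a φ r)
        (rightFrac (1 - α) b (rightFracTwo (1 - α) b v) r)
      = (α / (Real.Gamma α * Real.Gamma (1 - α))) • ∫ q in a..b, ∫ r in a..q,
        (q - r) ^ (-(1 + α)) • n (φ r) (m (y q - y r) (∫ τ in q..b, (τ - q) ^ (α - 1) • k τ)) := by
  set J : ℝ → Z := fun q => ∫ τ in q..b, (τ - q) ^ (α - 1) • k τ with hJdef
  have hα1 : α < 1 := hαγ.trans hγ1
  have hGα : 0 < Real.Gamma α := Real.Gamma_pos_of_pos (by linarith)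
  have hGα' : 0 < Real.Gamma (1 - α) := Real.Gamma_pos_of_pos (by linarith)
  have hG2 : 0 < Real.Gamma (2 * α - 1) := Real.Gamma_pos_of_pos (by linarith)
  obtain ⟨K, hK0, hK⟩ := hy.hol
  obtain ⟨My, hMy0, hMy⟩ := hy.bdd
  obtain ⟨Mφ, hMφ0, hMφ⟩ := hφ.bdd
  have hM0 : 0 ≤ M := (norm_nonneg _).trans (hM ((a + b) / 2) ⟨by linarith, by linarith⟩)
  have hJm : AEStronglyMeasurable J (volume.restrict (Ioo a b)) :=
    fracIntegral_aesm hab.le (by linarith) hk hM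
  obtain ⟨CJ, hCJ0, hCJ⟩ : ∃ CJ, 0 ≤ CJ ∧ ∀ q ∈ Ioo a b, ‖J q‖ ≤ CJ :=
    ⟨_, (norm_nonneg _).trans (fracIntegral_bound (by linarith) hM (r := (a + b) / 2)
      ⟨by linarith, by linarith⟩), fun q hq => fracIntegral_bound (by linarith) hM hq⟩
  set Ψ : ℝ → Y := secondDensity α b m y J with hΨ
  have hΨm : AEStronglyMeasurable Ψ (volume.restrict (Ioo a b)) :=
    secondDensity_aesm m hab.le hy hγ1 hαγ hJm hCJ
  obtain ⟨CΨ, hCΨ0, hCΨ⟩ := secondDensity_bound m hy hαγ hCJ0 hCJ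
  have hΨx : ∀ x ∈ Ioo a b, ∀ ρ ∈ Ioo x b, ‖Ψ ρ‖ ≤ CΨ * (x - a) ^ (-γ) := by
    intro x hx ρ hρ
    refine (hCΨ ρ ⟨hx.1.trans hρ.1, hρ.2⟩).trans (mul_le_mul_of_nonneg_left ?_ hCΨ0)
    exact Real.rpow_le_rpow_of_nonpos (sub_pos.2 hx.1) (by linarith [hρ.1]) (by linarith)
  have hΨmx : ∀ x ∈ Ioo a b, AEStronglyMeasurable Ψ (volume.restrict (Ioo x b)) :=
    fun x hx => aesm_Ioo_mono hΨm hx.1.le le_rfl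
  set U : ℝ → Y := fun r => ∫ ρ in r..b, (ρ - r) ^ (α - 1) • Ψ ρ with hU
  set c : ℝ := (Real.Gamma α)⁻¹ * (α / (Real.Gamma α * Real.Gamma (1 - α))) with hc
  -- The constant `c` collects Γ(α)⁻¹ from the derivative and the factor from
  -- `integral_kernel_eq_fracIntegral`.
  have hw : ∀ r ∈ Ioo a b, RightFracTwoExists (1 - α) b v r ∧
      rightFracTwo (1 - α) b v r = c • U r := by
    intro r hr
    have h := rightFracTwo_of_primitive (κ := 1 - α) (M := ‖m‖ * (My + My) * M) (by linarith)
      (by linarith) hr.2 (l := fun ρ => m (y ρ - y r) (k ρ)) (v := v)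
      (m.aestronglyMeasurable_comp₂
        ((aesm_Ioo_mono hy.aesm hr.1.le le_rfl).sub aestronglyMeasurable_const)
        (aesm_Ioo_mono hk hr.1.le le_rfl)) (fun τ hτ => ?_)
        (fun τ hτ => hv r τ hr.1 hτ.1 hτ.2)
    · refine ⟨h.1, ?_⟩
      rw [h.2, sub_sub_cancel, neg_sub,
        integral_kernel_eq_fracIntegral m hy hγ1 hα hαγ hk hM hr, smul_smul]
    · have hτ' : τ ∈ Ioo a b := ⟨hr.1.trans hτ.1, hτ.2⟩
      refine (m.le_opNorm₂ _ _).trans ?_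
      have h1 := (norm_sub_le (y τ) (y r)).trans (add_le_add (hMy τ hτ') (hMy r hr))
      have h2 := hM τ hτ'
      gcongr
  have hwr : ∀ r ∈ Ioo a b, ∀ q, r ≤ q → q < b → rightFracTwo (1 - α) b v q = c • U q :=
    fun r hr q hrq hq => (hw q ⟨hr.1.trans_le hrq, hq⟩).2
  -- `rightFrac_fracIntegral` needs a bounded function, so it is applied on each interval of the
  -- exhaustion; right-sided operators do not notice the change of the left endpoint.
  have hae : ∀ᵐ r ∂(volume.restrict (Ioo a b)),
      rightFrac (1 - α) b (rightFracTwo (1 - α) b v) r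
        = (c * (Real.Gamma α / Real.Gamma (2 * α - 1))) •
          ∫ ρ in r..b, (ρ - r) ^ (2 * α - 1 - 1) • Ψ ρ := by
    have hae' : ∀ᵐ r ∂(volume.restrict (Ioo a b)), rightFrac (1 - α) b U r
        = (Real.Gamma α / Real.Gamma (2 * α - 1)) •
          ∫ ρ in r..b, (ρ - r) ^ (2 * α - 1 - 1) • Ψ ρ := by
      rw [Ioo_eq_iUnion hab, ae_restrict_iUnion_iff]
      intro i
      have hi : a + (b - a) / ((i : ℝ) + 2) ∈ Ioo a b := by
        have h1 : 0 < b - a := sub_pos.2 hab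
        have h2 : 0 < (b - a) / ((i : ℝ) + 2) := by positivity
        refine ⟨by linarith, ?_⟩
        have : (b - a) / ((i : ℝ) + 2) < b - a := div_lt_self h1 (by
          have : (0 : ℝ) ≤ i := Nat.cast_nonneg i
          linarith)
        linarith
      exact rightFrac_fracIntegral hi.2 hα hα1 (hΨmx _ hi) (hΨx _ hi)
    filter_upwards [hae', ae_restrict_mem measurableSet_Ioo] with r hr hrm
    rw [rightFrac_congr_smul hrm.2 (hwr r hrm), hr, smul_smul]
  -- The orders fit because 0 < 2α - 1 < α < γ, and the pairing tolerates the singularity (ρ -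
  -- a)^(-γ) of the density.
  have hpair := hφ.pairing hab hγ1 (κ := 2 * α - 1) (by linarith) (by linarith) n
    (γ' := γ) (by linarith) hγ1 hΨm hCΨ0 hCΨ
  have hcongr : (fun r => (c * (Real.Gamma α / Real.Gamma (2 * α - 1))) •
      n (leftFrac (2 * α - 1) a φ r) (∫ ρ in r..b, (ρ - r) ^ (2 * α - 1 - 1) • Ψ ρ))
      =ᵐ[volume.restrict (Ioo a b)] fun r => n (leftFrac (2 * α - 1) a φ r)
        (rightFrac (1 - α) b (rightFracTwo (1 - α) b v) r) := by
    filter_upwards [hae] with r hr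
    rw [hr, map_smul]
  have triF : IntegrableOn (fun p : ℝ × ℝ => (p.2 - p.1) ^ (-(1 + α)) •
      n (φ p.1) (m (y p.2 - y p.1) (J p.2))) (tri a b) := by
    refine tri_integrable_pow
      (f := fun r q => (q - r) ^ (-(1 + α)) • n (φ r) (m (y q - y r) (J q)))
      (p := -γ) (s := γ - 1 - α) (C := ‖n‖ * Mφ * (‖m‖ * K * CJ)) (by linarith) (by linarith)
      ((measurable_tri_rpow _).aestronglyMeasurable.smul (n.aestronglyMeasurable_comp₂
        (aesm_tri_fst hφ.aesm) (m.aestronglyMeasurable_comp₂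
          ((aesm_tri_snd hy.aesm).sub (aesm_tri_fst hy.aesm)) (aesm_tri_snd hJm)))) ?_
    intro r q hr hrq hq
    refine norm_smul_diff_le hrq ((n.le_opNorm₂ _ _).trans ?_)
    have h1 := hMφ r ⟨hr, hrq.trans hq⟩
    have h2 := hK r q hr hrq hq
    have h3 := hCJ q ⟨hr.trans hrq, hq⟩
    have h4 := (norm_nonneg _).trans h2
    calc _ ≤ ‖n‖ * Mφ * (‖m‖ * (K * (r - a) ^ (-γ) * (q - r) ^ γ) * CJ) := by
          gcongr
          refine (m.le_opNorm₂ _ _).trans ?_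
          gcongr
      _ = _ := by ring
  have fub := tri_fubini hab.le
    (f := fun r q => (q - r) ^ (-(1 + α)) • n (φ r) (m (y q - y r) (J q))) triF
  refine ⟨fun r hr => ⟨(hw r hr).1, ?_⟩, (hpair.1.smul _).congr_ae_Ioo hab.le hcongr, fub.2.1, ?_⟩
  · have hx : (a + r) / 2 ∈ Ioo a b := ⟨by linarith [hr.1], by linarith [hr.1, hr.2]⟩
    exact rightFracExists_congr_smul hr.2 (hwr r hr)
      (rightFracExists_fracIntegral hα hα1 (hΨmx _ hx) (hΨx _ hx) ⟨by linarith [hr.1], hr.2⟩)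
  · have e1 : ∫ τ in a..b, n (φ τ) (Ψ τ) = ∫ r in a..b, ∫ q in r..b,
        (q - r) ^ (-(1 + α)) • n (φ r) (m (y q - y r) (J q)) := by
      refine integral_congr_Ioo hab.le fun r hr => ?_
      have := ContinuousLinearMap.intervalIntegral_comp_comm (n (φ r))
        (intervalIntegrable_density m hy hαγ hJm hCJ hr)
      simp only [map_smul] at this
      rw [this, hΨ, secondDensity]
    rw [← fub.2.2, ← e1, ← integral_congr_ae_Ioo hab.le hcongr, intervalIntegral.integral_smul,
      hpair.2, smul_smul]
    congr 1
    have hG : Real.Gamma (2 * α - 1) / Real.Gamma (2 * α - 1) = 1 := div_self hG2.ne'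
    have e2 : ∀ G : ℝ, G / G = 1 → c * (Real.Gamma α / G) * G
        = α / (Real.Gamma α * Real.Gamma (1 - α)) := by
      intro G hG
      have hG0 : G ≠ 0 := fun h => by simp [h] at hG
      rw [hc]
      field_simp
    exact e2 _ hG

/-- Fractional integration by parts with the compensated derivative. -/
theorem WHolder.compensated_parts (hab : a < b) {y : ℝ → X} (hy : WHolder γ a b y)
    (hγ1 : γ < 1) (hα0 : 0 < α) (hαγ : α < γ) {f : X → P} (hf : Continuous (fderiv ℝ f))
    (hfy : WHolder γ a b fun r => f (y r)) {Mf : ℝ} (hMf : ∀ r ∈ Ioo a b, ‖fderiv ℝ f (y r)‖ ≤ Mf)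
    (B : P →L[ℝ] Z →L[ℝ] W) {k g : ℝ → Z} {M : ℝ}
    (hk : AEStronglyMeasurable k (volume.restrict (Ioo a b))) (hM : ∀ τ ∈ Ioo a b, ‖k τ‖ ≤ M)
    (hg : ∀ q r, a < q → q ≤ r → r ≤ b → g r - g q = ∫ τ in q..r, k τ)
    (hT : IntervalIntegrable (fun r => ∫ q in a..r, (r - q) ^ (-(1 + α)) •
      B (fderiv ℝ f (y q) (y r - y q)) (∫ τ in r..b, (τ - r) ^ (α - 1) • k τ)) volume a b) :
    (∀ r ∈ Ioo a b, CompFracExists α a f y r ∧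
      RightFracExists (1 - α) b (fun ρ => g ρ - g b) r) ∧
    IntervalIntegrable (fun r => B (compFrac α a f y r)
      (rightFrac (1 - α) b (fun ρ => g ρ - g b) r)) volume a b ∧
    ∫ r in a..b, B (compFrac α a f y r) (rightFrac (1 - α) b (fun ρ => g ρ - g b) r)
      = -(∫ r in a..b, B (f (y r)) (k r)) + (α / (Real.Gamma α * Real.Gamma (1 - α))) •
        ∫ r in a..b, ∫ q in a..r, (r - q) ^ (-(1 + α)) •
          B (fderiv ℝ f (y q) (y r - y q)) (∫ τ in r..b, (τ - r) ^ (α - 1) • k τ) := by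
  obtain ⟨K, hK0, hK⟩ := hy.hol
  have hM0 : 0 ≤ M := (norm_nonneg _).trans (hM ((a + b) / 2) ⟨by linarith, by linarith⟩)
  have hMf0 : 0 ≤ Mf := (norm_nonneg _).trans (hMf ((a + b) / 2) ⟨by linarith, by linarith⟩)
  have hGα : 0 < Real.Gamma α := Real.Gamma_pos_of_pos hα0
  have hGα' : 0 < Real.Gamma (1 - α) := Real.Gamma_pos_of_pos (by linarith)
  -- The linearised increment is bounded by a multiple of |y(r) - y(q)|. The compensation therefore
  -- converges on its own and can be split off from the ordinary left derivative.
  have hD : ∀ r ∈ Ioo a b, IntervalIntegrable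
      (fun q => (r - q) ^ (-(1 + α)) • fderiv ℝ f (y q) (y r - y q)) volume a r := by
    intro r hr
    have hyr := aesm_Ioo_mono hy.aesm le_rfl hr.2.le
    refine intervalIntegrable_singular hγ1 hα0.le hαγ (K := Mf * K) hr.1
      ((ContinuousLinearMap.id ℝ (X →L[ℝ] P)).aestronglyMeasurable_comp₂
        (hf.comp_aestronglyMeasurable hyr) (aestronglyMeasurable_const.sub hyr)) fun q hq => ?_
    refine ((fderiv ℝ f (y q)).le_opNorm _).trans ?_
    have h1 := hMf q ⟨hq.1, hq.2.trans hr.2⟩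
    have h2 := hK q r hq.1 hq.2 hr.2
    calc _ ≤ Mf * (K * (q - a) ^ (-γ) * (r - q) ^ γ) := by gcongr
      _ = _ := by ring
  have hL : ∀ r ∈ Ioo a b, LeftFracExists α a (fun ρ => f (y ρ)) r := fun r hr =>
    hfy.leftFracExists hγ1 hα0.le hαγ hr
  have hcomp : ∀ r ∈ Ioo a b, compFrac α a f y r = leftFrac α a (fun ρ => f (y ρ)) r
      - (α / Real.Gamma (1 - α)) • ∫ q in a..r, (r - q) ^ (-(1 + α)) •
        fderiv ℝ f (y q) (y r - y q) := by
    intro r hr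
    have e : ∫ q in a..r, (r - q) ^ (-(1 + α)) •
        (f (y r) - f (y q) - fderiv ℝ f (y q) (y r - y q))
        = (∫ q in a..r, (r - q) ^ (-(1 + α)) • (f (y r) - f (y q)))
          - ∫ q in a..r, (r - q) ^ (-(1 + α)) • fderiv ℝ f (y q) (y r - y q) := by
      rw [← intervalIntegral.integral_sub (hL r hr) (hD r hr)]
      simp only [smul_sub]
    rw [compFrac, leftFrac, e]
    module
  have hR := fun r hr => (rightFrac_of_primitive (κ := 1 - α) (by linarith) (by linarith) hk hM hg
    (r := r) hr)
  have hA := hfy.integral_leftFrac_rightFrac hab hγ1 hα0 hαγ B hM0 hk hM hg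
  have hT' : IntervalIntegrable (fun r => (α / (Real.Gamma α * Real.Gamma (1 - α))) •
      ∫ q in a..r, (r - q) ^ (-(1 + α)) •
        B (fderiv ℝ f (y q) (y r - y q)) (∫ τ in r..b, (τ - r) ^ (α - 1) • k τ)) volume a b :=
    hT.smul _
  have e1 : ∀ r ∈ Ioo a b, B (leftFrac α a (fun ρ => f (y ρ)) r)
      (rightFrac (1 - α) b (fun ρ => g ρ - g b) r)
      + (α / (Real.Gamma α * Real.Gamma (1 - α))) • ∫ q in a..r, (r - q) ^ (-(1 + α)) •
          B (fderiv ℝ f (y q) (y r - y q)) (∫ τ in r..b, (τ - r) ^ (α - 1) • k τ)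
      = B (compFrac α a f y r) (rightFrac (1 - α) b (fun ρ => g ρ - g b) r) := by
    intro r hr
    have h1 := ContinuousLinearMap.intervalIntegral_comp_comm
      (B.flip (∫ τ in r..b, (τ - r) ^ (α - 1) • k τ)) (hD r hr)
    simp only [map_smul, ContinuousLinearMap.flip_apply] at h1
    -- The factor α / Γ(1-α) of the compensated derivative and the factor -Γ(α)⁻¹ of the right
    -- derivative combine, up to sign, to the constant of `second_order_parts`.
    have h2 : B ((α / Real.Gamma (1 - α)) • ∫ q in a..r, (r - q) ^ (-(1 + α)) •
        fderiv ℝ f (y q) (y r - y q)) (rightFrac (1 - α) b (fun ρ => g ρ - g b) r)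
        = -((α / (Real.Gamma α * Real.Gamma (1 - α))) • B (∫ q in a..r, (r - q) ^ (-(1 + α)) •
          fderiv ℝ f (y q) (y r - y q)) (∫ τ in r..b, (τ - r) ^ (α - 1) • k τ)) := by
      rw [(hR r hr).2, sub_sub_cancel, neg_sub, map_neg, map_smul, map_smul, smul_apply, smul_smul]
      congr 2
      field_simp
    rw [h1, hcomp r hr, map_sub, sub_apply, h2, sub_neg_eq_add]
  refine ⟨fun r hr => ⟨?_, (hR r hr).1⟩, (hA.1.add hT').congr_Ioo hab.le e1, ?_⟩
  · have := (hL r hr).sub (hD r hr)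
    simp only [← smul_sub] at this
    exact this
  · rw [← integral_congr_Ioo hab.le e1, intervalIntegral.integral_add hA.1 hT', hA.2,
      intervalIntegral.integral_smul]

end SecondOrderParts

/-! ### Stability of weighted Hölder paths -/

section WHolderOps

variable {X Y Z : Type*} [NormedAddCommGroup X] [NormedSpace ℝ X]
  [NormedAddCommGroup Y] [NormedSpace ℝ Y] [NormedAddCommGroup Z] [NormedSpace ℝ Z]
  {γ a b : ℝ}

/-- On the interval (b - a)^γ (q - a)^(-γ) is at least one, so an unweighted bound implies the
weighted one. Measurability comes from continuity, boundedness from comparison with the midpoint. -/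
theorem WHolder.of_holder (hab : a < b) (hγ : 0 < γ) {y : ℝ → X} {K : ℝ} (hK : 0 ≤ K)
    (h : ∀ q r, a < q → q < r → r < b → ‖y r - y q‖ ≤ K * (r - q) ^ γ) : WHolder γ a b y := by
  have h' : ∀ q ∈ Ioo a b, ∀ r ∈ Ioo a b, ‖y r - y q‖ ≤ K * |r - q| ^ γ := by
    intro q hq r hr
    rcases lt_trichotomy q r with hqr | hqr | hqr
    · rw [abs_of_pos (sub_pos.2 hqr)]
      exact h q r hq.1 hqr hr.2
    · simp only [hqr, sub_self, norm_zero, abs_zero]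
      exact mul_nonneg hK (Real.rpow_nonneg le_rfl _)
    · rw [norm_sub_rev, abs_sub_comm, abs_of_pos (sub_pos.2 hqr)]
      exact h r q hr.1 hqr hq.2
  have hc : ContinuousOn y (Ioo a b) := by
    intro x hx
    rw [ContinuousWithinAt, tendsto_iff_norm_sub_tendsto_zero]
    have hcont : Continuous fun z : ℝ => K * |z - x| ^ γ :=
      continuous_const.mul ((by fun_prop : Continuous fun z : ℝ => |z - x|).rpow_const
        fun _ => Or.inr hγ.le)
    have h0 : Tendsto (fun z : ℝ => K * |z - x| ^ γ) (𝓝[Ioo a b] x) (𝓝 0) := by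
      have := (hcont.tendsto x).mono_left (nhdsWithin_le_nhds (s := Ioo a b))
      simpa [Real.zero_rpow hγ.ne'] using this
    refine squeeze_zero' (Eventually.of_forall fun _ => norm_nonneg _) ?_ h0
    filter_upwards [self_mem_nhdsWithin] with z hz using h' x hx z hz
  have hba : 0 < b - a := sub_pos.2 hab
  refine ⟨hc.aestronglyMeasurable measurableSet_Ioo,
    ⟨‖y ((a + b) / 2)‖ + K * (b - a) ^ γ, by positivity, fun r hr => ?_⟩,
    ⟨K * (b - a) ^ γ, by positivity, fun q r hq hqr hr => (h q r hq hqr hr).trans ?_⟩⟩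
  · have hm : (a + b) / 2 ∈ Ioo a b := ⟨by linarith, by linarith⟩
    have h1 := norm_le_norm_add_norm_sub' (y r) (y ((a + b) / 2))
    have h2 := h' _ hm r hr
    have h3 : |r - (a + b) / 2| ^ γ ≤ (b - a) ^ γ := by
      refine Real.rpow_le_rpow (abs_nonneg _) (abs_le.2 ⟨?_, ?_⟩) hγ.le <;> linarith [hr.1, hr.2]
    have h4 := mul_le_mul_of_nonneg_left h3 hK
    linarith
  · have h1 : 0 < q - a := sub_pos.2 hq
    have h2 : (1 : ℝ) ≤ (b - a) ^ γ * (q - a) ^ (-γ) := by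
      rw [Real.rpow_neg h1.le, ← div_eq_mul_inv, one_le_div (Real.rpow_pos_of_pos h1 _)]
      exact Real.rpow_le_rpow h1.le (by linarith) hγ.le
    have h3 : 0 ≤ K * (r - q) ^ γ := mul_nonneg hK (Real.rpow_nonneg (by linarith) _)
    calc K * (r - q) ^ γ = (K * (r - q) ^ γ) * 1 := by ring
      _ ≤ (K * (r - q) ^ γ) * ((b - a) ^ γ * (q - a) ^ (-γ)) := by gcongr
      _ = _ := by ring

theorem WHolder.mono_left {y : ℝ → X} (h : WHolder γ a b y) (hγ : 0 ≤ γ) {a' : ℝ} (ha : a ≤ a') :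
    WHolder γ a' b y := by
  obtain ⟨M, hM0, hM⟩ := h.bdd
  obtain ⟨K, hK0, hK⟩ := h.hol
  refine ⟨aesm_Ioo_mono h.aesm ha le_rfl, ⟨M, hM0, fun r hr => hM r ⟨ha.trans_lt hr.1, hr.2⟩⟩,
    ⟨K, hK0, fun q r hq hqr hr => (hK q r (ha.trans_lt hq) hqr hr).trans ?_⟩⟩
  have h1 : (q - a) ^ (-γ) ≤ (q - a') ^ (-γ) :=
    Real.rpow_le_rpow_of_nonpos (sub_pos.2 hq) (by linarith) (by linarith)
  have h2 : 0 ≤ (r - q) ^ γ := Real.rpow_nonneg (by linarith) _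
  gcongr

/-- The Hölder condition involves only norms of increments, so it passes to any bounded measurable
path with dominated increments. Lipschitz and bilinear stability reduce to this. -/
theorem WHolder.of_le {y : ℝ → X} {z : ℝ → Y} (h : WHolder γ a b y)
    (hz : AEStronglyMeasurable z (volume.restrict (Ioo a b))) {M L : ℝ} (hL : 0 ≤ L)
    (hM : ∀ r ∈ Ioo a b, ‖z r‖ ≤ M)
    (hle : ∀ q ∈ Ioo a b, ∀ r ∈ Ioo a b, ‖z r - z q‖ ≤ L * ‖y r - y q‖) : WHolder γ a b z := by
  obtain ⟨K, hK0, hK⟩ := h.hol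
  refine ⟨hz, ⟨|M|, abs_nonneg _, fun r hr => (hM r hr).trans (le_abs_self _)⟩,
    ⟨L * K, mul_nonneg hL hK0, fun q r hq hqr hr => ?_⟩⟩
  refine (hle q ⟨hq, hqr.trans hr⟩ r ⟨hq.trans hqr, hr⟩).trans ?_
  calc _ ≤ L * (K * (q - a) ^ (-γ) * (r - q) ^ γ) := by gcongr; exact hK q r hq hqr hr
    _ = _ := by ring

theorem WHolder.lipschitz_comp {y : ℝ → X} (h : WHolder γ a b y) {f : X → Y} {C : ℝ≥0}
    (hf : LipschitzWith C f) : WHolder γ a b fun r => f (y r) := by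
  obtain ⟨M, hM0, hM⟩ := h.bdd
  refine h.of_le (hf.continuous.comp_aestronglyMeasurable h.aesm) (L := C) C.2
    (M := ‖f 0‖ + C * M) (fun r hr => ?_) fun q _ r _ => ?_
  · have h1 := hf.norm_sub_le (y r) 0
    rw [sub_zero] at h1
    have h2 := norm_le_norm_add_norm_sub' (f (y r)) (f 0)
    have h3 := mul_le_mul_of_nonneg_left (hM r hr) C.2
    change (C : ℝ) * _ ≤ C * M at h3
    linarith
  · exact hf.norm_sub_le _ _

theorem WHolder.clm_comp {y : ℝ → X} (h : WHolder γ a b y) (L : X →L[ℝ] Y) :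
    WHolder γ a b fun r => L (y r) := h.lipschitz_comp L.lipschitz

theorem WHolder.prodMk {y : ℝ → X} {z : ℝ → Y} (hy : WHolder γ a b y) (hz : WHolder γ a b z) :
    WHolder γ a b fun r => (y r, z r) := by
  obtain ⟨M, hM0, hM⟩ := hy.bdd
  obtain ⟨K, hK0, hK⟩ := hy.hol
  obtain ⟨M', hM0', hM'⟩ := hz.bdd
  obtain ⟨K', hK0', hK'⟩ := hz.hol
  refine ⟨hy.aesm.prodMk hz.aesm, ⟨max M M', le_max_of_le_left hM0, fun r hr =>
    max_le_max (hM r hr) (hM' r hr)⟩, ⟨max K K', le_max_of_le_left hK0, fun q r hq hqr hr => ?_⟩⟩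
  have h1 : 0 ≤ (r - q) ^ γ := Real.rpow_nonneg (by linarith) _
  have h2 : 0 ≤ (q - a) ^ (-γ) := Real.rpow_nonneg (by linarith) _
  refine max_le ((hK q r hq hqr hr).trans ?_) ((hK' q r hq hqr hr).trans ?_)
  · gcongr
    exact le_max_left _ _
  · gcongr
    exact le_max_right _ _

theorem WHolder.add {y z : ℝ → X} (hy : WHolder γ a b y) (hz : WHolder γ a b z) :
    WHolder γ a b fun r => y r + z r :=
  (hy.prodMk hz).clm_comp (ContinuousLinearMap.fst ℝ X X + ContinuousLinearMap.snd ℝ X X)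

theorem WHolder.congr {y z : ℝ → X} (hy : WHolder γ a b y) (h : ∀ r ∈ Ioo a b, y r = z r) :
    WHolder γ a b z := by
  obtain ⟨M, hM0, hM⟩ := hy.bdd
  refine hy.of_le (hy.aesm.congr ?_) zero_le_one (M := M) (fun r hr => h r hr ▸ hM r hr) ?_
  · filter_upwards [ae_restrict_mem measurableSet_Ioo] with r hr using h r hr
  · intro q hq r hr
    rw [h q hq, h r hr, one_mul]

theorem WHolder.sub_const {y : ℝ → X} (hy : WHolder γ a b y) (c : X) :
    WHolder γ a b fun r => y r - c :=
  hy.lipschitz_comp (f := fun x => x - c) (C := 1) (LipschitzWith.of_dist_le_mul fun x z => by simp)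

theorem WHolder.bilin {y : ℝ → X} {z : ℝ → Y} (hy : WHolder γ a b y) (hz : WHolder γ a b z)
    (B : X →L[ℝ] Y →L[ℝ] Z) : WHolder γ a b fun r => B (y r) (z r) := by
  obtain ⟨M, hM0, hM⟩ := hy.bdd
  obtain ⟨M', hM0', hM'⟩ := hz.bdd
  refine (hy.prodMk hz).of_le (B.aestronglyMeasurable_comp₂ hy.aesm hz.aesm)
    (L := ‖B‖ * M' + ‖B‖ * M) (M := ‖B‖ * M * M') (by positivity) (fun r hr => ?_) ?_
  · refine (B.le_opNorm₂ _ _).trans ?_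
    have := hM r hr
    have := hM' r hr
    gcongr
  · intro q hq r hr
    have e : B (y r) (z r) - B (y q) (z q) = B (y r - y q) (z r) + B (y q) (z r - z q) := by
      simp only [map_sub, sub_apply]
      abel
    have h1 : ‖y r - y q‖ ≤ ‖(y r, z r) - (y q, z q)‖ := le_max_left _ _
    have h2 : ‖z r - z q‖ ≤ ‖(y r, z r) - (y q, z q)‖ := le_max_right _ _
    have h3 := hM' r hr
    have h4 := hM q hq
    rw [e]
    calc _ ≤ ‖B‖ * ‖y r - y q‖ * ‖z r‖ + ‖B‖ * ‖y q‖ * ‖z r - z q‖ :=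
          (norm_add_le _ _).trans (add_le_add (B.le_opNorm₂ _ _) (B.le_opNorm₂ _ _))
      _ ≤ ‖B‖ * ‖(y r, z r) - (y q, z q)‖ * M' + ‖B‖ * M * ‖(y r, z r) - (y q, z q)‖ := by gcongr
      _ = _ := by ring

end WHolderOps

/-! ### The semigroup: smoothing estimate and measurability -/

namespace EigenData

variable {V : Type*} [NormedAddCommGroup V] [InnerProductSpace ℝ V] (D : EigenData V)

theorem repr_S (t : ℝ) (x : V) (i : ℕ) :
    D.e.repr (D.S t x) i = Real.exp (-(D.lam i * max t 0)) * D.e.repr x i := by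
  change D.e.repr (D.e.repr.symm _) i = _
  rw [LinearIsometryEquiv.apply_symm_apply]

theorem norm_le_of_repr {x y : V} {C : ℝ} (hC : 0 ≤ C)
    (h : ∀ i, |D.e.repr x i| ≤ C * |D.e.repr y i|) : ‖x‖ ≤ C * ‖y‖ := by
  rw [← D.e.repr.norm_map x, ← D.e.repr.norm_map y, ← Real.norm_of_nonneg hC, ← norm_smul]
  refine lp.norm_mono (by norm_num) fun i => ?_
  rw [lp.coeFn_smul, Pi.smul_apply, norm_smul, Real.norm_of_nonneg hC]
  exact h i

theorem S_of_nonpos {t : ℝ} (ht : t ≤ 0) : D.S t = ContinuousLinearMap.id ℝ V := by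
  ext x
  apply D.e.repr.injective
  ext i
  rw [repr_S, max_eq_right ht]
  simp

theorem S_add {s t : ℝ} (hs : 0 ≤ s) (ht : 0 ≤ t) : D.S (s + t) = D.S s ∘L D.S t := by
  ext x
  apply D.e.repr.injective
  ext i
  rw [ContinuousLinearMap.comp_apply, repr_S, repr_S, repr_S, max_eq_left hs, max_eq_left ht,
    max_eq_left (add_nonneg hs ht), ← mul_assoc, ← Real.exp_add]
  ring_nf

theorem norm_S_le (t : ℝ) : ‖D.S t‖ ≤ 1 :=
  LinearMap.mkContinuous_norm_le _ zero_le_one _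

theorem rpow_mul_exp_neg_le {x γ : ℝ} (hx : 0 ≤ x) (hγ1 : γ ≤ 1) (hγ0 : 0 ≤ γ) :
    x ^ γ * Real.exp (-x) ≤ 1 := by
  have h : x ^ γ ≤ Real.exp x := by
    rcases le_total x 1 with h1 | h1
    · exact (Real.rpow_le_one hx h1 hγ0).trans (Real.one_le_exp hx)
    · exact (Real.rpow_le_rpow_of_exponent_le h1 hγ1).trans
        (by rw [Real.rpow_one]; linarith [Real.add_one_le_exp x])
  rw [Real.exp_neg, ← div_eq_mul_inv, div_le_one (Real.exp_pos x)]
  exact h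

theorem one_sub_exp_neg_le {x γ : ℝ} (hx : 0 ≤ x) (hγ1 : γ ≤ 1) (hγ0 : 0 ≤ γ) :
    1 - Real.exp (-x) ≤ x ^ γ := by
  rcases le_total x 1 with h1 | h1
  · rcases hx.eq_or_lt with rfl | h0
    · simpa using Real.rpow_nonneg le_rfl γ
    · have : x ^ (1 : ℝ) ≤ x ^ γ := Real.rpow_le_rpow_of_exponent_ge h0 h1 hγ1
      rw [Real.rpow_one] at this
      linarith [Real.add_one_le_exp (-x)]
  · linarith [Real.one_le_rpow h1 hγ0, Real.exp_pos (-x)]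

/-- On each coordinate e^(-λq) (1 - e^(-λ(r-q))) ≤ (λq)^(-γ) (λ(r-q))^γ, and the powers of λ cancel.
The weight in `WHolder` originates here. -/
theorem norm_S_sub_le {q r γ : ℝ} (hq : 0 < q) (hqr : q ≤ r) (hγ0 : 0 ≤ γ) (hγ1 : γ ≤ 1) :
    ‖D.S r - D.S q‖ ≤ (r - q) ^ γ * q ^ (-γ) := by
  have hrq : 0 ≤ r - q := sub_nonneg.2 hqr
  refine ContinuousLinearMap.opNorm_le_bound _ (by positivity) fun x => ?_
  refine D.norm_le_of_repr (by positivity) fun i => ?_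
  have hl := D.lam_pos i
  rw [sub_apply, map_sub, lp.coeFn_sub, Pi.sub_apply, repr_S, repr_S, ← sub_mul, abs_mul,
    max_eq_left hq.le, max_eq_left (hq.le.trans hqr)]
  refine mul_le_mul_of_nonneg_right ?_ (abs_nonneg _)
  have e : Real.exp (-(D.lam i * r)) = Real.exp (-(D.lam i * q)) * Real.exp (-(D.lam i * (r - q))) := by
    rw [← Real.exp_add]
    ring_nf
  have h1 := one_sub_exp_neg_le (mul_nonneg hl.le hrq) hγ1 hγ0
  have h2 := rpow_mul_exp_neg_le (mul_nonneg hl.le hq.le) hγ1 hγ0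
  have h3 : Real.exp (-(D.lam i * (r - q))) ≤ 1 :=
    Real.exp_le_one_iff.2 (by have := mul_nonneg hl.le hrq; linarith)
  rw [e, abs_sub_comm, show ∀ A B : ℝ, A - A * B = A * (1 - B) by intros; ring, abs_mul,
    Real.abs_exp, abs_of_nonneg (by linarith)]
  have h4 : Real.exp (-(D.lam i * q)) ≤ (D.lam i * q) ^ (-γ) := by
    have h5 : 0 < D.lam i * q := mul_pos hl hq
    rw [Real.rpow_neg h5.le, ← one_div, le_div_iff₀ (Real.rpow_pos_of_pos h5 _)]
    linarith
  calc _ ≤ (D.lam i * q) ^ (-γ) * (D.lam i * (r - q)) ^ γ := by gcongr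
    _ = _ := by
      rw [Real.mul_rpow hl.le hq.le, Real.mul_rpow hl.le hrq, Real.rpow_neg hl.le]
      have := (Real.rpow_pos_of_pos hl γ).ne'
      field_simp

theorem continuous_S_max {c : ℝ} (hc : 0 < c) : Continuous fun t : ℝ => D.S (max t c) := by
  have key : ∀ q r : ℝ, c ≤ q → q ≤ r → ‖D.S r - D.S q‖ ≤ c⁻¹ * (r - q) := by
    intro q r hq hqr
    have h := D.norm_S_sub_le (hc.trans_le hq) hqr zero_le_one le_rfl
    rw [Real.rpow_one, Real.rpow_neg_one] at h
    have h1 : q⁻¹ ≤ c⁻¹ := inv_anti₀ hc hq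
    have := mul_le_mul_of_nonneg_left h1 (sub_nonneg.2 hqr)
    linarith
  refine LipschitzWith.continuous (K := ⟨c⁻¹, by positivity⟩) (LipschitzWith.of_dist_le_mul ?_)
  intro x y
  wlog hxy : y ≤ x generalizing x y with H
  · rw [dist_comm, dist_comm x]
    exact H y x (le_of_not_ge hxy)
  rw [dist_eq_norm, Real.dist_eq, abs_of_nonneg (sub_nonneg.2 hxy)]
  refine (key _ _ (le_max_right _ _) (max_le_max_right c hxy)).trans ?_
  change _ ≤ c⁻¹ * _
  have : max x c - max y c ≤ x - y := by
    rcases le_total x c with h1 | h1 <;> rcases le_total y c with h2 | h2 <;> simp [h1, h2] <;>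
      linarith
  gcongr

/-- Norm continuity fails at time zero because the eigenvalues are unbounded. But `S` is the
pointwise limit of its truncations at `1 / (n + 1)`, which for positive times are Lipschitz in
operator norm. This makes operator-valued Bochner integrals of `S` available. -/
theorem stronglyMeasurable_S : StronglyMeasurable D.S := by
  refine stronglyMeasurable_of_tendsto (u := atTop) (f := fun (n : ℕ) t =>
    if t ≤ 0 then ContinuousLinearMap.id ℝ V else D.S (max t (1 / ((n : ℝ) + 1))))
    (fun n => ?_) (tendsto_pi_nhds.2 fun t => ?_)
  · exact StronglyMeasurable.ite measurableSet_Iic stronglyMeasurable_const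
      (D.continuous_S_max (by positivity)).stronglyMeasurable
  · rcases le_or_gt t 0 with ht | ht
    · simp only [if_pos ht, D.S_of_nonpos ht]
      exact tendsto_const_nhds
    · simp only [if_neg ht.not_ge]
      refine tendsto_const_nhds.congr' ?_
      filter_upwards [tendsto_one_div_add_atTop_nhds_zero_nat.eventually (gt_mem_nhds ht)] with n hn
      rw [max_eq_left hn.le]

end EigenData

theorem norm_integral_le_const {E : Type*} [NormedAddCommGroup E] [NormedSpace ℝ E] {a b C : ℝ}
    (hab : a ≤ b) {f : ℝ → E} (h : ∀ x ∈ Ioo a b, ‖f x‖ ≤ C) : ‖∫ x in a..b, f x‖ ≤ C * (b - a) := by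
  rw [← setIntegral_Ioo_eq hab]
  refine (norm_setIntegral_le_of_norm_le_const (by simp) h).trans_eq ?_
  simp [hab]

theorem norm_integral_Ioo_le {E : Type*} [NormedAddCommGroup E] [NormedSpace ℝ E] {a b : ℝ}
    (hab : a ≤ b) {f : ℝ → E} {g : ℝ → ℝ} (hg : IntervalIntegrable g volume a b)
    (h : ∀ x ∈ Ioo a b, ‖f x‖ ≤ g x) : ‖∫ x in a..b, f x‖ ≤ ∫ x in a..b, g x := by
  rw [← setIntegral_Ioo_eq hab, ← setIntegral_Ioo_eq hab]
  refine norm_integral_le_of_norm_le ((intervalIntegrable_iff_Ioo hab).1 hg) ?_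
  filter_upwards [ae_restrict_mem measurableSet_Ioo] with x hx using h x hx

theorem intervalIntegrable_of_const {E : Type*} [NormedAddCommGroup E] {a b C : ℝ}
    (hab : a ≤ b) {f : ℝ → E} (hf : AEStronglyMeasurable f (volume.restrict (Ioo a b)))
    (h : ∀ x ∈ Ioo a b, ‖f x‖ ≤ C) : IntervalIntegrable f volume a b :=
  intervalIntegrable_of_bound hab intervalIntegrable_const hf h

theorem tri_integrable_const {E : Type*} [NormedAddCommGroup E] [NormedSpace ℝ E] {a b C : ℝ}
    {f : ℝ → ℝ → E}
    (hf : AEStronglyMeasurable (fun p : ℝ × ℝ => f p.1 p.2) (volume.restrict (tri a b)))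
    (h : ∀ x y, a < x → x < y → y < b → ‖f x y‖ ≤ C) :
    IntegrableOn (fun p : ℝ × ℝ => f p.1 p.2) (tri a b) :=
  tri_integrable_pow (C := C) (p := 0) (s := 0) (by norm_num) (by norm_num) hf
    fun x y hx hxy hy => by simpa using h x y hx hxy hy

/-! ### Convolutions with the semigroup -/

namespace EigenData

variable {V : Type*} [NormedAddCommGroup V] [InnerProductSpace ℝ V] (D : EigenData V)
  {X Y : Type*} [NormedAddCommGroup X] [NormedSpace ℝ X] [NormedAddCommGroup Y] [NormedSpace ℝ Y]
  (B : (V →L[ℝ] V) →L[ℝ] X →L[ℝ] Y) {h : ℝ → X} {M γ a b : ℝ}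

theorem aesm_S_tri : AEStronglyMeasurable (fun p : ℝ × ℝ => D.S (p.2 - p.1))
    (volume.restrict (tri a b)) :=
  (D.stronglyMeasurable_S.comp_measurable (by fun_prop)).aestronglyMeasurable

theorem aesm_S_sub_left (t : ℝ) (μ : Measure ℝ) : AEStronglyMeasurable (fun r => D.S (t - r)) μ :=
  (D.stronglyMeasurable_S.comp_measurable (by fun_prop)).aestronglyMeasurable

theorem aesm_S_sub_right (t : ℝ) (μ : Measure ℝ) : AEStronglyMeasurable (fun r => D.S (r - t)) μ :=
  (D.stronglyMeasurable_S.comp_measurable (by fun_prop)).aestronglyMeasurable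

theorem norm_bilin_S_le (t : ℝ) {x : X} (hx : ‖x‖ ≤ M) : ‖B (D.S t) x‖ ≤ ‖B‖ * M := by
  refine (B.le_opNorm₂ _ _).trans ?_
  have h1 := D.norm_S_le t
  have h2 := norm_nonneg x
  calc _ ≤ ‖B‖ * 1 * M := by gcongr
    _ = _ := by ring

/-- The bilinear map `B` lets one statement serve both vector-valued convolutions, with `B` the
identity, and operator-valued ones, with `B` equal to `tensOp` or `noiseOp`. -/
theorem intervalIntegrable_conv_left (hab : a ≤ b)
    (hh : AEStronglyMeasurable h (volume.restrict (Ioo a b))) (hM : ∀ r ∈ Ioo a b, ‖h r‖ ≤ M)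
    (t : ℝ) : IntervalIntegrable (fun r => B (D.S (t - r)) (h r)) volume a b :=
  intervalIntegrable_of_const hab (B.aestronglyMeasurable_comp₂ (D.aesm_S_sub_left t _) hh)
    fun r hr => D.norm_bilin_S_le B _ (hM r hr)

theorem intervalIntegrable_conv_right (hab : a ≤ b)
    (hh : AEStronglyMeasurable h (volume.restrict (Ioo a b))) (hM : ∀ r ∈ Ioo a b, ‖h r‖ ≤ M)
    (t : ℝ) : IntervalIntegrable (fun r => B (D.S (r - t)) (h r)) volume a b :=
  intervalIntegrable_of_const hab (B.aestronglyMeasurable_comp₂ (D.aesm_S_sub_right t _) hh)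
    fun r hr => D.norm_bilin_S_le B _ (hM r hr)

theorem norm_bilin_S_sub_le {q r : ℝ} (hq : 0 < q) (hqr : q ≤ r) (hγ0 : 0 ≤ γ) (hγ1 : γ ≤ 1)
    {x : X} (hx : ‖x‖ ≤ M) :
    ‖B (D.S r) x - B (D.S q) x‖ ≤ ‖B‖ * M * (r - q) ^ γ * q ^ (-γ) := by
  rw [← sub_apply, ← map_sub]
  refine (B.le_opNorm₂ _ _).trans ?_
  have h1 := D.norm_S_sub_le hq hqr hγ0 hγ1
  have h2 := norm_nonneg x
  calc _ ≤ ‖B‖ * ((r - q) ^ γ * q ^ (-γ)) * M := by gcongr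
    _ = _ := by ring

theorem sub_le_rpow {c d x : ℝ} (hγ1 : γ < 1) (hx : 0 < x) (hxd : x ≤ d - c) :
    x ≤ (d - c) ^ (1 - γ) * x ^ γ := by
  have : x = x ^ (1 - γ) * x ^ γ := by rw [← Real.rpow_add hx, sub_add_cancel, Real.rpow_one]
  have h2 := Real.rpow_nonneg hx.le γ
  calc x = x ^ (1 - γ) * x ^ γ := this
    _ ≤ _ := by gcongr

/-- Convolutions with the semigroup are Hölder continuous. -/
theorem holder_conv_left (hab : a < b) (hγ0 : 0 < γ) (hγ1 : γ < 1)
    (hh : AEStronglyMeasurable h (volume.restrict (Ioo a b))) (hM : ∀ r ∈ Ioo a b, ‖h r‖ ≤ M) :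
    WHolder γ a b fun t => ∫ r in a..t, B (D.S (t - r)) (h r) := by
  have hM0 : 0 ≤ M := (norm_nonneg _).trans (hM ((a + b) / 2) ⟨by linarith, by linarith⟩)
  have hba : 0 ≤ b - a := by linarith
  have hγ' : 0 < 1 - γ := by linarith
  refine WHolder.of_holder hab hγ0 (K := ‖B‖ * M * (b - a) ^ (1 - γ) * (1 / (1 - γ) + 1))
    (by positivity) fun q r hq hqr hr => ?_
  have i1 : ∀ t, IntervalIntegrable (fun ρ => B (D.S (t - ρ)) (h ρ)) volume a q := fun t =>
    D.intervalIntegrable_conv_left B hq.le (aesm_Ioo_mono hh le_rfl (hqr.trans hr).le)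
      (fun ρ hρ => hM ρ ⟨hρ.1, hρ.2.trans (hqr.trans hr)⟩) t
  have i2 : IntervalIntegrable (fun ρ => B (D.S (r - ρ)) (h ρ)) volume q r :=
    D.intervalIntegrable_conv_left B hqr.le (aesm_Ioo_mono hh hq.le hr.le)
      (fun ρ hρ => hM ρ ⟨hq.trans hρ.1, hρ.2.trans hr⟩) r
  -- The increment is the change of the semigroup over `(a, q)`, of order (r - q)^γ with the
  -- integrable factor (q - ρ)^(-γ), plus the new piece over `(q, r)`, of order r - q.
  have e : (∫ ρ in a..r, B (D.S (r - ρ)) (h ρ)) - ∫ ρ in a..q, B (D.S (q - ρ)) (h ρ)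
      = (∫ ρ in a..q, (B (D.S (r - ρ)) (h ρ) - B (D.S (q - ρ)) (h ρ)))
        + ∫ ρ in q..r, B (D.S (r - ρ)) (h ρ) := by
    rw [intervalIntegral.integral_sub (i1 r) (i1 q),
      ← intervalIntegral.integral_add_adjacent_intervals (i1 r) i2]
    abel
  rw [e]
  have b1 : ‖∫ ρ in a..q, (B (D.S (r - ρ)) (h ρ) - B (D.S (q - ρ)) (h ρ))‖
      ≤ ∫ ρ in a..q, ‖B‖ * M * (r - q) ^ γ * (q - ρ) ^ (-γ) := by
    refine norm_integral_Ioo_le hq.le ((intervalIntegrable_rsub_rpow (by linarith) a q q).const_mul _)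
      fun ρ hρ => ?_
    have := D.norm_bilin_S_sub_le B (q := q - ρ) (r := r - ρ) (by linarith [hρ.2]) (by linarith)
      hγ0.le hγ1.le (hM ρ ⟨hρ.1, hρ.2.trans (hqr.trans hr)⟩)
    rwa [show r - ρ - (q - ρ) = r - q by ring] at this
  rw [intervalIntegral.integral_const_mul, integral_rsub_rpow (by linarith), neg_add_eq_sub] at b1
  have b2 := norm_integral_le_const hqr.le (C := ‖B‖ * M) (f := fun ρ => B (D.S (r - ρ)) (h ρ))
    fun ρ hρ => D.norm_bilin_S_le B _ (hM ρ ⟨hq.trans hρ.1, hρ.2.trans hr⟩)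
  have b3 := sub_le_rpow (c := a) (d := b) (x := r - q) hγ1 (by linarith) (by linarith)
  have b4 : (q - a) ^ (1 - γ) ≤ (b - a) ^ (1 - γ) :=
    Real.rpow_le_rpow (by linarith) (by linarith) hγ'.le
  have h0 : 0 ≤ (r - q) ^ γ := Real.rpow_nonneg (by linarith) _
  refine (norm_add_le _ _).trans ((add_le_add b1 b2).trans ?_)
  calc _ ≤ ‖B‖ * M * (r - q) ^ γ * ((b - a) ^ (1 - γ) / (1 - γ))
        + ‖B‖ * M * ((b - a) ^ (1 - γ) * (r - q) ^ γ) := by gcongr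
    _ = _ := by ring

theorem holder_conv_right (hab : a < b) (hγ0 : 0 < γ) (hγ1 : γ < 1)
    (hh : AEStronglyMeasurable h (volume.restrict (Ioo a b))) (hM : ∀ r ∈ Ioo a b, ‖h r‖ ≤ M) :
    WHolder γ a b fun t => ∫ r in t..b, B (D.S (r - t)) (h r) := by
  have hM0 : 0 ≤ M := (norm_nonneg _).trans (hM ((a + b) / 2) ⟨by linarith, by linarith⟩)
  have hba : 0 ≤ b - a := by linarith
  have hγ' : 0 < 1 - γ := by linarith
  refine WHolder.of_holder hab hγ0 (K := ‖B‖ * M * (b - a) ^ (1 - γ) * (1 / (1 - γ) + 1))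
    (by positivity) fun q r hq hqr hr => ?_
  have i1 : ∀ t, IntervalIntegrable (fun ρ => B (D.S (ρ - t)) (h ρ)) volume r b := fun t =>
    D.intervalIntegrable_conv_right B hr.le (aesm_Ioo_mono hh (hq.trans hqr).le le_rfl)
      (fun ρ hρ => hM ρ ⟨(hq.trans hqr).trans hρ.1, hρ.2⟩) t
  have i2 : IntervalIntegrable (fun ρ => B (D.S (ρ - q)) (h ρ)) volume q r :=
    D.intervalIntegrable_conv_right B hqr.le (aesm_Ioo_mono hh hq.le hr.le)
      (fun ρ hρ => hM ρ ⟨hq.trans hρ.1, hρ.2.trans hr⟩) q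
  have e : (∫ ρ in r..b, B (D.S (ρ - r)) (h ρ)) - ∫ ρ in q..b, B (D.S (ρ - q)) (h ρ)
      = -((∫ ρ in r..b, (B (D.S (ρ - q)) (h ρ) - B (D.S (ρ - r)) (h ρ)))
        + ∫ ρ in q..r, B (D.S (ρ - q)) (h ρ)) := by
    rw [intervalIntegral.integral_sub (i1 q) (i1 r),
      ← intervalIntegral.integral_add_adjacent_intervals i2 (i1 q)]
    abel
  rw [e, norm_neg]
  have b1 : ‖∫ ρ in r..b, (B (D.S (ρ - q)) (h ρ) - B (D.S (ρ - r)) (h ρ))‖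
      ≤ ∫ ρ in r..b, ‖B‖ * M * (r - q) ^ γ * (ρ - r) ^ (-γ) := by
    refine norm_integral_Ioo_le hr.le ((intervalIntegrable_sub_rpow (by linarith) r b r).const_mul _)
      fun ρ hρ => ?_
    have := D.norm_bilin_S_sub_le B (q := ρ - r) (r := ρ - q) (by linarith [hρ.1]) (by linarith)
      hγ0.le hγ1.le (hM ρ ⟨(hq.trans hqr).trans hρ.1, hρ.2⟩)
    rwa [show ρ - q - (ρ - r) = r - q by ring] at this
  rw [intervalIntegral.integral_const_mul, integral_sub_rpow (by linarith), neg_add_eq_sub] at b1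
  have b2 := norm_integral_le_const hqr.le (C := ‖B‖ * M) (f := fun ρ => B (D.S (ρ - q)) (h ρ))
    fun ρ hρ => D.norm_bilin_S_le B _ (hM ρ ⟨hq.trans hρ.1, hρ.2.trans hr⟩)
  have b3 := sub_le_rpow (c := a) (d := b) (x := r - q) hγ1 (by linarith) (by linarith)
  have b4 : (b - r) ^ (1 - γ) ≤ (b - a) ^ (1 - γ) :=
    Real.rpow_le_rpow (by linarith) (by linarith) hγ'.le
  have h0 : 0 ≤ (r - q) ^ γ := Real.rpow_nonneg (by linarith) _
  refine (norm_add_le _ _).trans ((add_le_add b1 b2).trans ?_)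
  calc _ ≤ ‖B‖ * M * (r - q) ^ γ * ((b - a) ^ (1 - γ) / (1 - γ))
        + ‖B‖ * M * ((b - a) ^ (1 - γ) * (r - q) ^ γ) := by gcongr
    _ = _ := by ring

/-- The orbits of the semigroup are Hölder continuous with a singularity at zero. -/
theorem holder_orbit (hγ0 : 0 ≤ γ) (hγ1 : γ ≤ 1) (x : V) (b : ℝ) :
    WHolder γ 0 b fun t => D.S t x := by
  refine ⟨((ContinuousLinearMap.apply ℝ V x).continuous.comp_stronglyMeasurable
    D.stronglyMeasurable_S).aestronglyMeasurable,
    ⟨‖x‖, norm_nonneg _, fun r _ => (D.S r).le_of_opNorm_le (D.norm_S_le r) x |>.trans_eq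
      (one_mul _)⟩, ⟨‖x‖, norm_nonneg _, fun q r hq hqr _ => ?_⟩⟩
  rw [← sub_apply, sub_zero]
  refine ((D.S r - D.S q).le_of_opNorm_le (D.norm_S_sub_le hq hqr.le hγ0 hγ1) x).trans_eq ?_
  ring

end EigenData

/-! ### Smooth paths -/

section SmoothPath

variable {V : Type*} [NormedAddCommGroup V] [InnerProductSpace ℝ V] {T : ℝ} {ω : ℝ → V}

/-- The values of `deriv` at the finitely many exceptional points are included in the maximum, so no
null set has to be carried along. -/
theorem SmoothPath.exists_bound (hω : SmoothPath T ω) :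
    ∃ M, 0 ≤ M ∧ ∀ t ∈ Ioo 0 T, ‖deriv ω t‖ ≤ M := by
  obtain ⟨-, N, hN, -, M, hM⟩ := hω
  obtain ⟨M', hM'⟩ := (hN.image fun t => ‖deriv ω t‖).bddAbove
  refine ⟨max 0 (max M M'), le_max_left _ _, fun t ht => le_max_of_le_right ?_⟩
  by_cases h : t ∈ N
  · exact le_max_of_le_right (hM' ⟨t, h, rfl⟩)
  · exact le_max_of_le_left (hM t ⟨ht, h⟩)

theorem SmoothPath.aesm_deriv (hω : SmoothPath T ω) :
    AEStronglyMeasurable (deriv ω) (volume.restrict (Ioo 0 T)) := by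
  obtain ⟨-, N, hN, hC, -⟩ := hω
  have ho : IsOpen (Ioo 0 T \ N) := isOpen_Ioo.sdiff hN.isClosed
  have h := (hC.continuousOn_deriv_of_isOpen ho le_rfl).aestronglyMeasurable
    (μ := volume) ho.measurableSet
  have e : (Ioo 0 T \ N : Set ℝ) =ᵐ[volume] (Ioo 0 T : Set ℝ) :=
    sdiff_null_ae_eq_self (hN.measure_zero _)
  rwa [Measure.restrict_congr_set e] at h

theorem SmoothPath.integral_deriv [CompleteSpace V] (hω : SmoothPath T ω) {s t : ℝ}
    (hs : 0 ≤ s) (hst : s ≤ t) (ht : t ≤ T) : ∫ r in s..t, deriv ω r = ω t - ω s := by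
  obtain ⟨M, hM0, hM⟩ := hω.exists_bound
  have hm := hω.aesm_deriv
  obtain ⟨hc, N, hN, hC, -⟩ := hω
  refine integral_eq_of_hasDerivAt_off_countable_of_le ω (deriv ω) hst hN.countable
    (hc.mono (Icc_subset_Icc hs ht)) (fun x hx => ?_)
    (intervalIntegrable_of_const hst (aesm_Ioo_mono hm hs ht)
      fun r hr => hM r ⟨hs.trans_lt hr.1, hr.2.trans_le ht⟩)
  have ho : IsOpen (Ioo 0 T \ N) := isOpen_Ioo.sdiff hN.isClosed
  have hx' : x ∈ Ioo 0 T \ N := ⟨⟨hs.trans_lt hx.1.1, hx.1.2.trans_le ht⟩, hx.2⟩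
  exact ((hC.differentiableOn one_ne_zero).differentiableAt (ho.mem_nhds hx')).hasDerivAt

end SmoothPath

/-! ### Restarting mild solutions, and their regularity -/

section MildSolution

variable {V : Type*} [NormedAddCommGroup V] [InnerProductSpace ℝ V] [CompleteSpace V]
  (D : EigenData V) {δ : ℝ≥0} {T : ℝ} {ω : ℝ → V} {F : V → V} {G : V → HSOp V (D.Vd δ)}
  {u₀ : D.Vd δ} {u : ℝ → V}

/-- On `(0, s)` the law S(t - r) = S(t - s) S(s - r) lets S(t - s) be pulled out of the integral. -/
theorem EigenData.conv_split {h : ℝ → V} {M s t : ℝ} (hs : 0 ≤ s) (hst : s ≤ t) (ht : t ≤ T)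
    (hh : AEStronglyMeasurable h (volume.restrict (Ioo 0 T))) (hM : ∀ r ∈ Ioo 0 T, ‖h r‖ ≤ M) :
    ∫ r in (0 : ℝ)..t, D.S (t - r) (h r)
      = D.S (t - s) (∫ r in (0 : ℝ)..s, D.S (s - r) (h r)) + ∫ r in s..t, D.S (t - r) (h r) := by
  have i1 : ∀ x, IntervalIntegrable (fun r => D.S (x - r) (h r)) volume 0 s := fun x =>
    D.intervalIntegrable_conv_left (ContinuousLinearMap.id ℝ (V →L[ℝ] V)) hs
      (aesm_Ioo_mono hh le_rfl (hst.trans ht)) (fun r hr => hM r ⟨hr.1, hr.2.trans_le (hst.trans ht)⟩) x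
  have i2 : IntervalIntegrable (fun r => D.S (t - r) (h r)) volume s t :=
    D.intervalIntegrable_conv_left (ContinuousLinearMap.id ℝ (V →L[ℝ] V)) hst
      (aesm_Ioo_mono hh hs ht) (fun r hr => hM r ⟨hs.trans_lt hr.1, hr.2.trans_le ht⟩) t
  rw [← intervalIntegral.integral_add_adjacent_intervals (i1 t) i2,
    ← ContinuousLinearMap.intervalIntegral_comp_comm _ (i1 s)]
  congr 1
  refine integral_congr_Ioo hs fun r hr => ?_
  rw [← ContinuousLinearMap.comp_apply, ← D.S_add (by linarith) (by linarith [hr.2])]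
  congr 2
  ring

theorem aesm_of_continuousOn_Icc {E : Type*} [NormedAddCommGroup E] {y : ℝ → E} {a b : ℝ}
    (h : ContinuousOn y (Icc a b)) : AEStronglyMeasurable y (volume.restrict (Ioo a b)) :=
  (h.mono Ioo_subset_Icc_self).aestronglyMeasurable measurableSet_Ioo

theorem exists_bound_of_continuousOn_Icc {E : Type*} [NormedAddCommGroup E] {y : ℝ → E} {a b : ℝ}
    (h : ContinuousOn y (Icc a b)) : ∃ M, 0 ≤ M ∧ ∀ t ∈ Icc a b, ‖y t‖ ≤ M := by
  obtain ⟨M, hM⟩ := isCompact_Icc.exists_bound_of_continuousOn h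
  exact ⟨max 0 M, le_max_left _ _, fun t ht => le_max_of_le_right (hM t ht)⟩

variable {D}

theorem noise_aesm (hω : SmoothPath T ω) (hG : Continuous G) (hu : ContinuousOn u (Icc 0 T)) :
    AEStronglyMeasurable (fun r => (G (u r)).op (deriv ω r)) (volume.restrict (Ioo 0 T)) :=
  (HSOp.opL V (D.Vd δ)).aestronglyMeasurable_comp₂
    (aesm_of_continuousOn_Icc (hG.comp_continuousOn hu)) hω.aesm_deriv

theorem noise_bound (hω : SmoothPath T ω) (hG : Continuous G) (hu : ContinuousOn u (Icc 0 T)) :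
    ∃ M, 0 ≤ M ∧ ∀ r ∈ Ioo 0 T, ‖(G (u r)).op (deriv ω r)‖ ≤ M := by
  obtain ⟨M, hM0, hM⟩ := hω.exists_bound
  obtain ⟨M', hM0', hM'⟩ := exists_bound_of_continuousOn_Icc (hG.comp_continuousOn hu)
  refine ⟨M' * M, by positivity, fun r hr => ((G (u r)).norm_apply_le _).trans ?_⟩
  have h1 := hM r hr
  have h2 : ‖G (u r)‖ ≤ M' := hM' r (Ioo_subset_Icc_self hr)
  gcongr

theorem incl_noise_aesm (hω : SmoothPath T ω) (hG : Continuous G) (hu : ContinuousOn u (Icc 0 T)) :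
    AEStronglyMeasurable (fun r => EigenData.Vd.incl D δ ((G (u r)).op (deriv ω r)))
      (volume.restrict (Ioo 0 T)) :=
  (EigenData.Vd.incl D δ).continuous.comp_aestronglyMeasurable (noise_aesm hω hG hu)

theorem incl_noise_bound (hω : SmoothPath T ω) (hG : Continuous G) (hu : ContinuousOn u (Icc 0 T)) :
    ∃ M, 0 ≤ M ∧ ∀ r ∈ Ioo 0 T, ‖EigenData.Vd.incl D δ ((G (u r)).op (deriv ω r))‖ ≤ M := by
  obtain ⟨M, hM0, hM⟩ := noise_bound hω hG hu
  exact ⟨‖EigenData.Vd.incl D δ‖ * M, by positivity, fun r hr =>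
    (EigenData.Vd.incl D δ).le_opNorm_of_le (hM r hr)⟩

/-- A mild solution restarted at time `s`. -/
theorem IsMildSolution.eq_restart (hu : IsMildSolution D δ T ω F G u₀ u) (hω : SmoothPath T ω)
    (hF : Continuous F) (hG : Continuous G) {s t : ℝ} (hs : 0 ≤ s) (hst : s ≤ t) (ht : t ≤ T) :
    u t = D.S (t - s) (u s) + (∫ r in s..t, D.S (t - r) (F (u r)))
      + ∫ r in s..t, D.S (t - r) (EigenData.Vd.incl D δ ((G (u r)).op (deriv ω r))) := by
  obtain ⟨M1, -, hM1⟩ := exists_bound_of_continuousOn_Icc (hF.comp_continuousOn hu.1)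
  obtain ⟨M2, -, hM2⟩ := incl_noise_bound hω hG hu.1
  have e1 := D.conv_split hs hst ht (aesm_of_continuousOn_Icc (hF.comp_continuousOn hu.1))
    fun r hr => hM1 r (Ioo_subset_Icc_self hr)
  have e2 := D.conv_split hs hst ht (incl_noise_aesm hω hG hu.1) hM2
  have e3 := D.S_add (sub_nonneg.2 hst) hs
  rw [sub_add_cancel] at e3
  simp only [Function.comp_apply] at e1
  rw [hu.2 t ⟨hs.trans hst, ht⟩, hu.2 s ⟨hs, hst.trans ht⟩, e1, e2, e3]
  simp only [map_add, ContinuousLinearMap.comp_apply]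
  abel

/-- Only the orbit of the initial value needs the weight at time zero; the two convolutions have
bounded integrands and are Hölder up to zero. -/
theorem IsMildSolution.holder (hu : IsMildSolution D δ T ω F G u₀ u) (hω : SmoothPath T ω)
    (hF : Continuous F) (hG : Continuous G) (hT : 0 < T) {γ : ℝ} (hγ0 : 0 < γ) (hγ1 : γ < 1) :
    WHolder γ 0 T u := by
  obtain ⟨M1, -, hM1⟩ := exists_bound_of_continuousOn_Icc (hF.comp_continuousOn hu.1)
  obtain ⟨M2, -, hM2⟩ := incl_noise_bound hω hG hu.1
  have h1 := D.holder_orbit hγ0.le hγ1.le (EigenData.Vd.incl D δ u₀) T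
  have h2 := D.holder_conv_left (ContinuousLinearMap.id ℝ (V →L[ℝ] V)) hT hγ0 hγ1
    (aesm_of_continuousOn_Icc (hF.comp_continuousOn hu.1)) fun r hr => hM1 r (Ioo_subset_Icc_self hr)
  have h3 := D.holder_conv_left (ContinuousLinearMap.id ℝ (V →L[ℝ] V)) hT hγ0 hγ1
    (incl_noise_aesm hω hG hu.1) hM2
  exact ((h1.add h2).add h3).congr fun r hr => (hu.2 r (Ioo_subset_Icc_self hr)).symm

end MildSolution

/-! ### Bilinear operations on Hilbert--Schmidt operators -/

section HilbertSchmidtBounds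

variable {H K L : Type*} [NormedAddCommGroup H] [InnerProductSpace ℝ H] [CompleteSpace H]
  [NormedAddCommGroup K] [InnerProductSpace ℝ K]
  [NormedAddCommGroup L] [InnerProductSpace ℝ L] [CompleteSpace L]

/-- The finite Hilbert--Schmidt sums of `T` are bounded by `C ^ 2`. -/
def HSBound (T : H →L[ℝ] K) (C : ℝ) : Prop :=
  ∀ s : Finset (hsIndex H), ∑ i ∈ s, ‖T (hsBasis H i)‖ ^ 2 ≤ C ^ 2

theorem HSBound.isHS {T : H →L[ℝ] K} {C : ℝ} (h : HSBound T C) : IsHS T :=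
  summable_of_sum_le (fun _ => by positivity) h

theorem HSBound.neg {T : H →L[ℝ] K} {C : ℝ} (h : HSBound T C) : HSBound (-T) C := fun s => by
  simpa using h s

theorem HSBound.mono {T : H →L[ℝ] K} {C C' : ℝ} (h : HSBound T C) (hC : 0 ≤ C) (hCC : C ≤ C') :
    HSBound T C' := fun s => (h s).trans (by gcongr)

theorem HSBound.comp_left {K' : Type*} [NormedAddCommGroup K'] [InnerProductSpace ℝ K']
    {T : H →L[ℝ] K} {C c : ℝ} (h : HSBound T C) (A : K →L[ℝ] K') (hA : ‖A‖ ≤ c) :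
    HSBound (A ∘L T) (c * C) := by
  intro s
  rw [mul_pow]
  refine le_trans ?_ (mul_le_mul_of_nonneg_left (h s) (by positivity))
  rw [Finset.mul_sum]
  refine Finset.sum_le_sum fun i _ => ?_
  rw [← mul_pow]
  have := A.le_of_opNorm_le hA (T (hsBasis H i))
  rw [ContinuousLinearMap.comp_apply]
  gcongr

/-- Each finite Hilbert–Schmidt sum is the squared norm of a bounded linear map into a finite
Hilbert sum, so the integral triangle inequality applies to it. No measurability in Hilbert–Schmidt
norm is needed; if the operator-valued integrand is not integrable, the integral is zero by
convention. -/
theorem HSBound.integral [CompleteSpace K] {a b : ℝ} (hab : a ≤ b) {f : ℝ → H →L[ℝ] K} {g : ℝ → ℝ}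
    (hg : IntervalIntegrable g volume a b) (hg0 : ∀ x ∈ Ioo a b, 0 ≤ g x)
    (h : ∀ x ∈ Ioo a b, HSBound (f x) (g x)) : HSBound (∫ x in a..b, f x) (∫ x in a..b, g x) := by
  intro s
  by_cases hf : IntervalIntegrable f volume a b
  · let Φ : (H →L[ℝ] K) →L[ℝ] PiLp 2 fun _ : s => K :=
      ((PiLp.continuousLinearEquiv 2 ℝ fun _ : s => K).symm :
        (s → K) →L[ℝ] PiLp 2 fun _ : s => K) ∘L
        ContinuousLinearMap.pi fun i => ContinuousLinearMap.apply ℝ K (hsBasis H i)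
    have hΦ : ∀ A : H →L[ℝ] K, ‖Φ A‖ ^ 2 = ∑ i ∈ s, ‖A (hsBasis H i)‖ ^ 2 := by
      intro A
      rw [PiLp.norm_sq_eq_of_L2, ← Finset.sum_coe_sort s]
      rfl
    rw [← hΦ, ← ContinuousLinearMap.intervalIntegral_comp_comm Φ hf]
    have h1 : ‖∫ x in a..b, Φ (f x)‖ ≤ ∫ x in a..b, g x := by
      refine norm_integral_Ioo_le hab hg fun x hx => ?_
      refine le_of_sq_le_sq ?_ (hg0 x hx)
      rw [hΦ]
      exact h x hx s
    gcongr
  · rw [intervalIntegral.integral_undef hf]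
    simpa using sq_nonneg _

/-- A criterion for the Hilbert--Schmidt property in terms of the coordinates of the image. -/
theorem HSBound.of_coords [CompleteSpace K] {ν : Type*} (d : HilbertBasis ν ℝ K) {T : H →L[ℝ] K}
    {c : ν → ℝ} {C : ℝ} (hc : Summable fun k => c k ^ 2) (hC : ∑' k, c k ^ 2 ≤ C ^ 2)
    (hc0 : ∀ k, 0 ≤ c k) (h : ∀ k y, |inner ℝ (d k) (T y)| ≤ c k * ‖y‖) : HSBound T C := by
  -- The sum is computed on the adjoint: the coordinate bound at y = T* d_k gives ‖T* d_k‖ ≤ c_k.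
  have h1 : ∑' i, ((‖T (hsBasis H i)‖₊ ^ 2 : ℝ≥0) : ℝ≥0∞) ≤ ENNReal.ofReal (C ^ 2) := by
    rw [tsum_sq_eq_adjoint _ d]
    refine le_trans ?_ (ENNReal.ofReal_le_ofReal hC)
    rw [ENNReal.ofReal_tsum_of_nonneg (fun _ => by positivity) hc]
    refine ENNReal.tsum_le_tsum fun k => ?_
    rw [← ENNReal.ofReal_coe_nnreal]
    refine ENNReal.ofReal_le_ofReal ?_
    push_cast
    have hk : ‖ContinuousLinearMap.adjoint T (d k)‖ ≤ c k := by
      set z := ContinuousLinearMap.adjoint T (d k) with hz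
      have h2 := h k z
      rw [← ContinuousLinearMap.adjoint_inner_left, ← hz, real_inner_self_eq_norm_sq,
        abs_of_nonneg (by positivity)] at h2
      rcases (norm_nonneg z).eq_or_lt with h3 | h3
      · rw [← h3]
        exact hc0 k
      · nlinarith
    gcongr
  intro s
  have h2 := (ENNReal.sum_le_tsum s).trans h1
  rw [← ENNReal.ofReal_le_ofReal_iff (sq_nonneg _), ENNReal.ofReal_sum_of_nonneg
    (fun _ _ => by positivity)]
  refine le_trans (le_of_eq ?_) h2
  refine Finset.sum_congr rfl fun i _ => ?_
  rw [← ENNReal.ofReal_coe_nnreal]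
  push_cast
  rfl

end HilbertSchmidtBounds

namespace HSOp

variable {H K L : Type*} [NormedAddCommGroup H] [InnerProductSpace ℝ H] [CompleteSpace H]
  [NormedAddCommGroup K] [InnerProductSpace ℝ K] [CompleteSpace K]
  [NormedAddCommGroup L] [InnerProductSpace ℝ L] [CompleteSpace L]

theorem ofReal_norm_sq (T : HSOp H K) :
    ENNReal.ofReal (‖T‖ ^ 2) = ∑' i, ((‖T.op (hsBasis H i)‖₊ ^ 2 : ℝ≥0) : ℝ≥0∞) := by
  rw [norm_sq_eq, ENNReal.ofReal_tsum_of_nonneg (fun _ => by positivity) T.op_isHS]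
  refine tsum_congr fun i => ?_
  rw [← ENNReal.ofReal_coe_nnreal]
  push_cast
  rfl

theorem norm_comp_le (T : HSOp H K) (B : L →L[ℝ] H) : ‖T.comp B‖ ≤ ‖T‖ * ‖B‖ := by
  refine le_of_sq_le_sq ?_ (by positivity)
  rw [← ENNReal.ofReal_le_ofReal_iff (sq_nonneg _), mul_pow, ENNReal.ofReal_mul (sq_nonneg _),
    ofReal_norm_sq, ofReal_norm_sq, tsum_sq_eq_adjoint _ (hsBasis K),
    tsum_sq_eq_adjoint (K := K) _ (hsBasis K), ← ENNReal.tsum_mul_right]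
  refine ENNReal.tsum_le_tsum fun k => ?_
  have h1 : ‖ContinuousLinearMap.adjoint (T.comp B).op (hsBasis K k)‖
      ≤ ‖B‖ * ‖ContinuousLinearMap.adjoint T.op (hsBasis K k)‖ := by
    rw [comp, op_mk, ContinuousLinearMap.adjoint_comp, ContinuousLinearMap.comp_apply]
    refine (ContinuousLinearMap.le_opNorm _ _).trans_eq ?_
    rw [LinearIsometryEquiv.norm_map]
  rw [← ENNReal.ofReal_coe_nnreal, ← ENNReal.ofReal_coe_nnreal,
    ← ENNReal.ofReal_mul (NNReal.coe_nonneg _)]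
  refine ENNReal.ofReal_le_ofReal ?_
  push_cast
  calc _ ≤ (‖B‖ * ‖ContinuousLinearMap.adjoint T.op (hsBasis K k)‖) ^ 2 := by gcongr
    _ = _ := by ring

variable (H K L)

/-- Composition `(B, T) ↦ T ∘ B` as a bounded bilinear map. -/
def compL : (L →L[ℝ] H) →L[ℝ] HSOp H K →L[ℝ] HSOp L K :=
  LinearMap.mkContinuous₂ (LinearMap.mk₂ ℝ (fun B T => T.comp B)
    (fun B B' T => op_injective (T.op.comp_add B B'))
    (fun c B T => op_injective (T.op.comp_smul c B))
    (fun B T T' => op_injective (ContinuousLinearMap.add_comp T.op T'.op B))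
    (fun c B T => op_injective (ContinuousLinearMap.smul_comp c T.op B))) 1
    fun B T => by
      rw [one_mul, mul_comm]
      exact norm_comp_le T B

variable {H K L}

variable (H K)

/-- Evaluation `x ↦ (T ↦ T x)` as a bounded linear map. -/
def evalCLM : H →L[ℝ] HSOp H K →L[ℝ] K := (opL H K).flip

variable {H K}

end HSOp

namespace EigenData

variable {V : Type*} [NormedAddCommGroup V] [InnerProductSpace ℝ V] [CompleteSpace V]
  (D : EigenData V) (δ : ℝ≥0)

/-- The i-th coordinate of S(τ) T x is at most e^(-λτ) λ^(-δ) ‖T‖ ‖x‖ with λ = λᵢ, and e^(-2λτ) ≤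
(λτ)⁻¹. The squares sum to at most τ⁻¹ ‖x‖² ∑ λᵢ^(-1-2δ). Here the summability assumption enters,
and τ^(-1/2) is integrable at zero. -/
theorem hsBound_S_incl_evalL (hsum : Summable fun i => D.lam i ^ (-(1 + 2 * (δ : ℝ)))) :
    ∃ C, 0 ≤ C ∧ ∀ {H : Type _} [NormedAddCommGroup H] [InnerProductSpace ℝ H] [CompleteSpace H]
      (τ : ℝ) (x : H) (M : ℝ), 0 < τ → ‖x‖ ≤ M →
      HSBound (D.S τ ∘L Vd.incl D δ ∘L (HSOp.evalL x : HSOp H (D.Vd δ) →L[ℝ] D.Vd δ))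
        (M * (C * τ ^ (-(1 / 2 : ℝ)))) := by
  refine ⟨Real.sqrt (∑' i, D.lam i ^ (-(1 + 2 * (δ : ℝ)))), Real.sqrt_nonneg _, ?_⟩
  intro H _ _ _ τ x M hτ hx
  have hM : 0 ≤ M := (norm_nonneg _).trans hx
  have hle : ∀ i, (M * (Real.exp (-(D.lam i * τ)) * D.lam i ^ (-(δ : ℝ)))) ^ 2
      ≤ M ^ 2 * τ⁻¹ * D.lam i ^ (-(1 + 2 * (δ : ℝ))) := by
    intro i
    have hl := D.lam_pos i
    have h1 : Real.exp (-(D.lam i * τ)) ^ 2 ≤ τ⁻¹ * D.lam i ^ (-1 : ℝ) := by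
      have h2 := rpow_mul_exp_neg_le (mul_pos hl hτ).le le_rfl zero_le_one
      rw [Real.rpow_one] at h2
      have h3 : Real.exp (-(D.lam i * τ)) ≤ 1 := Real.exp_le_one_iff.2 (by
        have := mul_pos hl hτ
        linarith)
      have h4 := Real.exp_pos (-(D.lam i * τ))
      rw [Real.rpow_neg_one, ← mul_inv, ← one_div, le_div_iff₀ (by positivity)]
      nlinarith [mul_pos hl hτ]
    have e : D.lam i ^ (-(1 + 2 * (δ : ℝ))) = D.lam i ^ (-1 : ℝ) * (D.lam i ^ (-(δ : ℝ))) ^ 2 := by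
      rw [sq, ← Real.rpow_add hl, ← Real.rpow_add hl]
      ring_nf
    rw [e, mul_pow, mul_pow]
    have := sq_nonneg (D.lam i ^ (-(δ : ℝ)))
    calc _ ≤ M ^ 2 * (τ⁻¹ * D.lam i ^ (-1 : ℝ) * (D.lam i ^ (-(δ : ℝ))) ^ 2) := by gcongr
      _ = _ := by ring
  have hs' : Summable fun i => M ^ 2 * τ⁻¹ * D.lam i ^ (-(1 + 2 * (δ : ℝ))) := hsum.mul_left _
  have hs := Summable.of_nonneg_of_le (fun _ => sq_nonneg _) hle hs'
  refine HSBound.of_coords D.e (c := fun i => M * (Real.exp (-(D.lam i * τ)) * D.lam i ^ (-(δ : ℝ))))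
    hs ?_ (fun i => ?_) fun i y => ?_
  · refine (hs.tsum_le_tsum hle hs').trans_eq ?_
    rw [tsum_mul_left, mul_pow, mul_pow, Real.sq_sqrt (tsum_nonneg fun i =>
      Real.rpow_nonneg (D.lam_pos i).le _), ← Real.rpow_natCast (τ ^ _), ← Real.rpow_mul hτ.le]
    norm_num [Real.rpow_neg_one]
    ring
  · have := Real.rpow_nonneg (D.lam_pos i).le (-(δ : ℝ))
    positivity
  · have h0 := Real.rpow_nonneg (D.lam_pos i).le (-(δ : ℝ))
    rw [← HilbertBasis.repr_apply_apply, ContinuousLinearMap.comp_apply,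
      ContinuousLinearMap.comp_apply, repr_S, HilbertBasis.repr_apply_apply, Vd.incl_apply,
      Vd.inner_eq, HSOp.evalL_apply, max_eq_left hτ.le, abs_mul, abs_mul, Real.abs_exp,
      abs_of_nonneg h0]
    have h1 : |Vd.toLp D δ (y.op x) i| ≤ ‖y.op x‖ :=
      lp.norm_apply_le_norm (by norm_num) (Vd.toLp D δ (y.op x)) i
    have h2 := y.norm_apply_le x
    calc _ ≤ Real.exp (-(D.lam i * τ)) * (D.lam i ^ (-(δ : ℝ)) * (‖y‖ * M)) := by
          gcongr
          exact h1.trans (h2.trans (by gcongr))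
      _ = _ := by ring

end EigenData

/-! ### Tensors over a general bilinear map, and their Fubini identities -/

section TensorIdentities

variable {V W U A A₂ : Type*} [NormedAddCommGroup V] [InnerProductSpace ℝ V]
  [NormedAddCommGroup W] [NormedSpace ℝ W] [NormedAddCommGroup U] [NormedSpace ℝ U]
  [NormedAddCommGroup A] [NormedSpace ℝ A] [NormedAddCommGroup A₂] [NormedSpace ℝ A₂]
  (β : V →L[ℝ] V →L[ℝ] W)

/-- The bilinear map `(Q, w) ↦ (x ↦ β(Q x, w))`. -/
def tensOp : (V →L[ℝ] V) →L[ℝ] V →L[ℝ] (V →L[ℝ] W) :=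
  ((ContinuousLinearMap.compL ℝ V V W) ∘L β.flip).flip

variable (D : EigenData V) (ι : U →L[ℝ] V) (ev : V →L[ℝ] A →L[ℝ] U) (ev₂ : W →L[ℝ] A₂ →L[ℝ] U)

/-- The bilinear map `(Q, x) ↦ (T ↦ Q (T x))`. -/
def noiseOp : (V →L[ℝ] V) →L[ℝ] V →L[ℝ] (A →L[ℝ] V) :=
  ((ContinuousLinearMap.compL ℝ A U V).flip ∘L ev).flip ∘L
    (ContinuousLinearMap.compL ℝ U V V).flip ι

/-! The tensors of the statement for a bounded bilinear map `β` in place of the tensor product, a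
space `U` in place of `V_δ`, and spaces `A`, `A₂` of operators in place of the spaces of
Hilbert--Schmidt operators, on which evaluation is given by the bilinear maps `ev`, `ev₂`. -/

/-- `β`-version of `area`. -/
def genArea (u ω : ℝ → V) (s t : ℝ) : W := ∫ τ in s..t, β (u τ - u s) (deriv ω τ)

/-- `β`-version of `omS`. -/
def genOmS (ω : ℝ → V) (s t : ℝ) : U →L[ℝ] W :=
  ∫ ξ in s..t, β.flip (deriv ω ξ) ∘L D.S (ξ - s) ∘L ι

/-- `β`-version of `omSom`. -/
def genOmSom (ω : ℝ → V) (s t : ℝ) : A →L[ℝ] W :=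
  ∫ ξ in s..t, β.flip (deriv ω ξ) ∘L ∫ r in s..ξ, D.S (ξ - r) ∘L ι ∘L ev (deriv ω r)

/-- `β`-version of `uomSom`. -/
def genUomSom (u ω : ℝ → V) (t s r : ℝ) : A₂ →L[ℝ] W :=
  -∫ q in s..r, ∫ ξ in q..t, β.flip (deriv ω ξ) ∘L D.S (ξ - q) ∘L ι ∘L
    ev₂ (β (u q - u s) (deriv ω q))

/-- `β`-version of `omStensOm`. -/
def genOmStensOm (ω : ℝ → V) (t s τ : ℝ) : A →L[ℝ] W :=
  ∫ r in s..τ, (genOmS β D ι ω r t - genOmS β D ι ω s t) ∘L ev (deriv ω r)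

/-- `β`-version of `fE`. -/
def genFE (c : (V →L[ℝ] W) →L[ℝ] A₂ →L[ℝ] A) (E : A₂) (p : (U →L[ℝ] W) × V) : V →L[ℝ] W :=
  p.1 ∘L ev.flip (c (β p.2) E)

/-- `x ↦ ∫_s^t β(S(ξ - s) x, ω'(ξ)) dξ` on all of `V`. -/
def omV (ω : ℝ → V) (s t : ℝ) : V →L[ℝ] W :=
  ∫ ξ in s..t, tensOp β (D.S (ξ - s)) (deriv ω ξ)

variable [CompleteSpace V] [CompleteSpace W] {β D ι ev ev₂} {T : ℝ} {ω : ℝ → V} {s t : ℝ}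

theorem SmoothPath.aesm_Ioo (hω : SmoothPath T ω) (hs : 0 ≤ s) (ht : t ≤ T) :
    AEStronglyMeasurable (deriv ω) (volume.restrict (Ioo s t)) :=
  aesm_Ioo_mono hω.aesm_deriv hs ht

theorem SmoothPath.tensOp_integrable (hω : SmoothPath T ω) (hs : 0 ≤ s) (hst : s ≤ t) (ht : t ≤ T)
    (a : ℝ) : IntervalIntegrable (fun ξ => tensOp β (D.S (ξ - a)) (deriv ω ξ)) volume s t := by
  obtain ⟨M, -, hM⟩ := hω.exists_bound
  exact D.intervalIntegrable_conv_right (tensOp β) hst (hω.aesm_Ioo hs ht)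
    (fun r hr => hM r ⟨hs.trans_lt hr.1, hr.2.trans_le ht⟩) a

theorem norm_tensOp_S_le {M : ℝ} (τ : ℝ) {w : V} (hw : ‖w‖ ≤ M) :
    ‖tensOp β (D.S τ) w‖ ≤ ‖β.flip‖ * M := by
  refine (ContinuousLinearMap.opNorm_comp_le (β.flip w) (D.S τ)).trans ?_
  have h1 := β.flip.le_opNorm_of_le hw
  have h2 := D.norm_S_le τ
  calc _ ≤ ‖β.flip‖ * M * 1 := mul_le_mul h1 h2 (norm_nonneg _) ((norm_nonneg _).trans h1)
    _ = _ := mul_one _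

/-- The inclusion factors out of the integral, leaving an operator on all of V, where the semigroup
acts. -/
theorem genOmS_eq (hω : SmoothPath T ω) (hs : 0 ≤ s) (hst : s ≤ t) (ht : t ≤ T) :
    genOmS β D ι ω s t = omV β D ω s t ∘L ι :=
  ContinuousLinearMap.intervalIntegral_comp_comm
    ((ContinuousLinearMap.compL ℝ U V W).flip (ι))
    (hω.tensOp_integrable hs hst ht s)

/-- For ξ > τ the semigroup law gives S(ξ - s) = S(ξ - τ) S(τ - s), and the second factor does not
depend on ξ. -/
theorem omV_split (hω : SmoothPath T ω) {τ : ℝ} (hs : 0 ≤ s) (hsτ : s ≤ τ) (hτt : τ ≤ t)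
    (ht : t ≤ T) : omV β D ω s t = omV β D ω s τ + omV β D ω τ t ∘L D.S (τ - s) := by
  have e : ∫ ξ in τ..t, tensOp β (D.S (ξ - s)) (deriv ω ξ) = omV β D ω τ t ∘L D.S (τ - s) := by
    rw [omV]
    refine (integral_congr_Ioo hτt fun ξ hξ => ?_).trans
      (ContinuousLinearMap.intervalIntegral_comp_comm
        ((ContinuousLinearMap.compL ℝ V V W).flip (D.S (τ - s)))
        (hω.tensOp_integrable (hs.trans hsτ) hτt ht τ))
    have h := D.S_add (s := ξ - τ) (t := τ - s) (by linarith [hξ.1]) (by linarith)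
    rw [sub_add_sub_cancel] at h
    rw [h]
    rfl
  rw [← e, omV, omV, intervalIntegral.integral_add_adjacent_intervals
    (hω.tensOp_integrable hs hsτ (hτt.trans ht) s)
    (hω.tensOp_integrable (hs.trans hsτ) hτt ht s)]

theorem omV_holder (hω : SmoothPath T ω) (hs : 0 ≤ s) (hst : s < t) (ht : t ≤ T) {γ : ℝ}
    (hγ0 : 0 < γ) (hγ1 : γ < 1) : WHolder γ s t fun r => omV β D ω r t := by
  obtain ⟨M, -, hM⟩ := hω.exists_bound
  exact D.holder_conv_right (tensOp β) hst hγ0 hγ1 (hω.aesm_Ioo hs ht)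
    fun r hr => hM r ⟨hs.trans_lt hr.1, hr.2.trans_le ht⟩

theorem genOmS_holder (hω : SmoothPath T ω) {q : ℝ} (hs : 0 ≤ s) (hsq : s < q) (hqt : q ≤ t)
    (ht : t ≤ T) {γ : ℝ} (hγ0 : 0 < γ) (hγ1 : γ < 1) : WHolder γ s q fun r => genOmS β D ι ω r t :=
  ((((omV_holder hω hs (hsq.trans_le hqt) ht hγ0 hγ1).clm_comp
    ((ContinuousLinearMap.compL ℝ U V W).flip (ι))).congr
      fun _ hr => (genOmS_eq hω (hs.trans hr.1.le) hr.2.le ht).symm)).mono hqt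

/-- The evaluated kernel `genOmS (r, t) ∘ e (z r)` of the tensors. -/
theorem genOmS_eval_aesm {H B : Type*} [NormedAddCommGroup H] [NormedSpace ℝ H]
    [NormedAddCommGroup B] [NormedSpace ℝ B] (e : H →L[ℝ] B →L[ℝ] U)
    (hω : SmoothPath T ω) {q : ℝ} (hs : 0 ≤ s) (hsq : s ≤ q) (hqt : q ≤ t)
    (ht : t ≤ T) {z : ℝ → H} (hz : AEStronglyMeasurable z (volume.restrict (Ioo s q))) :
    AEStronglyMeasurable (fun r => genOmS β D ι ω r t ∘L e (z r)) (volume.restrict (Ioo s q)) := by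
  rcases hsq.eq_or_lt with rfl | hsq
  · simp
  exact (ContinuousLinearMap.compL ℝ B U W).aestronglyMeasurable_comp₂
    (genOmS_holder hω hs hsq hqt ht (γ := 1 / 2) (by norm_num) (by norm_num)).aesm
    (e.continuous.comp_aestronglyMeasurable hz)

theorem genOmS_eval_bound {H B : Type*} [NormedAddCommGroup H] [NormedSpace ℝ H]
    [NormedAddCommGroup B] [NormedSpace ℝ B] (e : H →L[ℝ] B →L[ℝ] U)
    (hω : SmoothPath T ω) {q : ℝ} (hs : 0 ≤ s) (hqt : q ≤ t)
    (ht : t ≤ T) {z : ℝ → H} {M : ℝ} (hM : ∀ r ∈ Ioo s q, ‖z r‖ ≤ M) :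
    ∃ C, ∀ r ∈ Ioo s q, ‖genOmS β D ι ω r t ∘L e (z r)‖ ≤ C := by
  rcases le_or_gt q s with hsq | hsq
  · exact ⟨0, fun r hr => absurd (hr.1.trans hr.2) hsq.not_gt⟩
  obtain ⟨C, hC0, hC⟩ := (genOmS_holder (β := β) (D := D) (ι := ι) hω hs hsq hqt ht (γ := 1 / 2)
    (by norm_num) (by norm_num)).bdd
  refine ⟨C * (‖e‖ * M), fun r hr => (ContinuousLinearMap.opNorm_comp_le _ _).trans ?_⟩
  have h1 := hC r hr
  have h2 := e.le_opNorm_of_le (hM r hr)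
  gcongr

theorem genOmS_eval_integrable {H B : Type*} [NormedAddCommGroup H] [NormedSpace ℝ H]
    [NormedAddCommGroup B] [NormedSpace ℝ B] (e : H →L[ℝ] B →L[ℝ] U)
    (hω : SmoothPath T ω) {q : ℝ} (hs : 0 ≤ s) (hsq : s ≤ q) (hqt : q ≤ t)
    (ht : t ≤ T) {z : ℝ → H} (hz : AEStronglyMeasurable z (volume.restrict (Ioo s q))) {M : ℝ}
    (hM : ∀ r ∈ Ioo s q, ‖z r‖ ≤ M) :
    IntervalIntegrable (fun r => genOmS β D ι ω r t ∘L e (z r)) volume s q := by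
  obtain ⟨C, hC⟩ := genOmS_eval_bound (β := β) (D := D) (ι := ι) e hω hs hqt ht hM
  exact intervalIntegrable_of_const hsq (genOmS_eval_aesm e hω hs hsq hqt ht hz) hC

theorem SmoothPath.bound_Ioo {M : ℝ} (hM : ∀ r ∈ Ioo 0 T, ‖deriv ω r‖ ≤ M) (hs : 0 ≤ s)
    (ht : t ≤ T) : ∀ r ∈ Ioo s t, ‖deriv ω r‖ ≤ M :=
  fun r hr => hM r ⟨hs.trans_lt hr.1, hr.2.trans_le ht⟩

/-- Exchanging the two time integrals makes the inner one ω_S(r, t), which exhibits the tensor as a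
primitive in its lower time. -/
theorem genOmSom_eq (hω : SmoothPath T ω) (hs : 0 ≤ s) (hst : s ≤ t) (ht : t ≤ T) :
    genOmSom β D ι ev ω s t = ∫ r in s..t, genOmS β D ι ω r t ∘L ev (deriv ω r) := by
  obtain ⟨M, hM0, hM'⟩ := hω.exists_bound
  have hM := SmoothPath.bound_Ioo hM' hs ht
  have hw := hω.aesm_Ioo hs ht
  let f : ℝ → ℝ → A →L[ℝ] W := fun r ξ =>
    tensOp β (D.S (ξ - r)) (deriv ω ξ) ∘L ι ∘L ev (deriv ω r)
  have hf : IntegrableOn (fun p : ℝ × ℝ => f p.1 p.2) (tri s t) := by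
    refine tri_integrable_const (C := ‖β.flip‖ * M * (‖ι‖ * (‖ev‖ * M))) ?_ ?_
    · exact (ContinuousLinearMap.compL ℝ A V W).aestronglyMeasurable_comp₂
        ((tensOp β).aestronglyMeasurable_comp₂ D.aesm_S_tri (aesm_tri_snd hw))
        (((ContinuousLinearMap.compL ℝ A U V ι) ∘L ev).continuous.comp_aestronglyMeasurable
          (aesm_tri_fst hw))
    · intro r ξ hr hrξ hξ
      have h1 := norm_tensOp_S_le (β := β) (D := D) (ξ - r) (hM ξ ⟨hr.trans hrξ, hξ⟩)
      have h2 := ev.le_opNorm_of_le (hM r ⟨hr, hrξ.trans hξ⟩)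
      refine (ContinuousLinearMap.opNorm_comp_le _ _).trans ?_
      refine mul_le_mul h1 ((ContinuousLinearMap.opNorm_comp_le _ _).trans ?_) (norm_nonneg _)
        (by positivity)
      gcongr
  have hfub := (tri_fubini hst hf).2.2
  have e1 : ∀ ξ ∈ Ioo s t, ∫ r in s..ξ, f r ξ = β.flip (deriv ω ξ) ∘L
      ∫ r in s..ξ, D.S (ξ - r) ∘L ι ∘L ev (deriv ω r) := by
    intro ξ hξ
    exact ContinuousLinearMap.intervalIntegral_comp_comm
      (ContinuousLinearMap.compL ℝ A V W (β.flip (deriv ω ξ)))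
      (D.intervalIntegrable_conv_left (noiseOp ι ev) hξ.1.le (aesm_Ioo_mono hw le_rfl hξ.2.le)
        (fun r hr => hM r ⟨hr.1, hr.2.trans hξ.2⟩) ξ)
  have e2 : ∀ r ∈ Ioo s t, ∫ ξ in r..t, f r ξ = genOmS β D ι ω r t ∘L ev (deriv ω r) := by
    intro r hr
    rw [genOmS_eq hω (hs.trans hr.1.le) hr.2.le ht]
    exact ContinuousLinearMap.intervalIntegral_comp_comm
      ((ContinuousLinearMap.compL ℝ A V W).flip (ι ∘L ev (deriv ω r)))
      (hω.tensOp_integrable (hs.trans hr.1.le) hr.2.le ht r)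
  rw [genOmSom, ← integral_congr_Ioo hst e1, ← hfub, integral_congr_Ioo hst e2]

/-- This is the bounded density of (ω ⊗_S ω)(·, t) that feeds the right-sided derivative in the area
formula. -/
theorem genOmSom_sub (hω : SmoothPath T ω) {q r : ℝ} (hq : 0 ≤ q) (hqr : q ≤ r) (hrt : r ≤ t)
    (ht : t ≤ T) : genOmSom β D ι ev ω r t - genOmSom β D ι ev ω q t
      = ∫ ρ in q..r, -(genOmS β D ι ω ρ t ∘L ev (deriv ω ρ)) := by
  obtain ⟨M, -, hM⟩ := hω.exists_bound
  rw [genOmSom_eq hω hq (hqr.trans hrt) ht, genOmSom_eq hω (hq.trans hqr) hrt ht,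
    intervalIntegral.integral_neg, ← intervalIntegral.integral_add_adjacent_intervals
    (genOmS_eval_integrable ev hω hq hqr hrt ht (hω.aesm_Ioo hq (hrt.trans ht))
      (SmoothPath.bound_Ioo hM hq (hrt.trans ht)))
    (genOmS_eval_integrable ev hω (hq.trans hqr) hrt le_rfl ht (hω.aesm_Ioo (hq.trans hqr) ht)
      (SmoothPath.bound_Ioo hM (hq.trans hqr) ht))]
  abel

theorem genUomSom_eq (hω : SmoothPath T ω) (u : ℝ → V) {q : ℝ} (hs : 0 ≤ s) (hsq : s ≤ q)
    (hqt : q ≤ t) (ht : t ≤ T) : genUomSom β D ι ev₂ u ω t s q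
      = -∫ r in s..q, genOmS β D ι ω r t ∘L ev₂ (β (u r - u s) (deriv ω r)) := by
  rw [genUomSom]
  congr 1
  refine integral_congr_Ioo hsq fun r hr => ?_
  rw [genOmS_eq hω (hs.trans hr.1.le) (hr.2.le.trans hqt) ht]
  exact ContinuousLinearMap.intervalIntegral_comp_comm
    ((ContinuousLinearMap.compL ℝ A₂ V W).flip (ι ∘L ev₂ (β (u r - u s) (deriv ω r))))
    (hω.tensOp_integrable (hs.trans hr.1.le) (hr.2.le.trans hqt) ht r)

end TensorIdentities

/-! ### The tensors are Hilbert–Schmidt -/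

section HilbertSchmidtTensors

variable {V W : Type*} [NormedAddCommGroup V] [InnerProductSpace ℝ V] [CompleteSpace V]
  [NormedAddCommGroup W] [InnerProductSpace ℝ W] [CompleteSpace W] {β : V →L[ℝ] V →L[ℝ] W}
  {D : EigenData V} {δ : ℝ≥0} {T : ℝ} {ω : ℝ → V} {s t : ℝ}

/-- The inner integral has Hilbert–Schmidt bound of order ∫ (ξ - r)^(-1/2) dr, bounded uniformly in
ξ; composing with the bounded tensor with ω'(ξ) and integrating once more preserves the property. -/
theorem genOmSom_isHS (hsum : Summable fun i => D.lam i ^ (-(1 + 2 * (δ : ℝ))))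
    (hω : SmoothPath T ω) (hs : 0 ≤ s) (hst : s ≤ t) (ht : t ≤ T) :
    IsHS (genOmSom β D (EigenData.Vd.incl D δ) (HSOp.evalCLM V (D.Vd δ)) ω s t) := by
  obtain ⟨C, hC0, hC⟩ := D.hsBound_S_incl_evalL δ hsum
  obtain ⟨M, hM0, hM'⟩ := hω.exists_bound
  have hM := SmoothPath.bound_Ioo hM' hs ht
  have hin : ∀ ξ ∈ Ioo s t, HSBound (∫ r in s..ξ, D.S (ξ - r) ∘L EigenData.Vd.incl D δ ∘L
      HSOp.evalCLM V (D.Vd δ) (deriv ω r))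
      (M * (C * ((t - s) ^ (1 / 2 : ℝ) / (1 / 2)))) := by
    intro ξ hξ
    have h := HSBound.integral hξ.1.le (g := fun r => M * (C * (ξ - r) ^ (-(1 / 2 : ℝ))))
      (f := fun r => D.S (ξ - r) ∘L EigenData.Vd.incl D δ ∘L HSOp.evalCLM V (D.Vd δ) (deriv ω r))
      (((intervalIntegrable_rsub_rpow (by norm_num) s ξ ξ).const_mul C).const_mul M)
      (fun r hr => by have := Real.rpow_nonneg (sub_nonneg.2 hr.2.le) (-(1 / 2 : ℝ)); positivity)
      (fun r hr => hC (ξ - r) (deriv ω r) M (sub_pos.2 hr.2) (hM r ⟨hr.1, hr.2.trans hξ.2⟩))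
    rw [intervalIntegral.integral_const_mul, intervalIntegral.integral_const_mul,
      integral_rsub_rpow (by norm_num)] at h
    have h1 : 0 ≤ ξ - s := sub_nonneg.2 hξ.1.le
    have h2 : ξ - s ≤ t - s := by linarith [hξ.2]
    norm_num at h ⊢
    refine h.mono (by positivity) ?_
    gcongr
  refine HSBound.isHS (HSBound.integral hst (g := fun _ => ‖β.flip‖ * M *
    (M * (C * ((t - s) ^ (1 / 2 : ℝ) / (1 / 2))))) intervalIntegrable_const
    (fun r hr => ?_) fun ξ hξ => (hin ξ hξ).comp_left (β.flip (deriv ω ξ)) ?_)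
  · have := Real.rpow_nonneg (sub_nonneg.2 hst) (1 / 2 : ℝ)
    positivity
  · exact β.flip.le_opNorm_of_le (hM ξ hξ)

/-- As for `genOmSom_isHS`, except that the singularity (ξ - r)^(-1/2) is integrated in the later
time ξ. -/
theorem genUomSom_isHS (hsum : Summable fun i => D.lam i ^ (-(1 + 2 * (δ : ℝ))))
    (hω : SmoothPath T ω) {u : ℝ → V} (hu : ContinuousOn u (Icc 0 T)) {q : ℝ}
    (hs : 0 ≤ s) (hsq : s ≤ q) (hqt : q ≤ t) (ht : t ≤ T) :
    IsHS (genUomSom β D (EigenData.Vd.incl D δ) (HSOp.evalCLM W (D.Vd δ)) u ω t s q) := by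
  obtain ⟨C, hC0, hC⟩ := D.hsBound_S_incl_evalL δ hsum
  obtain ⟨M, hM0, hM'⟩ := hω.exists_bound
  have hM := SmoothPath.bound_Ioo hM' hs ht
  obtain ⟨M', hM'0, hu'⟩ := exists_bound_of_continuousOn_Icc hu
  obtain ⟨N, hN0, hz⟩ : ∃ N, 0 ≤ N ∧ ∀ r ∈ Ioo s q, ‖β (u r - u s) (deriv ω r)‖ ≤ N := by
    refine ⟨‖β‖ * (M' + M') * M, by positivity, fun r hr => (β.le_opNorm₂ _ _).trans ?_⟩
    have h1 := hM r ⟨hr.1, hr.2.trans_le hqt⟩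
    have h2 := (norm_sub_le (u r) (u s)).trans (add_le_add
      (hu' r ⟨hs.trans hr.1.le, hr.2.le.trans (hqt.trans ht)⟩) (hu' s ⟨hs, hsq.trans (hqt.trans ht)⟩))
    gcongr
  have hin : ∀ r ∈ Ioo s q, HSBound (∫ ξ in r..t, β.flip (deriv ω ξ) ∘L D.S (ξ - r) ∘L
      EigenData.Vd.incl D δ ∘L HSOp.evalCLM W (D.Vd δ) (β (u r - u s) (deriv ω r)))
      (‖β.flip‖ * M * (N * (C * ((t - s) ^ (1 / 2 : ℝ) / (1 / 2))))) := by
    intro r hr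
    have hrt : r ≤ t := hr.2.le.trans hqt
    have h := HSBound.integral hrt
      (g := fun ξ => ‖β.flip‖ * M * (N * (C * (ξ - r) ^ (-(1 / 2 : ℝ)))))
      (f := fun ξ => β.flip (deriv ω ξ) ∘L D.S (ξ - r) ∘L
        EigenData.Vd.incl D δ ∘L HSOp.evalCLM W (D.Vd δ) (β (u r - u s) (deriv ω r)))
      ((((intervalIntegrable_sub_rpow (by norm_num) r t r).const_mul C).const_mul N).const_mul _)
      (fun ξ hξ => by have := Real.rpow_nonneg (sub_nonneg.2 hξ.1.le) (-(1 / 2 : ℝ)); positivity)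
      (fun ξ hξ => (hC (ξ - r) _ N (sub_pos.2 hξ.1) (hz r hr)).comp_left (β.flip (deriv ω ξ))
        (β.flip.le_opNorm_of_le (hM ξ ⟨hr.1.trans hξ.1, hξ.2⟩)))
    rw [intervalIntegral.integral_const_mul, intervalIntegral.integral_const_mul,
      intervalIntegral.integral_const_mul, integral_sub_rpow (by norm_num)] at h
    have h1 : 0 ≤ t - r := sub_nonneg.2 hrt
    have h2 : t - r ≤ t - s := by linarith [hr.1]
    norm_num at h ⊢
    refine h.mono (by positivity) ?_
    gcongr
  refine HSBound.isHS (HSBound.neg (HSBound.integral hsq (g := fun _ => _) intervalIntegrable_const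
    (fun r hr => ?_) hin))
  have := Real.rpow_nonneg (sub_nonneg.2 (hsq.trans hqt)) (1 / 2 : ℝ)
  positivity

end HilbertSchmidtTensors

theorem IntervalIntegrable.clm_comp {E F : Type*} [NormedAddCommGroup E] [NormedSpace ℝ E]
    [NormedAddCommGroup F] [NormedSpace ℝ F] {f : ℝ → E} {a b : ℝ}
    (hf : IntervalIntegrable f volume a b) (L : E →L[ℝ] F) :
    IntervalIntegrable (fun x => L (f x)) volume a b :=
  ⟨L.integrable_comp hf.1, L.integrable_comp hf.2⟩

/-! ### The tensor ω_S(t) ⊗ ω, and the area of a path satisfying a mild equation -/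

section TensorFormulas

variable {V W U A : Type*} [NormedAddCommGroup V] [InnerProductSpace ℝ V] [CompleteSpace V]
  [NormedAddCommGroup W] [NormedSpace ℝ W] [CompleteSpace W]
  [NormedAddCommGroup U] [NormedSpace ℝ U]
  [NormedAddCommGroup A] [NormedSpace ℝ A]
  {β : V →L[ℝ] V →L[ℝ] W} {D : EigenData V} {ι : U →L[ℝ] V} {ev : V →L[ℝ] A →L[ℝ] U}
  {T : ℝ} {ω : ℝ → V} {s t : ℝ}

/-- Split ω_S(r, t) at τ: the part up to τ integrates to (ω ⊗_S ω)(s, τ) by `genOmSom_eq`, and in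
the rest the operator from τ to t leaves the integral. The frozen term ω_S(s, t) only sees ∫ ω' =
ω(τ) - ω(s). -/
theorem genOmStensOm_eq (hω : SmoothPath T ω) {τ : ℝ} (hs : 0 ≤ s) (hsτ : s ≤ τ) (hτt : τ ≤ t)
    (ht : t ≤ T) : genOmStensOm β D ι ev ω t s τ
      = omV β D ω τ t ∘L (∫ r in s..τ, D.S (τ - r) ∘L ι ∘L ev (deriv ω r))
        + genOmSom β D ι ev ω s τ - genOmS β D ι ω s t ∘L ev (ω τ - ω s) := by
  obtain ⟨M, -, hM'⟩ := hω.exists_bound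
  have hτT := hτt.trans ht
  have hM := SmoothPath.bound_Ioo hM' hs hτT
  have hw := hω.aesm_Ioo hs hτT
  have iw : IntervalIntegrable (deriv ω) volume s τ := intervalIntegrable_of_const hsτ hw hM
  have i1 := genOmS_eval_integrable (β := β) (D := D) (ι := ι) ev hω hs hsτ hτt ht hw hM
  have i2 := genOmS_eval_integrable (β := β) (D := D) (ι := ι) ev hω hs hsτ le_rfl hτT hw hM
  have i3 := D.intervalIntegrable_conv_left (noiseOp ι ev) hsτ hw hM τ
  have e1 : ∫ r in s..τ, genOmS β D ι ω s t ∘L ev (deriv ω r)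
      = genOmS β D ι ω s t ∘L ev (ω τ - ω s) := by
    rw [← hω.integral_deriv hs hsτ hτT]
    exact ContinuousLinearMap.intervalIntegral_comp_comm
      (ContinuousLinearMap.compL ℝ A U W (genOmS β D ι ω s t) ∘L ev) iw
  have i4 : IntervalIntegrable (fun r => genOmS β D ι ω s t ∘L ev (deriv ω r)) volume s τ :=
    iw.clm_comp (ContinuousLinearMap.compL ℝ A U W (genOmS β D ι ω s t) ∘L ev)
  have e2 : ∀ r ∈ Ioo s τ, genOmS β D ι ω r t ∘L ev (deriv ω r)
      = genOmS β D ι ω r τ ∘L ev (deriv ω r)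
        + omV β D ω τ t ∘L (D.S (τ - r) ∘L ι ∘L ev (deriv ω r)) := by
    intro r hr
    rw [genOmS_eq hω (hs.trans hr.1.le) (hr.2.le.trans hτt) ht,
      genOmS_eq hω (hs.trans hr.1.le) hr.2.le hτT,
      omV_split hω (hs.trans hr.1.le) hr.2.le hτt ht]
    rfl
  have i5 : IntervalIntegrable (fun r => omV β D ω τ t ∘L (D.S (τ - r) ∘L ι ∘L ev (deriv ω r)))
      volume s τ := i3.clm_comp (ContinuousLinearMap.compL ℝ A V W (omV β D ω τ t))
  have e3 : ∫ r in s..τ, omV β D ω τ t ∘L (D.S (τ - r) ∘L ι ∘L ev (deriv ω r))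
      = omV β D ω τ t ∘L (∫ r in s..τ, D.S (τ - r) ∘L ι ∘L ev (deriv ω r)) :=
    ContinuousLinearMap.intervalIntegral_comp_comm
      (ContinuousLinearMap.compL ℝ A V W (omV β D ω τ t)) i3
  have e4 : ∫ r in s..τ, (genOmS β D ι ω r t - genOmS β D ι ω s t) ∘L ev (deriv ω r)
      = (∫ r in s..τ, genOmS β D ι ω r t ∘L ev (deriv ω r))
        - ∫ r in s..τ, genOmS β D ι ω s t ∘L ev (deriv ω r) := by
    rw [← intervalIntegral.integral_sub i1 i4]
    rfl
  rw [genOmStensOm, e4, e1, integral_congr_Ioo hsτ e2, intervalIntegral.integral_add i2 i5, e3,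
    ← genOmSom_eq hω hs hsτ hτT]
  abel

/-- The convolution is an integral in V, whereas ω_S(τ, t) acts on U. A preimage `y` under the
inclusion bridges the two. -/
theorem genOmStensOm_apply (hω : SmoothPath T ω) {τ : ℝ} (hs : 0 ≤ s) (hsτ : s ≤ τ) (hτt : τ ≤ t)
    (ht : t ≤ T) (E : A) {y : U}
    (hy : ι y = ∫ r in s..τ, D.S (τ - r) (ι (ev (deriv ω r) E))) :
    genOmStensOm β D ι ev ω t s τ E
      = genOmS β D ι ω τ t y + genOmSom β D ι ev ω s τ E
        - genOmS β D ι ω s t (ev (ω τ - ω s) E) := by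
  obtain ⟨M, -, hM'⟩ := hω.exists_bound
  have hτT := hτt.trans ht
  have i3 := D.intervalIntegrable_conv_left (noiseOp ι ev) hsτ (hω.aesm_Ioo hs hτT)
    (SmoothPath.bound_Ioo hM' hs hτT) τ
  have e := ContinuousLinearMap.intervalIntegral_comp_comm (ContinuousLinearMap.apply ℝ V E) i3
  have e' : (∫ r in s..τ, D.S (τ - r) ∘L ι ∘L ev (deriv ω r)) E = ι y := e.symm.trans hy.symm
  rw [genOmStensOm_eq hω hs hsτ hτt ht, sub_apply, add_apply, ContinuousLinearMap.comp_apply, e',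
    genOmS_eq hω (hs.trans hsτ) hτt ht]
  rfl

/-- The decomposition of the area of a path satisfying a mild equation. -/
theorem genArea_eq (hω : SmoothPath T ω) (hs : 0 ≤ s) (hst : s ≤ t) (ht : t ≤ T) {u f : ℝ → V}
    {z : ℝ → U} (hu : ∀ ξ ∈ Ioo s t, u ξ = D.S (ξ - s) (u s) + (∫ r in s..ξ, D.S (ξ - r) (f r))
      + ∫ r in s..ξ, D.S (ξ - r) (ι (z r)))
    (hf : AEStronglyMeasurable f (volume.restrict (Ioo s t))) {Mf : ℝ}
    (hMf : ∀ r ∈ Ioo s t, ‖f r‖ ≤ Mf)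
    (hz : AEStronglyMeasurable z (volume.restrict (Ioo s t))) {Mz : ℝ}
    (hMz : ∀ r ∈ Ioo s t, ‖z r‖ ≤ Mz) :
    genArea β u ω s t = (∫ ξ in s..t, β (D.S (ξ - s) (u s) - u s) (deriv ω ξ))
      + (∫ ξ in s..t, β (∫ r in s..ξ, D.S (ξ - r) (f r)) (deriv ω ξ))
      + ∫ r in s..t, genOmS β D ι ω r t (z r) := by
  rcases hst.eq_or_lt with rfl | hst'
  · simp [genArea]
  obtain ⟨M, hM0, hM'⟩ := hω.exists_bound
  have hM := SmoothPath.bound_Ioo hM' hs ht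
  have hw := hω.aesm_Ioo hs ht
  have key : ∀ x : ℝ → V, AEStronglyMeasurable x (volume.restrict (Ioo s t)) →
      ∀ C, (∀ r ∈ Ioo s t, ‖x r‖ ≤ C) →
      IntervalIntegrable (fun ξ => β (x ξ) (deriv ω ξ)) volume s t := by
    intro x hx C hC
    refine intervalIntegrable_of_const hst (C := ‖β‖ * C * M)
      (β.aestronglyMeasurable_comp₂ hx hw) fun r hr => (β.le_opNorm₂ _ _).trans ?_
    have h1 := hC r hr
    have h2 := hM r hr
    have h3 := (norm_nonneg _).trans h1
    gcongr
  have hιz : AEStronglyMeasurable (fun r => ι (z r)) (volume.restrict (Ioo s t)) :=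
    ι.continuous.comp_aestronglyMeasurable hz
  have hMιz : ∀ r ∈ Ioo s t, ‖ι (z r)‖ ≤ ‖ι‖ * Mz := fun r hr => ι.le_opNorm_of_le (hMz r hr)
  have w1 := D.holder_conv_left (ContinuousLinearMap.id ℝ (V →L[ℝ] V)) hst' (γ := 1 / 2)
    (by norm_num) (by norm_num) hf hMf
  have w2 := D.holder_conv_left (ContinuousLinearMap.id ℝ (V →L[ℝ] V)) hst' (γ := 1 / 2)
    (by norm_num) (by norm_num) hιz hMιz
  obtain ⟨C1, -, hC1⟩ := w1.bdd
  obtain ⟨C2, -, hC2⟩ := w2.bdd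
  have i1 := key (fun ξ => D.S (ξ - s) (u s) - u s)
    (((ContinuousLinearMap.apply ℝ V (u s)).continuous.comp_aestronglyMeasurable
      (D.aesm_S_sub_right s _)).sub aestronglyMeasurable_const) (1 * ‖u s‖ + ‖u s‖)
    fun ξ _ => (norm_sub_le _ _).trans
      (add_le_add_left ((D.S (ξ - s)).le_of_opNorm_le (D.norm_S_le _) _) _)
  have i2 : IntervalIntegrable (fun ξ => β (∫ r in s..ξ, D.S (ξ - r) (f r)) (deriv ω ξ)) volume s t :=
    key _ w1.aesm C1 hC1
  have i3 : IntervalIntegrable (fun ξ => β (∫ r in s..ξ, D.S (ξ - r) (ι (z r))) (deriv ω ξ))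
      volume s t := key _ w2.aesm C2 hC2
  -- Integrating first over the later time ξ turns the semigroup and ω'(ξ) into ω_S(r, t).
  have hfub : ∫ ξ in s..t, β (∫ r in s..ξ, D.S (ξ - r) (ι (z r))) (deriv ω ξ)
      = ∫ r in s..t, genOmS β D ι ω r t (z r) := by
    let g : ℝ → ℝ → W := fun r ξ => tensOp β (D.S (ξ - r)) (deriv ω ξ) (ι (z r))
    have hg : IntegrableOn (fun p : ℝ × ℝ => g p.1 p.2) (tri s t) := by
      refine tri_integrable_const (C := ‖β.flip‖ * M * (‖ι‖ * Mz)) ?_ ?_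
      · exact (ContinuousLinearMap.id ℝ (V →L[ℝ] W)).aestronglyMeasurable_comp₂
          ((tensOp β).aestronglyMeasurable_comp₂ D.aesm_S_tri (aesm_tri_snd hw))
          (aesm_tri_fst hιz)
      · intro r ξ hr hrξ hξ
        have h1 := norm_tensOp_S_le (β := β) (D := D) (ξ - r) (hM ξ ⟨hr.trans hrξ, hξ⟩)
        refine (ContinuousLinearMap.le_of_opNorm_le _ h1 _).trans ?_
        have := hMιz r ⟨hr, hrξ.trans hξ⟩
        gcongr
    have e1 : ∀ ξ ∈ Ioo s t, ∫ r in s..ξ, g r ξ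
        = β (∫ r in s..ξ, D.S (ξ - r) (ι (z r))) (deriv ω ξ) := fun ξ hξ =>
      ContinuousLinearMap.intervalIntegral_comp_comm (β.flip (deriv ω ξ))
        (D.intervalIntegrable_conv_left (ContinuousLinearMap.id ℝ (V →L[ℝ] V)) hξ.1.le
          (aesm_Ioo_mono hιz le_rfl hξ.2.le) (fun r hr => hMιz r ⟨hr.1, hr.2.trans hξ.2⟩) ξ)
    have e2 : ∀ r ∈ Ioo s t, ∫ ξ in r..t, g r ξ = genOmS β D ι ω r t (z r) := by
      intro r hr
      rw [genOmS_eq hω (hs.trans hr.1.le) hr.2.le ht]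
      exact ContinuousLinearMap.intervalIntegral_comp_comm
        (ContinuousLinearMap.apply ℝ W (ι (z r)))
        (hω.tensOp_integrable (hs.trans hr.1.le) hr.2.le ht r)
    rw [← integral_congr_Ioo hst e1, ← (tri_fubini hst hg).2.2, integral_congr_Ioo hst e2]
  rw [← hfub, ← intervalIntegral.integral_add i1 i2, ← intervalIntegral.integral_add (i1.add i2) i3]
  refine integral_congr_Ioo hst fun ξ hξ => ?_
  rw [← add_apply, ← map_add, ← add_apply, ← map_add]
  congr 2
  rw [hu ξ hξ]
  abel

end TensorFormulas

/-! ### Convolutions with values in `V_δ` -/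

namespace EigenData

variable {V : Type*} [NormedAddCommGroup V] [InnerProductSpace ℝ V] [CompleteSpace V]
  (D : EigenData V) (δ : ℝ≥0) {s t M : ℝ}

/-- The isometry `(-A)^δ : V_δ → V`. -/
def Vd.pow : D.Vd δ →L[ℝ] V :=
  LinearMap.mkContinuous (D.e.repr.symm.toLinearEquiv.toLinearMap ∘ₗ Vd.toLp D δ) 1 fun x => by
    rw [one_mul]
    exact (D.e.repr.symm.norm_map _).le

theorem Vd.repr_pow (x : D.Vd δ) (i : ℕ) : D.e.repr (Vd.pow D δ x) i = Vd.toLp D δ x i := by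
  change D.e.repr (D.e.repr.symm (Vd.toLp D δ x)) i = _
  rw [LinearIsometryEquiv.apply_symm_apply]

/-- Convolutions of paths in `V_δ` with the semigroup take values in `V_δ`. -/
theorem exists_conv_mem_Vd (hst : s ≤ t) {z : ℝ → D.Vd δ}
    (hz : AEStronglyMeasurable z (volume.restrict (Ioo s t))) (hM : ∀ r ∈ Ioo s t, ‖z r‖ ≤ M) :
    ∃ y : D.Vd δ, Vd.incl D δ y = ∫ r in s..t, D.S (t - r) (Vd.incl D δ (z r)) := by
  have hi : ∀ L : D.Vd δ →L[ℝ] V, IntervalIntegrable (fun r => D.S (t - r) (L (z r))) volume s t :=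
    fun L => D.intervalIntegrable_conv_left (ContinuousLinearMap.id ℝ (V →L[ℝ] V)) hst
      (L.continuous.comp_aestronglyMeasurable hz) (fun r hr => L.le_opNorm_of_le (hM r hr)) t
  set x := ∫ r in s..t, D.S (t - r) (Vd.incl D δ (z r)) with hx
  set x' := ∫ r in s..t, D.S (t - r) (Vd.pow D δ (z r)) with hx'
  -- The semigroup is diagonal, so λᵢ^δ passes inside the integral. The weighted coordinates of `x`
  -- are those of the V-valued convolution `x'` of (-A)^δ z, hence square summable.
  have key : ∀ i, D.lam i ^ (δ : ℝ) * inner ℝ (D.e i) x = D.e.repr x' i := by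
    intro i
    have e1 := ContinuousLinearMap.intervalIntegral_comp_comm (innerSL ℝ (D.e i))
      (hi (Vd.incl D δ))
    have e2 := ContinuousLinearMap.intervalIntegral_comp_comm (innerSL ℝ (D.e i)) (hi (Vd.pow D δ))
    simp only [innerSL_apply_apply] at e1 e2
    rw [HilbertBasis.repr_apply_apply, hx, hx', ← e1, ← e2, ← intervalIntegral.integral_const_mul]
    congr 1
    funext r
    rw [← HilbertBasis.repr_apply_apply, ← HilbertBasis.repr_apply_apply, repr_S, repr_S,
      Vd.repr_pow, HilbertBasis.repr_apply_apply, Vd.toLp_apply, Vd.incl_apply]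
    ring
  have hmem : Memℓp (fun i => D.lam i ^ (δ : ℝ) * inner ℝ (D.e i) x) 2 := by
    simp only [key]
    exact lp.memℓp _
  exact ⟨Vd.mk D δ x hmem, rfl⟩

end EigenData

theorem WHolder.inner_integrable {X P Y : Type*} [NormedAddCommGroup X] [NormedSpace ℝ X]
    [NormedAddCommGroup P] [NormedSpace ℝ P] [NormedAddCommGroup Y] [NormedSpace ℝ Y]
    {α γ a b : ℝ} {φ : ℝ → P} {y : ℝ → X} (hφ : WHolder γ a b φ) (hy : WHolder γ a b y)
    (hγ1 : γ < 1) (hα0 : 0 ≤ α) (hαγ : α < γ) (B : P →L[ℝ] X →L[ℝ] Y) {r : ℝ} (hr : r ∈ Ioo a b) :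
    IntervalIntegrable (fun q => (r - q) ^ (-(1 + α)) • B (φ q) (y r - y q)) volume a r := by
  obtain ⟨M, hM0, hM⟩ := hφ.bdd
  obtain ⟨K, hK0, hK⟩ := hy.hol
  refine intervalIntegrable_singular hγ1 hα0 hαγ (K := ‖B‖ * M * K) hr.1
    (B.aestronglyMeasurable_comp₂ (aesm_Ioo_mono hφ.aesm le_rfl hr.2.le)
      (aestronglyMeasurable_const.sub (aesm_Ioo_mono hy.aesm le_rfl hr.2.le))) fun q hq => ?_
  refine (B.le_opNorm₂ _ _).trans ?_
  have h1 := hM q ⟨hq.1, hq.2.trans hr.2⟩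
  have h2 := hK q r hq.1 hq.2 hr.2
  calc _ ≤ ‖B‖ * M * (K * (q - a) ^ (-γ) * (r - q) ^ γ) := by gcongr
    _ = _ := by ring

theorem exists_fderiv_bilin_bound {X Y Z : Type*} [NormedAddCommGroup X] [NormedSpace ℝ X]
    [NormedAddCommGroup Y] [NormedSpace ℝ Y] [NormedAddCommGroup Z] [NormedSpace ℝ Z]
    {γ a b : ℝ} (B : X →L[ℝ] Y →L[ℝ] Z) {x : ℝ → X} {y : ℝ → Y} (hx : WHolder γ a b x)
    (hy : WHolder γ a b y) : ∃ M, ∀ r ∈ Ioo a b,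
      ‖fderiv ℝ (fun p : X × Y => B p.1 p.2) (x r, y r)‖ ≤ M := by
  obtain ⟨M₁, hM₁0, hM₁⟩ := hx.bdd
  obtain ⟨M₂, hM₂0, hM₂⟩ := hy.bdd
  refine ⟨‖B‖ * M₁ + ‖B‖ * M₂, fun r hr =>
    ContinuousLinearMap.opNorm_le_bound _ (by positivity) fun p => ?_⟩
  have hB : IsBoundedBilinearMap ℝ fun p : X × Y => B p.1 p.2 := B.isBoundedBilinearMap
  rw [(hB.hasFDerivAt _).fderiv]
  have a1 := hM₁ r hr
  have a2 := hM₂ r hr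
  have a3 : ‖p.1‖ ≤ ‖p‖ := norm_fst_le p
  have a4 : ‖p.2‖ ≤ ‖p‖ := norm_snd_le p
  calc _ ≤ ‖B‖ * ‖x r‖ * ‖p.2‖ + ‖B‖ * ‖p.1‖ * ‖y r‖ :=
        (norm_add_le _ _).trans (add_le_add (B.le_opNorm₂ _ _) (B.le_opNorm₂ _ _))
    _ ≤ ‖B‖ * M₁ * ‖p‖ + ‖B‖ * ‖p‖ * M₂ := by gcongr
    _ = _ := by ring

/-! ### Representation by fractional derivatives -/

section TensorRepresentations

variable {V W U A A₂ : Type*} [NormedAddCommGroup V] [InnerProductSpace ℝ V] [CompleteSpace V]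
  [NormedAddCommGroup W] [NormedSpace ℝ W] [CompleteSpace W]
  [NormedAddCommGroup U] [NormedSpace ℝ U]
  [NormedAddCommGroup A] [NormedSpace ℝ A] [CompleteSpace A]
  [NormedAddCommGroup A₂] [NormedSpace ℝ A₂] [CompleteSpace A₂]
  {β : V →L[ℝ] V →L[ℝ] W} {D : EigenData V} {ι : U →L[ℝ] V} {ev : V →L[ℝ] A →L[ℝ] U}
  {ev₂ : W →L[ℝ] A₂ →L[ℝ] U} {c : (V →L[ℝ] W) →L[ℝ] A₂ →L[ℝ] A}
  {T : ℝ} {ω : ℝ → V} {s q t α γ : ℝ}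

/-- Representation of the rough part of the area by fractional derivatives. -/
theorem noise_integral_eq (hc : ∀ B x E, ev x (c B E) = ev₂ (B x) E) (hω : SmoothPath T ω)
    (hs : 0 ≤ s) (hst : s < t) (ht : t ≤ T) {u : ℝ → V} (hu : WHolder γ s t u) (hγ1 : γ < 1)
    (hα : 1 / 2 < α) (hαγ : α < γ) {G : V → A} (hG : Continuous (fderiv ℝ G)) {CG : ℝ≥0}
    (hGL : LipschitzWith CG G) {DG : V → A₂} {CDG : ℝ≥0} (hDGL : LipschitzWith CDG DG)
    (hDG : ∀ x h, fderiv ℝ G x h = c (β h) (DG x)) :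
    (∀ r ∈ Ioo s t,
      CompFracExists α s G u r ∧
      RightFracExists (1 - α) t (fun ρ => genOmSom β D ι ev ω ρ t - genOmSom β D ι ev ω t t) r ∧
      LeftFracExists (2 * α - 1) s (fun ρ => DG (u ρ)) r ∧
      RightFracTwoExists (1 - α) t (genUomSom β D ι ev₂ u ω t) r ∧
      RightFracExists (1 - α) t (rightFracTwo (1 - α) t (genUomSom β D ι ev₂ u ω t)) r) ∧
    IntervalIntegrable (fun r =>
      rightFrac (1 - α) t (fun ρ => genOmSom β D ι ev ω ρ t - genOmSom β D ι ev ω t t) r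
        (compFrac α s G u r)) volume s t ∧
    IntervalIntegrable (fun r =>
      rightFrac (1 - α) t (rightFracTwo (1 - α) t (genUomSom β D ι ev₂ u ω t)) r
        (leftFrac (2 * α - 1) s (fun ρ => DG (u ρ)) r)) volume s t ∧
    ∫ r in s..t, genOmS β D ι ω r t (ev (deriv ω r) (G (u r)))
      = (∫ r in s..t,
          rightFrac (1 - α) t (fun ρ => genOmSom β D ι ev ω ρ t - genOmSom β D ι ev ω t t) r
            (compFrac α s G u r))
        - ∫ r in s..t,
          rightFrac (1 - α) t (rightFracTwo (1 - α) t (genUomSom β D ι ev₂ u ω t)) r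
            (leftFrac (2 * α - 1) s (fun ρ => DG (u ρ)) r) := by
  obtain ⟨M, -, hM'⟩ := hω.exists_bound
  have hM := SmoothPath.bound_Ioo hM' hs ht
  have hw := hω.aesm_Ioo hs ht
  set k : ℝ → A →L[ℝ] W := fun r => -(genOmS β D ι ω r t ∘L ev (deriv ω r)) with hkdef
  have hk : AEStronglyMeasurable k (volume.restrict (Ioo s t)) :=
    (genOmS_eval_aesm ev hω hs hst.le le_rfl ht hw).neg
  obtain ⟨Ck, hCk'⟩ := genOmS_eval_bound (β := β) (D := D) (ι := ι) ev hω hs le_rfl ht hM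
  have hCk : ∀ r ∈ Ioo s t, ‖k r‖ ≤ Ck := fun r hr => (norm_neg _).trans_le (hCk' r hr)
  let m : V →L[ℝ] (A →L[ℝ] W) →L[ℝ] (A₂ →L[ℝ] W) :=
    (ContinuousLinearMap.compL ℝ A₂ A W).flip ∘L c ∘L β
  let n : A₂ →L[ℝ] (A₂ →L[ℝ] W) →L[ℝ] W := (ContinuousLinearMap.id ℝ (A₂ →L[ℝ] W)).flip
  let B : A →L[ℝ] (A →L[ℝ] W) →L[ℝ] W := (ContinuousLinearMap.id ℝ (A →L[ℝ] W)).flip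
  -- By the compatibility `hc`, the third order tensor is a second order tensor of `u` against the
  -- same density `k` that belongs to (ω ⊗_S ω)(·, t); the minus signs agree.
  have hv : ∀ r τ, s < r → r < τ → τ ≤ t → genUomSom β D ι ev₂ u ω t r τ
      = ∫ ρ in r..τ, m (u ρ - u r) (k ρ) := by
    intro r τ hr hrτ hτ
    rw [genUomSom_eq hω u (hs.trans hr.le) hrτ.le hτ ht, ← intervalIntegral.integral_neg]
    congr 1
    funext ρ
    ext E
    change -(genOmS β D ι ω ρ t (ev₂ (β (u ρ - u r) (deriv ω ρ)) E))
      = -(genOmS β D ι ω ρ t (ev (deriv ω ρ) (c (β (u ρ - u r)) E)))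
    rw [hc]
  have hφ := hu.lipschitz_comp hDGL
  have h2 := WHolder.second_order_parts hst hu hφ hγ1 hα hαγ m n hk hCk hv
  -- This identifies the double integrals of the first and second order formulas, so that they
  -- cancel.
  have hnm : ∀ x h Q, n (DG x) (m h Q) = B (fderiv ℝ G x h) Q := fun x h Q => by
    rw [hDG]
    rfl
  simp only [hnm] at h2
  have hg : ∀ q r, s < q → q ≤ r → r ≤ t →
      genOmSom β D ι ev ω r t - genOmSom β D ι ev ω q t = ∫ ρ in q..r, k ρ :=
    fun q r hq hqr hr => genOmSom_sub hω (hs.trans hq.le) hqr hr ht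
  have h1 := WHolder.compensated_parts hst hu hγ1 (by linarith) hαγ hG (hu.lipschitz_comp hGL)
    (Mf := CG) (fun r _ => norm_fderiv_le_of_lipschitz ℝ hGL) B hk hCk hg h2.2.2.1
  refine ⟨fun r hr => ⟨(h1.1 r hr).1, (h1.1 r hr).2,
    hφ.leftFracExists hγ1 (by linarith) (by linarith) hr, (h2.1 r hr).1, (h2.1 r hr).2⟩,
    h1.2.1, h2.2.1, ?_⟩
  have e : ∫ r in s..t, B (G (u r)) (k r)
      = -∫ r in s..t, genOmS β D ι ω r t (ev (deriv ω r) (G (u r))) := by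
    rw [← intervalIntegral.integral_neg]
    rfl
  have e1 := h1.2.2
  rw [e, neg_neg, ← h2.2.2.2] at e1
  exact eq_sub_of_add_eq e1.symm

/-- Representation of the third order tensor by fractional derivatives. -/
theorem genUomSom_apply_eq (hω : SmoothPath T ω)
    (hs : 0 ≤ s) (hsq : s ≤ q) (hqt : q ≤ t) (ht : t ≤ T) {u : ℝ → V}
    (hu : AEStronglyMeasurable u (volume.restrict (Ioo s q))) {Mu : ℝ}
    (hMu : ∀ r ∈ Ioo s q, ‖u r‖ ≤ Mu) (E : A₂) :
    genUomSom β D ι ev₂ u ω t s q E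
      = -∫ r in s..q, genOmS β D ι ω r t (ev₂ (β (u r - u s) (deriv ω r)) E) := by
  obtain ⟨M, -, hM'⟩ := hω.exists_bound
  have hM := SmoothPath.bound_Ioo hM' hs (hqt.trans ht)
  have hw := hω.aesm_Ioo hs (hqt.trans ht)
  rw [genUomSom_eq hω u hs hsq hqt ht, neg_apply]
  congr 1
  refine (ContinuousLinearMap.intervalIntegral_comp_comm (ContinuousLinearMap.apply ℝ W E)
    (genOmS_eval_integrable ev₂ hω hs hsq hqt ht (M := ‖β‖ * (Mu + ‖u s‖) * M)
      (β.aestronglyMeasurable_comp₂ (hu.sub aestronglyMeasurable_const) hw) fun r hr => ?_)).symm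
  refine (β.le_opNorm₂ _ _).trans ?_
  change ‖β‖ * ‖u r - u s‖ * ‖deriv ω r‖ ≤ _
  have h1 := (norm_sub_le (u r) (u s)).trans (add_le_add_left (hMu r hr) _)
  have h2 := hM r hr
  have h3 := (norm_nonneg _).trans h1
  gcongr

/-- The integrand is the bilinear map `genFE` evaluated along the pair of ω_S(·, t) and the
increment of `u`, against ω'. Its compensation splits by the product rule into a term with the
increment of ω_S and one with the increment of `u`, each equal to a second order integral. -/
theorem genUomSom_representation (hc : ∀ B x E, ev x (c B E) = ev₂ (B x) E) (hω : SmoothPath T ω)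
    (hs : 0 ≤ s) (hsq : s < q) (hqt : q ≤ t) (ht : t ≤ T) {u : ℝ → V} (hu : WHolder γ s q u)
    (hγ1 : γ < 1) (hα : 1 / 2 < α) (hαγ : α < γ) (E : A₂) :
    (∀ r ∈ Ioo s q,
      CompFracExists α s (genFE β ev c E) (fun ρ => (genOmS β D ι ω ρ t, u ρ - u s)) r ∧
      RightFracExists (1 - α) q (fun ρ => ω ρ - ω q) r ∧
      LeftFracExists (2 * α - 1) s (fun ρ => c (β (u ρ - u s)) E) r ∧
      RightFracTwoExists (1 - α) q (genOmStensOm β D ι ev ω t) r ∧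
      RightFracExists (1 - α) q (rightFracTwo (1 - α) q (genOmStensOm β D ι ev ω t)) r ∧
      LeftFracExists (2 * α - 1) s (fun ρ => genOmS β D ι ω ρ t) r ∧
      RightFracTwoExists (1 - α) q (genArea β u ω) r ∧
      RightFracExists (1 - α) q (rightFracTwo (1 - α) q (genArea β u ω)) r) ∧
    IntervalIntegrable (fun r =>
      compFrac α s (genFE β ev c E) (fun ρ => (genOmS β D ι ω ρ t, u ρ - u s)) r
        (rightFrac (1 - α) q (fun ρ => ω ρ - ω q) r)) volume s q ∧
    IntervalIntegrable (fun r =>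
      rightFrac (1 - α) q (rightFracTwo (1 - α) q (genOmStensOm β D ι ev ω t)) r
        (leftFrac (2 * α - 1) s (fun ρ => c (β (u ρ - u s)) E) r)) volume s q ∧
    IntervalIntegrable (fun r =>
      leftFrac (2 * α - 1) s (fun ρ => genOmS β D ι ω ρ t) r
        (ev₂ (rightFrac (1 - α) q (rightFracTwo (1 - α) q (genArea β u ω)) r) E)) volume s q ∧
    genUomSom β D ι ev₂ u ω t s q E
      = (∫ r in s..q,
          compFrac α s (genFE β ev c E) (fun ρ => (genOmS β D ι ω ρ t, u ρ - u s)) r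
            (rightFrac (1 - α) q (fun ρ => ω ρ - ω q) r))
        - (∫ r in s..q,
            rightFrac (1 - α) q (rightFracTwo (1 - α) q (genOmStensOm β D ι ev ω t)) r
              (leftFrac (2 * α - 1) s (fun ρ => c (β (u ρ - u s)) E) r))
        - ∫ r in s..q,
            leftFrac (2 * α - 1) s (fun ρ => genOmS β D ι ω ρ t) r
              (ev₂ (rightFrac (1 - α) q (rightFracTwo (1 - α) q (genArea β u ω)) r) E) := by
  obtain ⟨M, -, hM'⟩ := hω.exists_bound
  have hM := SmoothPath.bound_Ioo hM' hs (hqt.trans ht)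
  have hw := hω.aesm_Ioo hs (hqt.trans ht)
  obtain ⟨Mu, -, hMu⟩ := hu.bdd
  have hO : WHolder γ s q fun r => genOmS β D ι ω r t :=
    genOmS_holder hω hs hsq hqt ht (by linarith) hγ1
  have hus : WHolder γ s q fun r => u r - u s := hu.sub_const (u s)
  let L : V →L[ℝ] V →L[ℝ] U := ev.flip ∘L c.flip E ∘L β
  let b : (U →L[ℝ] W) →L[ℝ] V →L[ℝ] (V →L[ℝ] W) :=
    ((ContinuousLinearMap.compL ℝ V U W).flip ∘L L).flip
  have hb : IsBoundedBilinearMap ℝ (genFE β ev c E) := b.isBoundedBilinearMap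
  let m₁ : (U →L[ℝ] W) →L[ℝ] V →L[ℝ] (A →L[ℝ] W) :=
    ((ContinuousLinearMap.compL ℝ A U W).flip ∘L ev).flip
  let n₁ : A →L[ℝ] (A →L[ℝ] W) →L[ℝ] W := (ContinuousLinearMap.id ℝ (A →L[ℝ] W)).flip
  let n₂ : (U →L[ℝ] W) →L[ℝ] W →L[ℝ] W := (ContinuousLinearMap.compL ℝ W U W).flip (ev₂.flip E)
  have hφ : WHolder γ s q fun r => c (β (u r - u s)) E := hus.clm_comp (c.flip E ∘L β)
  -- Here the increment is that of ω_S(·, t), with `E` applied to the increment of `u` as weight; in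
  -- `h2` the two factors exchange roles.
  have h1 := WHolder.second_order_parts hsq hO hφ hγ1 hα hαγ m₁ n₁ hw hM
    (v := genOmStensOm β D ι ev ω t) fun _ _ _ _ _ => rfl
  have h2 := WHolder.second_order_parts hsq hu hO hγ1 hα hαγ β n₂ hw hM
    (v := genArea β u ω) fun _ _ _ _ _ => rfl
  set J : ℝ → V := fun r => ∫ τ in r..q, (τ - r) ^ (α - 1) • deriv ω τ with hJ
  have hder : ∀ p x : (U →L[ℝ] W) × V, fderiv ℝ (genFE β ev c E) p x = b p.1 x.2 + b x.1 p.2 := by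
    intro p x
    rw [(hb.hasFDerivAt p).fderiv]
    rfl
  obtain ⟨Mf, hMf⟩ := exists_fderiv_bilin_bound b hO hus
  -- The product rule inside the singular integral: the two double integrals add up to the one in
  -- the compensated formula.
  have hin : ∀ r ∈ Ioo s q, (∫ p in s..r, (r - p) ^ (-(1 + α)) •
        n₁ (c (β (u p - u s)) E) (m₁ (genOmS β D ι ω r t - genOmS β D ι ω p t) (J r)))
      + (∫ p in s..r, (r - p) ^ (-(1 + α)) • n₂ (genOmS β D ι ω p t) (β (u r - u p) (J r)))
      = ∫ p in s..r, (r - p) ^ (-(1 + α)) • (ContinuousLinearMap.id ℝ (V →L[ℝ] W))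
        (fderiv ℝ (genFE β ev c E) (genOmS β D ι ω p t, u p - u s)
          ((genOmS β D ι ω r t, u r - u s) - (genOmS β D ι ω p t, u p - u s))) (J r) := by
    intro r hr
    have i1 := hφ.inner_integrable hO hγ1 (by linarith) hαγ
      ((ContinuousLinearMap.compL ℝ (U →L[ℝ] W) (A →L[ℝ] W) W).flip (m₁.flip (J r)) ∘L n₁) hr
    have i2 := hO.inner_integrable hu hγ1 (by linarith) hαγ
      ((ContinuousLinearMap.compL ℝ V W W).flip (β.flip (J r)) ∘L n₂) hr
    refine (intervalIntegral.integral_add i1 i2).symm.trans ?_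
    congr 1
    funext p
    rw [hder, ← smul_add]
    congr 1
    change (genOmS β D ι ω r t - genOmS β D ι ω p t) (ev (J r) (c (β (u p - u s)) E))
      + genOmS β D ι ω p t (ev₂ (β (u r - u p) (J r)) E)
      = genOmS β D ι ω p t (ev (J r) (c (β (u r - u s - (u p - u s))) E))
        + (genOmS β D ι ω r t - genOmS β D ι ω p t) (ev (J r) (c (β (u p - u s)) E))
    rw [sub_sub_sub_cancel_right, hc _ _ E, hc _ _ E, add_comm]
  have hT := (h1.2.2.1.add h2.2.2.1).congr_Ioo hsq.le hin
  have hfd : Continuous (fderiv ℝ (genFE β ev c E)) :=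
    ContDiff.continuous_fderiv (n := 1) hb.contDiff one_ne_zero
  have h3 := WHolder.compensated_parts hsq (hO.prodMk hus) (f := genFE β ev c E) hγ1 (by linarith) hαγ
    hfd (hO.bilin hus b) hMf (ContinuousLinearMap.id ℝ (V →L[ℝ] W)) hw hM
    (g := ω) (fun p r hp hpr hr => (hω.integral_deriv (hs.trans hp.le) hpr (hr.trans (hqt.trans ht))).symm) hT
  refine ⟨fun r hr => ⟨(h3.1 r hr).1, (h3.1 r hr).2,
    hφ.leftFracExists hγ1 (by linarith) (by linarith) hr, (h1.1 r hr).1, (h1.1 r hr).2,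
    hO.leftFracExists hγ1 (by linarith) (by linarith) hr, (h2.1 r hr).1, (h2.1 r hr).2⟩,
    h3.2.1, h1.2.1, h2.2.1, ?_⟩
  have e3 := h3.2.2
  rw [← integral_congr_Ioo hsq.le hin, intervalIntegral.integral_add h1.2.2.1 h2.2.2.1, smul_add,
    ← h1.2.2.2, ← h2.2.2.2] at e3
  have e0 : ∫ r in s..q, (ContinuousLinearMap.id ℝ (V →L[ℝ] W))
      (genFE β ev c E (genOmS β D ι ω r t, u r - u s)) (deriv ω r)
      = ∫ r in s..q, genOmS β D ι ω r t (ev₂ (β (u r - u s) (deriv ω r)) E) := by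
    congr 1
    funext r
    rw [← hc]
    rfl
  rw [genUomSom_apply_eq hω hs hsq.le hqt ht hu.aesm hMu, ← e0]
  have alg : ∀ x c y z : W, c = -x + (y + z) → -x = c - y - z := by
    rintro x c y z rfl
    abel
  exact alg _ _ _ _ e3

end TensorRepresentations

/-! ### The rough part of the area of a mild solution -/

section MildSolutionTensors

variable {V : Type*} [NormedAddCommGroup V] [InnerProductSpace ℝ V] [CompleteSpace V]
  {D : EigenData V} {δ : ℝ≥0} {T : ℝ} {ω : ℝ → V} {F : V → V} {G : V → HSOp V (D.Vd δ)}
  {u₀ : D.Vd δ} {u : ℝ → V} {s t α γ : ℝ}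

theorem HSOp.evalCLM_compL {H K L : Type*} [NormedAddCommGroup H] [InnerProductSpace ℝ H]
    [CompleteSpace H] [NormedAddCommGroup K] [InnerProductSpace ℝ K] [CompleteSpace K]
    [NormedAddCommGroup L] [InnerProductSpace ℝ L] [CompleteSpace L]
    (B : L →L[ℝ] H) (x : L) (E : HSOp H K) :
    HSOp.evalCLM L K x (HSOp.compL H K L B E) = HSOp.evalCLM H K (B x) E := rfl

/-- The area of a mild solution, with the rough part still written in terms of `ω_S`. -/
theorem IsMildSolution.area_eq (hu : IsMildSolution D δ T ω F G u₀ u) (hω : SmoothPath T ω)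
    (hF : Continuous F) (hG : Continuous G) (hs : 0 ≤ s) (hst : s ≤ t) (ht : t ≤ T) :
    area u ω s t
      = (∫ ξ in s..t, tens V (D.S (ξ - s) (u s) - u s) (deriv ω ξ))
        + (∫ ξ in s..t, tens V (∫ r in s..ξ, D.S (ξ - r) (F (u r))) (deriv ω ξ))
        + ∫ r in s..t, omS D δ ω r t ((G (u r)).op (deriv ω r)) := by
  obtain ⟨M1, -, hM1⟩ := exists_bound_of_continuousOn_Icc (hF.comp_continuousOn hu.1)
  obtain ⟨M2, -, hM2⟩ := noise_bound hω hG hu.1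
  exact genArea_eq (β := tens V) (ι := EigenData.Vd.incl D δ)
    (z := fun r => (G (u r)).op (deriv ω r)) hω hs hst ht
    (fun ξ hξ => hu.eq_restart hω hF hG hs hξ.1.le (hξ.2.le.trans ht))
    (aesm_Ioo_mono (aesm_of_continuousOn_Icc (hF.comp_continuousOn hu.1)) hs ht)
    (fun r hr => hM1 r ⟨hs.trans hr.1.le, hr.2.le.trans ht⟩)
    (aesm_Ioo_mono (noise_aesm hω hG hu.1) hs ht)
    (fun r hr => hM2 r ⟨hs.trans_lt hr.1, hr.2.trans_le ht⟩)

theorem fderiv_eq_compL {DG : V → HSOp (HTensor V) (D.Vd δ)}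
    (hDG : ∀ x h k : V, (fderiv ℝ G x h).op k = (DG x).op (tens V h k)) (x h : V) :
    fderiv ℝ G x h = HSOp.compL (HTensor V) (D.Vd δ) V (tens V h) (DG x) := by
  refine HSOp.op_injective ?_
  ext k
  exact hDG x h k

end MildSolutionTensors

end

set_option maxHeartbeats 4000000 in
theorem lemma3p2 {V : Type*} [NormedAddCommGroup V] [InnerProductSpace ℝ V] [CompleteSpace V]
    (D : EigenData V) (δ : ℝ≥0) (hδ : δ ≤ 1)
    (hsum : Summable fun i => D.lam i ^ (-(1 + 2 * (δ : ℝ))))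
    (T : ℝ) (hT : 0 < T) (ω : ℝ → V) (hω : SmoothPath T ω)
    (F : V → V) (hF : ∃ C : ℝ≥0, LipschitzWith C F)
    (G : V → HSOp V (D.Vd δ)) (hG : ContDiff ℝ 2 G) (hGlip : ∃ C : ℝ≥0, LipschitzWith C G)
    (DG : V → HSOp (HTensor V) (D.Vd δ))
    (hDG : ∀ x h k : V, (fderiv ℝ G x h).op k = (DG x).op (tens V h k))
    (hDGlip : ∃ C : ℝ≥0, LipschitzWith C DG)
    (u₀ : D.Vd δ) (u : ℝ → V) (hu : IsMildSolution D δ T ω F G u₀ u)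
    (α : ℝ) (hα : 1 / 2 < α) (hα' : α < 1) :
    -- the tensors are Hilbert--Schmidt
    (∀ s t : ℝ, 0 ≤ s → s ≤ t → t ≤ T → IsHS (omSom D δ ω s t)) ∧
    (∀ s r t : ℝ, 0 ≤ s → s ≤ r → r ≤ t → t ≤ T → IsHS (uomSom D δ u ω t s r)) ∧
    -- the equation for the area
    (∀ s t : ℝ, 0 ≤ s → s ≤ t → t ≤ T →
      (∀ r ∈ Ioo s t,
        CompFracExists α s G u r ∧
        RightFracExists (1 - α) t (fun ρ => omSom D δ ω ρ t - omSom D δ ω t t) r ∧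
        LeftFracExists (2 * α - 1) s (fun ρ => DG (u ρ)) r ∧
        RightFracTwoExists (1 - α) t (uomSom D δ u ω t) r ∧
        RightFracExists (1 - α) t (rightFracTwo (1 - α) t (uomSom D δ u ω t)) r) ∧
      IntervalIntegrable (fun r =>
        rightFrac (1 - α) t (fun ρ => omSom D δ ω ρ t - omSom D δ ω t t) r
          (compFrac α s G u r)) volume s t ∧
      IntervalIntegrable (fun r =>
        rightFrac (1 - α) t (rightFracTwo (1 - α) t (uomSom D δ u ω t)) r
          (leftFrac (2 * α - 1) s (fun ρ => DG (u ρ)) r)) volume s t ∧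
      area u ω s t
        = (∫ ξ in s..t, tens V (D.S (ξ - s) (u s) - u s) (deriv ω ξ))
          + (∫ ξ in s..t, tens V (∫ r in s..ξ, D.S (ξ - r) (F (u r))) (deriv ω ξ))
          + (∫ r in s..t,
              rightFrac (1 - α) t (fun ρ => omSom D δ ω ρ t - omSom D δ ω t t) r
                (compFrac α s G u r))
          - ∫ r in s..t,
              rightFrac (1 - α) t (rightFracTwo (1 - α) t (uomSom D δ u ω t)) r
                (leftFrac (2 * α - 1) s (fun ρ => DG (u ρ)) r)) ∧
    -- the formula for the tensor of `ω_S(t)` and `ω`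
    (∀ (E : HSOp V (D.Vd δ)) (s τ t : ℝ), 0 ≤ s → s ≤ τ → τ ≤ t → t ≤ T →
      ∃ y : D.Vd δ,
        EigenData.Vd.incl D δ y
          = (∫ r in s..τ, D.S (τ - r) (EigenData.Vd.incl D δ (E.op (deriv ω r)))) ∧
        omStensOm D δ ω t s τ E
          = omS D δ ω τ t y + omSom D δ ω s τ E - omS D δ ω s t (E.op (ω τ - ω s))) ∧
    -- the representation of the third-order tensor
    (∀ (E : HSOp (HTensor V) (D.Vd δ)) (s q t : ℝ), 0 ≤ s → s ≤ q → q ≤ t → t ≤ T →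
      uomSom D δ u ω t s q E
        = -(∫ r in s..q, omS D δ ω r t (E.op (tens V (u r - u s) (deriv ω r)))) ∧
      (∀ r ∈ Ioo s q,
        CompFracExists α s (fE E) (fun ρ => (omS D δ ω ρ t, u ρ - u s)) r ∧
        RightFracExists (1 - α) q (fun ρ => ω ρ - ω q) r ∧
        LeftFracExists (2 * α - 1) s (fun ρ => E.comp (tens V (u ρ - u s))) r ∧
        RightFracTwoExists (1 - α) q (omStensOm D δ ω t) r ∧
        RightFracExists (1 - α) q (rightFracTwo (1 - α) q (omStensOm D δ ω t)) r ∧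
        LeftFracExists (2 * α - 1) s (fun ρ => omS D δ ω ρ t) r ∧
        RightFracTwoExists (1 - α) q (area u ω) r ∧
        RightFracExists (1 - α) q (rightFracTwo (1 - α) q (area u ω)) r) ∧
      IntervalIntegrable (fun r =>
        compFrac α s (fE E) (fun ρ => (omS D δ ω ρ t, u ρ - u s)) r
          (rightFrac (1 - α) q (fun ρ => ω ρ - ω q) r)) volume s q ∧
      IntervalIntegrable (fun r =>
        rightFrac (1 - α) q (rightFracTwo (1 - α) q (omStensOm D δ ω t)) r
          (leftFrac (2 * α - 1) s (fun ρ => E.comp (tens V (u ρ - u s))) r)) volume s q ∧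
      IntervalIntegrable (fun r =>
        leftFrac (2 * α - 1) s (fun ρ => omS D δ ω ρ t) r
          (E.op (rightFrac (1 - α) q (rightFracTwo (1 - α) q (area u ω)) r))) volume s q ∧
      uomSom D δ u ω t s q E
        = (∫ r in s..q,
            compFrac α s (fE E) (fun ρ => (omS D δ ω ρ t, u ρ - u s)) r
              (rightFrac (1 - α) q (fun ρ => ω ρ - ω q) r))
          - (∫ r in s..q,
              rightFrac (1 - α) q (rightFracTwo (1 - α) q (omStensOm D δ ω t)) r
                (leftFrac (2 * α - 1) s (fun ρ => E.comp (tens V (u ρ - u s))) r))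
          - ∫ r in s..q,
              leftFrac (2 * α - 1) s (fun ρ => omS D δ ω ρ t) r
                (E.op (rightFrac (1 - α) q (rightFracTwo (1 - α) q (area u ω)) r))) := by
  obtain ⟨CF, hF⟩ := hF
  obtain ⟨CG, hGlip⟩ := hGlip
  obtain ⟨CDG, hDGlip⟩ := hDGlip
  -- The midpoint of α and 1 serves as Hölder exponent; any exponent strictly between them would do.
  have hγ1 : (1 + α) / 2 < 1 := by linarith
  have hαγ : α < (1 + α) / 2 := by linarith
  have hγ0 : 0 < (1 + α) / 2 := by linarith
  have hGd : Continuous (fderiv ℝ G) := hG.continuous_fderiv two_ne_zero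
  have hold : ∀ s t, 0 ≤ s → t ≤ T → WHolder ((1 + α) / 2) s t u := fun s t hs ht =>
    ((hu.holder hω hF.continuous hGlip.continuous hT hγ0 hγ1).mono ht).mono_left hγ0.le hs
  refine ⟨fun s t hs hst ht => genOmSom_isHS hsum hω hs hst ht,
    fun s r t hs hsr hrt ht => genUomSom_isHS hsum hω hu.1 hs hsr hrt ht,
    fun s t hs hst ht => ?_, fun E s τ t hs hsτ hτt ht => ?_, fun E s q t hs hsq hqt ht => ?_⟩
  · have harea := hu.area_eq hω hF.continuous hGlip.continuous hs hst ht
    -- Integration by parts needs a nondegenerate interval; for s = t all terms vanish.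
    rcases hst.eq_or_lt with rfl | hst
    · refine ⟨fun r hr => absurd (hr.1.trans hr.2) (lt_irrefl _), IntervalIntegrable.refl,
        IntervalIntegrable.refl, ?_⟩
      rw [harea]
      simp only [intervalIntegral.integral_same, sub_zero]
    -- The tensors of the statement are by definition the general ones for the Hilbert tensor
    -- product, evaluation of Hilbert–Schmidt operators, and composition in the role of `c`.
    · obtain ⟨h1, h2, h3, h4⟩ := noise_integral_eq (β := tens V) (D := D)
        (ι := EigenData.Vd.incl D δ) (ev := HSOp.evalCLM V (D.Vd δ))
        (ev₂ := HSOp.evalCLM (HTensor V) (D.Vd δ)) (c := HSOp.compL (HTensor V) (D.Vd δ) V)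
        HSOp.evalCLM_compL hω hs hst ht (hold s t hs ht) hγ1 hα hαγ hGd hGlip hDGlip
        (fderiv_eq_compL hDG)
      refine ⟨h1, h2, h3, ?_⟩
      rw [harea, add_sub_assoc]
      exact congrArg _ h4
  · obtain ⟨M, -, hM⟩ := hω.exists_bound
    have hτT := hτt.trans ht
    obtain ⟨y, hy⟩ := D.exists_conv_mem_Vd δ hsτ
      (E.op.continuous.comp_aestronglyMeasurable (hω.aesm_Ioo hs hτT))
      fun r hr => E.op.le_opNorm_of_le (SmoothPath.bound_Ioo hM hs hτT r hr)
    exact ⟨y, hy, genOmStensOm_apply (β := tens V) (ι := EigenData.Vd.incl D δ)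
      (ev := HSOp.evalCLM V (D.Vd δ)) hω hs hsτ hτt ht E hy⟩
  · have hold' := hold s q hs (hqt.trans ht)
    obtain ⟨Mu, -, hMu⟩ := hold'.bdd
    refine ⟨genUomSom_apply_eq (β := tens V) (ι := EigenData.Vd.incl D δ)
      (ev₂ := HSOp.evalCLM (HTensor V) (D.Vd δ)) hω hs hsq hqt ht hold'.aesm hMu E, ?_⟩
    rcases hsq.eq_or_lt with rfl | hsq
    · refine ⟨fun r hr => absurd (hr.1.trans hr.2) (lt_irrefl _), IntervalIntegrable.refl,
        IntervalIntegrable.refl, IntervalIntegrable.refl, ?_⟩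
      simp only [uomSom, intervalIntegral.integral_same, sub_zero, neg_zero, zero_apply]
    · exact genUomSom_representation (β := tens V) (D := D) (ι := EigenData.Vd.incl D δ)
        (ev := HSOp.evalCLM V (D.Vd δ)) (ev₂ := HSOp.evalCLM (HTensor V) (D.Vd δ))
        (c := HSOp.compL (HTensor V) (D.Vd δ) V) HSOp.evalCLM_compL hω hs hsq hqt ht hold' hγ1 hα
        hαγ E
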